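/- Let $r\ge 1$ be fixed. Consider the problem $$(\ast)\qquad \max\{f(Ax) : x\in X\},$$ where $A\in\mathbb R^{r\times n}$ has full row rank $r$, $f:\mathbb R^r\to\mathbb R$ is convex, $X\subseteq\mathbb R^n$, and an optimal solution exists. Suppose that $X=S\cap P$, where - $P=\{x\in\mathbb R^n : Mx\le b\}$ with $M\in\mathbb R^{m\times n}$, $b\in\mathbb R^m$; - $S\subseteq\{0,1\}^n$ is standard comonotone: for every permutation $\pi$ of $[n]$ and every $v\in\mathbb R^n$ with $v_{\pi(1)}\ge\dots\ge v_{\pi(n)}$, if $\max_{x\in S}v^\top x$ is attained, then it is attained at some $x^*\in S$ with $x^*_{\pi(1)}\ge\dots\ge x^*_{\pi(n)}$; - $\operatorname{conv}(S\cap P)=\operatorname{conv}(S)\cap P$. Let two subroutines be given. (1) For any $I\subseteq[n]$, the first one returns, within time $\mathsf T_1$, an optimal solution and the optimal value of $\max\{f(Ax) : x\in X,\ \operatorname{supp}(x)=I\}$, or certifies that no optimal solution exists. (2) For any $(c,\lambda,\gamma)\in\mathbb R^r\times\mathbb R\times\mathbb R^m$, the second one returns, within time $\mathsf{LP}$, a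 minimizer and a maximizer of $\sum_i x_i$ over the set of all $x\in X$ such that $x_i=1$ whenever $(A^\top c-M^\top\gamma)_i>\lambda$, $x_i=0$ whenever $(A^\top c-M^\top\gamma)_i<\lambda$, and $(Mx)_j=b_j$ whenever $\gamma_j\ne0$; or it certifies that this set is empty. The times include the transfer of the $n$-dimensional answers, so that $\mathsf T_1+\mathsf{LP}\ge n$. Then $(\ast)$ can be solved in time $$\mathcal O\big((n+m)^{r+m}\cdot(\mathsf T_1+\mathsf{LP})\big),$$ where the constant depends only on $r$. More precisely, there is one real-RAM program (unit-cost arithmetic and comparisons on real numbers, indices computed by addition and subtraction) which, on input $(r,n,m,A,M,b)$ and with access to $f$, $S$ and $X$ only through calls of the two subroutines (charged $\mathsf T_1$ and $\mathsf{LP}$ steps), halts within this number of steps and returns an optimal solution of $(\ast)$ and its value. -/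

import Mathlib

open scoped Matrix

namespace ConvexMax

/-! ## Comonotone sets -/

/-- `x` is a global maximizer of `g` over `D`. -/
def IsMaximizer {α : Type*} (g : α → ℝ) (D : Set α) (x : α) : Prop :=
  x ∈ D ∧ IsMaxOn g D x

/-- `x` is a global minimizer of `g` over `D`. -/
def IsMinimizer {α : Type*} (g : α → ℝ) (D : Set α) (x : α) : Prop :=
  x ∈ D ∧ IsMinOn g D x

/-- The cone `{x : x (π 1) ≥ ⋯ ≥ x (π n)}` of the vectors sorted by `π`. -/
def sortedCone {n : ℕ} (π : Equiv.Perm (Fin n)) : Set (Fin n → ℝ) :=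
  {x | Antitone fun i => x (π i)}

/-- `X` is comonotone with the permutation mapping `Ψ`: for every cost vector `v` sorted by `π`,
if `v ⬝ᵥ x` attains its maximum over `X`, then some maximizer is sorted by `Ψ π`. -/
def ComonotoneUnder {n : ℕ} (Ψ : Equiv.Perm (Fin n) → Equiv.Perm (Fin n))
    (X : Set (Fin n → ℝ)) : Prop :=
  ∀ π : Equiv.Perm (Fin n), ∀ v ∈ sortedCone π,
    (∃ x, IsMaximizer (fun y => v ⬝ᵥ y) X x) →
      ∃ x ∈ sortedCone (Ψ π), IsMaximizer (fun y => v ⬝ᵥ y) X x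

/-- Standard comonotone sets: the permutation mapping can be taken to be the identity. -/
def StandardComonotone {n : ℕ} (X : Set (Fin n → ℝ)) : Prop :=
  ComonotoneUnder id X

/-- `S ⊆ {0,1}ⁿ`. -/
def IsBinary {n : ℕ} (S : Set (Fin n → ℝ)) : Prop :=
  ∀ x ∈ S, ∀ i, x i = 0 ∨ x i = 1

/-- The polyhedron `P = {x : M x ≤ b}`. -/
def polyhedron {n m : ℕ} (M : Matrix (Fin m) (Fin n) ℝ) (b : Fin m → ℝ) : Set (Fin n → ℝ) :=
  {x | ∀ j, (M *ᵥ x) j ≤ b j}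

/-! ## The two families of subproblems -/

/-- The support of a vector. -/
noncomputable def supp {n : ℕ} (x : Fin n → ℝ) : Finset (Fin n) :=
  {i | x i ≠ 0}

/-- The points `x` with `x i = 1` where `(Aᵀ c - Mᵀ γ) i > lam` and `x i = 0` where
`(Aᵀ c - Mᵀ γ) i < lam`. -/
def thresholdSet {r n m : ℕ} (A : Matrix (Fin r) (Fin n) ℝ) (M : Matrix (Fin m) (Fin n) ℝ)
    (c : Fin r → ℝ) (lam : ℝ) (γ : Fin m → ℝ) : Set (Fin n → ℝ) :=
  {x | ∀ i, (lam < (Aᵀ *ᵥ c - Mᵀ *ᵥ γ) i → x i = 1) ∧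
            ((Aᵀ *ᵥ c - Mᵀ *ᵥ γ) i < lam → x i = 0)}

/-- The points at which every constraint with a nonzero multiplier is tight. -/
def tightSet {n m : ℕ} (M : Matrix (Fin m) (Fin n) ℝ) (b γ : Fin m → ℝ) : Set (Fin n → ℝ) :=
  {x | ∀ j, γ j ≠ 0 → (M *ᵥ x) j = b j}

/-- The two subroutines that an algorithm may call, as black boxes, with the (worst-case)
time `T₁` and `LP` that one call of each of them takes. -/
structure Oracles (r n m : ℕ) where
  /-- Input: a support. Output: a point and its objective value, or nothing. -/
  support : Finset (Fin n) → Option ((Fin n → ℝ) × ℝ)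
  /-- Input: `c`, `lam`, `γ`. Output: two points, or nothing. -/
  lp : (Fin r → ℝ) → ℝ → (Fin m → ℝ) → Option ((Fin n → ℝ) × (Fin n → ℝ))
  T₁ : ℕ
  LP : ℕ

/-- The first subroutine solves `max {f (A x) : x ∈ X, supp x = I}` for every `I ⊆ [n]`: it returns
an optimal solution with the optimal value, or certifies that no optimal solution exists. -/
def Oracles.SolvesFixedSupport {r n m : ℕ} (O : Oracles r n m) (A : Matrix (Fin r) (Fin n) ℝ)
    (f : (Fin r → ℝ) → ℝ) (X : Set (Fin n → ℝ)) : Prop :=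
  ∀ I : Finset (Fin n),
    (∀ x val, O.support I = some (x, val) →
      IsMaximizer (fun y => f (A *ᵥ y)) {y ∈ X | supp y = I} x ∧ val = f (A *ᵥ x)) ∧
    (O.support I = none →
      ¬ ∃ x, IsMaximizer (fun y => f (A *ᵥ y)) {y ∈ X | supp y = I} x)

/-- The second subroutine minimizes and maximizes `∑ i, x i` over
`thresholdSet A M c lam γ ∩ X ∩ tightSet M b γ` for all `c`, `lam`, `γ`: it returns a minimizer and
a maximizer, or certifies that this set is empty. -/
def Oracles.SolvesLP {r n m : ℕ} (O : Oracles r n m) (A : Matrix (Fin r) (Fin n) ℝ)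
    (M : Matrix (Fin m) (Fin n) ℝ) (b : Fin m → ℝ) (X : Set (Fin n → ℝ)) : Prop :=
  ∀ (c : Fin r → ℝ) (lam : ℝ) (γ : Fin m → ℝ),
    (∀ x y, O.lp c lam γ = some (x, y) →
      IsMinimizer (fun z => ∑ i, z i) (thresholdSet A M c lam γ ∩ X ∩ tightSet M b γ) x ∧
      IsMaximizer (fun z => ∑ i, z i) (thresholdSet A M c lam γ ∩ X ∩ tightSet M b γ) y) ∧
    (O.lp c lam γ = none → thresholdSet A M c lam γ ∩ X ∩ tightSet M b γ = ∅)

/-! ## The machine: a real RAM with two subroutines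

Memory consists of one-dimensional arrays of natural numbers and two-dimensional arrays of real
numbers, addressed by computed indices. Arithmetic operations, comparisons, memory accesses and
assignments take one step each. -/

/-- Memory: `nat k i` is entry `i` of integer array `k`, and `real k i j` is entry `(i, j)` of
real array `k`. -/
structure State where
  nat : ℕ → ℕ → ℕ
  real : ℕ → ℕ → ℕ → ℝ

/-- Integer expressions. -/
inductive NExp where
  | const (a : ℕ)
  | get (k : ℕ) (i : NExp)
  | add (a b : NExp)
  | sub (a b : NExp)

/-- Real expressions; the only constants are natural numbers. -/
inductive RExp where
  | const (a : ℕ)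
  | get (k : ℕ) (i j : NExp)
  | add (a b : RExp)
  | sub (a b : RExp)
  | mul (a b : RExp)
  | div (a b : RExp)

/-- Comparisons. -/
inductive Test where
  | natLt (a b : NExp)
  | realLt (a b : RExp)

/-- Programs. -/
inductive Prog where
  | setNat (k : ℕ) (i e : NExp)
  | setReal (k : ℕ) (i j : NExp) (e : RExp)
  | seq (p q : Prog)
  | branch (t : Test) (p q : Prog)
  | loop (t : Test) (p : Prog)
  | callSupport
  | callLP

/-- Value of an integer expression (subtraction is truncated at `0`). -/
def NExp.eval (s : State) : NExp → ℕ
  | .const a => a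
  | .get k i => s.nat k (i.eval s)
  | .add a b => a.eval s + b.eval s
  | .sub a b => a.eval s - b.eval s

/-- Number of steps for the evaluation of an integer expression. -/
def NExp.cost : NExp → ℕ
  | .const _ => 1
  | .get _ i => i.cost + 1
  | .add a b => a.cost + b.cost + 1
  | .sub a b => a.cost + b.cost + 1

/-- Value of a real expression (division by `0` gives `0`). -/
noncomputable def RExp.eval (s : State) : RExp → ℝ
  | .const a => a
  | .get k i j => s.real k (i.eval s) (j.eval s)
  | .add a b => a.eval s + b.eval s
  | .sub a b => a.eval s - b.eval s
  | .mul a b => a.eval s * b.eval s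
  | .div a b => a.eval s / b.eval s

/-- Number of steps for the evaluation of a real expression. -/
def RExp.cost : RExp → ℕ
  | .const _ => 1
  | .get _ i j => i.cost + j.cost + 1
  | .add a b => a.cost + b.cost + 1
  | .sub a b => a.cost + b.cost + 1
  | .mul a b => a.cost + b.cost + 1
  | .div a b => a.cost + b.cost + 1

/-- Outcome of a comparison. -/
def Test.holds (s : State) : Test → Prop
  | .natLt a b => a.eval s < b.eval s
  | .realLt a b => a.eval s < b.eval s

/-- Number of steps for a comparison. -/
def Test.cost : Test → ℕ
  | .natLt a b => a.cost + b.cost + 1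
  | .realLt a b => a.cost + b.cost + 1

/-- Write `v` to entry `i` of integer array `k`. -/
def State.setNat (s : State) (k i v : ℕ) : State where
  nat := fun k' i' => if k' = k ∧ i' = i then v else s.nat k' i'
  real := s.real

/-- Write `v` to entry `(i, j)` of real array `k`. -/
def State.setReal (s : State) (k i j : ℕ) (v : ℝ) : State where
  nat := s.nat
  real := fun k' i' j' => if k' = k ∧ i' = i ∧ j' = j then v else s.real k' i' j'

/-- Write the vector `v` to the first entries of row `i` of real array `k`. -/
def State.setVec {l : ℕ} (s : State) (k i : ℕ) (v : Fin l → ℝ) : State where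
  nat := s.nat
  real := fun k' i' j' =>
    if h : j' < l then (if k' = k ∧ i' = i then v ⟨j', h⟩ else s.real k' i' j')
    else s.real k' i' j'

/-- Read a vector from row `i` of real array `k`. -/
def State.getVec (s : State) (l k i : ℕ) : Fin l → ℝ := fun j => s.real k i j

/-- A call of the first subroutine. The support is read from integer array `1` (nonzero entries).
Entry `0` of integer array `2` receives `1` or `0` according to whether a point is returned; if so,
the point goes to row `0` and its objective value to entry `(1, 0)` of real array `4`. -/
def State.afterSupport {r n m : ℕ} (s : State) (O : Oracles r n m) : State :=
  match O.support {i | s.nat 1 i ≠ 0} with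
  | none => s.setNat 2 0 0
  | some (x, val) => ((s.setNat 2 0 1).setVec 4 0 x).setReal 4 1 0 val

/-- A call of the second subroutine. The input `c`, `lam`, `γ` is read from row `0`,
entry `(1, 0)` and row `2` of real array `3`. Entry `1` of integer array `2` receives `1` or `0`
according to whether points are returned; if so, they go to rows `0` and `1` of real array `5`. -/
def State.afterLP {r n m : ℕ} (s : State) (O : Oracles r n m) : State :=
  match O.lp (s.getVec r 3 0) (s.real 3 1 0) (s.getVec m 3 2) with
  | none => s.setNat 2 1 0
  | some (x, y) => ((s.setNat 2 1 1).setVec 5 0 x).setVec 5 1 y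

/-- `Exec O p s s' t`: started in `s`, the program `p` halts in `s'` after exactly `t` steps, where
a call of a subroutine counts for `O.T₁` respectively `O.LP` steps (plus one for the call). -/
inductive Exec {r n m : ℕ} (O : Oracles r n m) : Prog → State → State → ℕ → Prop where
  | setNat (k : ℕ) (i e : NExp) (s : State) :
      Exec O (.setNat k i e) s (s.setNat k (i.eval s) (e.eval s)) (i.cost + e.cost + 1)
  | setReal (k : ℕ) (i j : NExp) (e : RExp) (s : State) :
      Exec O (.setReal k i j e) s (s.setReal k (i.eval s) (j.eval s) (e.eval s))
        (i.cost + j.cost + e.cost + 1)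
  | seq {p q : Prog} {s s' s'' : State} {t t' : ℕ}
      (h : Exec O p s s' t) (h' : Exec O q s' s'' t') : Exec O (.seq p q) s s'' (t + t')
  | branchTrue {c : Test} {p q : Prog} {s s' : State} {t : ℕ}
      (hc : c.holds s) (h : Exec O p s s' t) : Exec O (.branch c p q) s s' (c.cost + t)
  | branchFalse {c : Test} {p q : Prog} {s s' : State} {t : ℕ}
      (hc : ¬ c.holds s) (h : Exec O q s s' t) : Exec O (.branch c p q) s s' (c.cost + t)
  | loopTrue {c : Test} {p : Prog} {s s' s'' : State} {t t' : ℕ}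
      (hc : c.holds s) (h : Exec O p s s' t) (h' : Exec O (.loop c p) s' s'' t') :
      Exec O (.loop c p) s s'' (c.cost + t + t')
  | loopFalse {c : Test} {p : Prog} {s : State}
      (hc : ¬ c.holds s) : Exec O (.loop c p) s s c.cost
  | callSupport (s : State) : Exec O .callSupport s (s.afterSupport O) (O.T₁ + 1)
  | callLP (s : State) : Exec O .callLP s (s.afterLP O) (O.LP + 1)

/-- Initial memory: integer array `0` holds `r, n, m`, and real arrays `0`, `1` and row `0` of real
array `2` hold `A`, `M` and `b`; all other entries are `0`. In particular, the sets `S` and `X` and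
the function `f` are accessible through the subroutines only. -/
def input {r n m : ℕ} (A : Matrix (Fin r) (Fin n) ℝ) (M : Matrix (Fin m) (Fin n) ℝ)
    (b : Fin m → ℝ) : State where
  nat := fun k i =>
    if k = 0 then (if i = 0 then r else if i = 1 then n else if i = 2 then m else 0) else 0
  real := fun k i j =>
    if k = 0 then (if h : i < r ∧ j < n then A ⟨i, h.1⟩ ⟨j, h.2⟩ else 0)
    else if k = 1 then (if h : i < m ∧ j < n then M ⟨i, h.1⟩ ⟨j, h.2⟩ else 0)
    else if k = 2 then (if h : i = 0 ∧ j < m then b ⟨j, h.2⟩ else 0)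
    else 0

/-- The computed point: row `0` of real array `6`. -/
def outputPoint (n : ℕ) (s : State) : Fin n → ℝ := s.getVec n 6 0

/-- The computed objective value: entry `(1, 0)` of real array `6`. -/
def outputValue (s : State) : ℝ := s.real 6 1 0

end ConvexMax

open ConvexMax

/-!
The algorithm enumerates candidate vectors `w = (c, lam, γ)` in dimension `d = r + 1 + m`, calls the
second subroutine with each of them, calls the first subroutine with the supports of the two points
returned, and keeps the best answer. The first subroutine merely evaluates the objective, since a
binary point is determined by its support (`IsBinary.eq_of_supp_eq`).

*One good vector exists.* The convex function `f (A x)` is maximized over the finite set `X` at a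
point `x₀` that also maximizes a linear function `c ⬝ᵥ A x`, where `c` may avoid finitely many
proper subspaces (`exists_generic_objective`). As `conv (S ∩ P) = conv S ∩ P`, Farkas' lemma gives
multipliers `γ` satisfying complementary slackness such that `x₀` maximizes `Aᵀ c - Mᵀ γ` over all
of `S` (`exists_multiplier`). Every maximizer over a standard comonotone binary set is sorted by the
objective (`IsBinary.maximizer_sorted`), so there is a threshold `lam` (`exists_threshold`), and
`x₀` is feasible for the subproblem of `(c, lam, γ)`.

*Finitely many vectors suffice.* The subproblem depends only on the signs at `w` of the `d`
coordinates and of the `n` functionals `(Aᵀ c - Mᵀ γ) i - lam`, and it gets larger if `w` moves to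
the boundary of its face of this central arrangement (`feasible_mono`). For fixed `c`, the pair
`(lam, γ)` is moved until the functionals vanishing at `w` determine it (`exists_basic_point`); then
`m + 1` of them do (`exists_separating_subset`), and their common kernel `V` has dimension `r` and
is parametrized by `c`. As `c` is generic, `w` lies in an open face of the arrangement induced on
`V`, and a point of this face can be computed from a flag of `r` functionals: one starts at the
origin and perturbs into the successive faces of the flag (`FlagRel`, `exists_flag`). The functional
selected last can be taken among the coordinates of `c` and their negatives. Both signs of each of
the `d + n` functionals being listed, there are `Q = 2 (d + n)` of them to choose from, and the
number of selections is `C(Q, m + 1) * 2 r * Q ^ (r - 1)`.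

*Two points suffice for each vector.* On the feasible set of the subproblem at such a `w`, the
point `A x` varies on a line, on which its position is determined by `∑ i, x i`. A convex function
is therefore maximized at a point of least or of greatest sum (`feasible_max_le`).

*Time.* A selection costs `O (d ^ 3 (T₁ + LP))` steps: Gaussian elimination along the selected
functionals gives the directions of the flag (`runs_step`), and explicit step lengths give `w`
(`runs_perturb`). The factorial in `C(Q, m + 1) ≤ Q ^ (m + 1) / (m + 1)!` absorbs `d ^ 3` and the
powers `Q ^ (r + m) ≤ (6 (n + m)) ^ (r + m)` up to a constant depending on `r` only
(`exists_enumeration_bound`). The increasing sequences are enumerated in colexicographic order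
(`colexRank_next`), and the remaining `r` functionals by an odometer (`runs_odometer`).
-/

namespace ConvexMax

/-! ### Lagrange multipliers from Farkas' lemma -/

/-- **Farkas' lemma** for finitely many linear functionals on an arbitrary real vector space. The
induction on the number of functionals projects along a point violating the last one. -/
theorem farkas {E ι : Type*} [AddCommGroup E] [Module ℝ E] [DecidableEq ι] (s : Finset ι)
    (a : ι → E →ₗ[ℝ] ℝ) (b : E →ₗ[ℝ] ℝ) (h : ∀ x, (∀ i ∈ s, 0 ≤ a i x) → 0 ≤ b x) :
    ∃ c : ι → ℝ, (∀ i ∈ s, 0 ≤ c i) ∧ ∀ x, b x = ∑ i ∈ s, c i * a i x := by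
  induction s using Finset.induction_on generalizing a b with
  | empty =>
    refine ⟨0, by simp, fun x => ?_⟩
    have h1 := h x (by simp)
    have h2 := h (-x) (by simp)
    simp only [map_neg] at h2
    simp only [Finset.sum_empty]
    linarith
  | insert k s hk ih =>
    by_cases hs : ∀ x, (∀ i ∈ s, 0 ≤ a i x) → 0 ≤ b x
    · obtain ⟨c, hc, hb⟩ := ih a b hs
      refine ⟨fun i => if i = k then 0 else c i, fun i hi => ?_, fun x => ?_⟩
      · by_cases hik : i = k
        · simp [hik]
        · simpa [hik] using hc i ((Finset.mem_insert.1 hi).resolve_left hik)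
      · rw [Finset.sum_insert hk, hb x]
        simp only [if_true, zero_mul, zero_add]
        exact Finset.sum_congr rfl fun i hi => by
          rw [if_neg (fun e : i = k => hk (e ▸ hi))]
    · push Not at hs
      obtain ⟨y, hy, hby⟩ := hs
      have hky : a k y < 0 := by
        by_contra hcon
        push Not at hcon
        refine absurd (h y fun i hi => ?_) (not_le.2 hby)
        rcases Finset.mem_insert.1 hi with rfl | hi
        · exact hcon
        · exact hy i hi
      -- The point `z` is scaled so that `x ↦ x + a k x • z` maps into the kernel of `a k`.
      set z : E := (-(a k y))⁻¹ • y with hz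
      have hpos : 0 < (-(a k y))⁻¹ := inv_pos.2 (by linarith)
      have hkz : a k z = -1 := by
        have : a k y ≠ 0 := hky.ne
        simp only [hz, map_smul, smul_eq_mul]
        field_simp
      have hzs : ∀ i ∈ s, 0 ≤ a i z := fun i hi => by
        simp only [hz, map_smul, smul_eq_mul]
        exact mul_nonneg hpos.le (hy i hi)
      have hbz : b z < 0 := by
        simp only [hz, map_smul, smul_eq_mul]
        exact mul_neg_of_pos_of_neg hpos hby
      obtain ⟨c, hc, hb⟩ := ih (fun i => a i + (a i z) • a k) (b + (b z) • a k) (by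
        intro x hx
        have := h (x + a k x • z) (fun i hi => by
          rcases Finset.mem_insert.1 hi with rfl | hi
          · simp [hkz]
          · have := hx i hi
            simp only [LinearMap.add_apply, LinearMap.smul_apply, smul_eq_mul] at this
            simp only [map_add, map_smul, smul_eq_mul]
            linarith)
        simp only [map_add, map_smul, smul_eq_mul] at this
        simp only [LinearMap.add_apply, LinearMap.smul_apply, smul_eq_mul]
        linarith)
      refine ⟨fun i => if i = k then ∑ j ∈ s, c j * a j z - b z else c i, fun i hi => ?_,
        fun x => ?_⟩
      · by_cases hik : i = k
        · have : 0 ≤ ∑ j ∈ s, c j * a j z :=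
            Finset.sum_nonneg fun j hj => mul_nonneg (hc j hj) (hzs j hj)
          simp only [hik, if_true]
          linarith
        · simpa [hik] using hc i ((Finset.mem_insert.1 hi).resolve_left hik)
      · rw [Finset.sum_insert hk]
        have h1 := hb x
        simp only [LinearMap.add_apply, LinearMap.smul_apply, smul_eq_mul] at h1
        have h2 : ∑ i ∈ s, (if i = k then ∑ j ∈ s, c j * a j z - b z else c i) * a i x
            = ∑ i ∈ s, c i * a i x :=
          Finset.sum_congr rfl fun i hi => by rw [if_neg (fun e : i = k => hk (e ▸ hi))]
        have h3 : ∑ i ∈ s, c i * (a i x + a i z * a k x)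
            = ∑ i ∈ s, c i * a i x + (∑ i ∈ s, c i * a i z) * a k x := by
          rw [Finset.sum_mul, ← Finset.sum_add_distrib]
          exact Finset.sum_congr rfl fun i _ => by ring
        rw [h2]
        simp only [if_true]
        rw [h3] at h1
        linarith

/-- Lagrangian duality: if `conv (S ∩ P) = conv S ∩ P`, then a maximizer of a linear functional over
`S ∩ P` maximizes, for suitable multipliers of the constraints of `P`, the Lagrangian over all of
`S`, and it satisfies complementary slackness. -/
theorem exists_multiplier {n m : ℕ} {S : Set (Fin n → ℝ)} (hS : S.Finite)
    (M : Matrix (Fin m) (Fin n) ℝ) (b : Fin m → ℝ) (u : Fin n → ℝ)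
    (hconv : convexHull ℝ (S ∩ polyhedron M b) = convexHull ℝ S ∩ polyhedron M b)
    {x₀ : Fin n → ℝ} (hx₀ : IsMaximizer (fun y => u ⬝ᵥ y) (S ∩ polyhedron M b) x₀) :
    ∃ γ : Fin m → ℝ, (∀ j, γ j ≠ 0 → (M *ᵥ x₀) j = b j) ∧
      ∀ x ∈ S, (u - Mᵀ *ᵥ γ) ⬝ᵥ x ≤ (u - Mᵀ *ᵥ γ) ⬝ᵥ x₀ := by
  classical
  have : Fintype S := hS.fintype
  set val := u ⬝ᵥ x₀ with hval
  obtain ⟨⟨hx₀S, hx₀P⟩, hmax⟩ := hx₀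
  -- It suffices to find nonnegative multipliers that bound the Lagrangian on `S`.
  suffices H : ∃ γ : Fin m → ℝ, (∀ j, 0 ≤ γ j) ∧
      ∀ x ∈ S, 0 ≤ ∑ j, γ j * ((M *ᵥ x) j - b j) + (val - u ⬝ᵥ x) by
    obtain ⟨γ, hγ, hL⟩ := H
    have key : ∀ x, (u - Mᵀ *ᵥ γ) ⬝ᵥ x = u ⬝ᵥ x - ∑ j, γ j * (M *ᵥ x) j := fun x => by
      rw [sub_dotProduct, Matrix.mulVec_transpose, ← Matrix.dotProduct_mulVec]
      rfl
    have hterm : ∀ j, γ j * ((M *ᵥ x₀) j - b j) ≤ 0 := fun j =>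
      mul_nonpos_of_nonneg_of_nonpos (hγ j) (sub_nonpos.2 (hx₀P j))
    have hsum : ∑ j, γ j * ((M *ᵥ x₀) j - b j) = 0 :=
      le_antisymm (Finset.sum_nonpos fun j _ => hterm j) (by simpa [hval] using hL x₀ hx₀S)
    have hz := (Finset.sum_eq_zero_iff_of_nonpos fun j _ => hterm j).1 hsum
    refine ⟨γ, fun j hj => ?_, fun x hx => ?_⟩
    · have := hz j (Finset.mem_univ j)
      have := (mul_eq_zero.1 this).resolve_left hj
      linarith
    · rw [key, key]
      have h1 := hL x hx
      simp only [mul_sub, Finset.sum_sub_distrib] at h1 hsum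
      linarith
  set a : S ⊕ Fin m ⊕ Unit → ((Fin m → ℝ) × ℝ) →ₗ[ℝ] ℝ := fun i => match i with
    | .inl s => LinearMap.coprod (∑ j, ((M *ᵥ s.1) j - b j) • LinearMap.proj j)
        ((val - u ⬝ᵥ s.1) • LinearMap.id)
    | .inr (.inl j) => LinearMap.coprod (LinearMap.proj j) 0
    | .inr (.inr _) => LinearMap.coprod 0 LinearMap.id with ha
  have ha1 : ∀ (s : S) γ t, a (.inl s) (γ, t) =
      ∑ j, γ j * ((M *ᵥ s.1) j - b j) + (val - u ⬝ᵥ s.1) * t := fun s γ t => by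
    simp [ha, LinearMap.sum_apply, mul_comm]
  have ha2 : ∀ j γ t, a (.inr (.inl j)) (γ, t) = γ j := fun j γ t => by simp [ha]
  have ha3 : ∀ γ t, a (.inr (.inr ())) (γ, t) = t := fun γ t => by simp [ha]
  by_contra hno
  -- Otherwise a nonnegative combination of the constraints is `-t`; its weights on `S` give a point
  -- of `conv S ∩ P` with a larger objective value.
  obtain ⟨c, hc, hb⟩ := farkas Finset.univ a (LinearMap.coprod 0 (-LinearMap.id)) (by
    rintro ⟨γ, t⟩ hx
    simp only [LinearMap.coprod_apply, LinearMap.zero_apply, zero_add, LinearMap.neg_apply,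
      LinearMap.id_apply]
    by_contra ht
    have ht : 0 < t := by linarith
    refine hno ⟨fun j => γ j / t, fun j => div_nonneg ?_ ht.le, fun x hx' => ?_⟩
    · simpa [ha2] using hx (.inr (.inl j)) (Finset.mem_univ _)
    · have h1 := hx (.inl ⟨x, hx'⟩) (Finset.mem_univ _)
      rw [ha1] at h1
      have h2 : ∑ j, γ j / t * ((M *ᵥ x) j - b j) + (val - u ⬝ᵥ x)
          = (∑ j, γ j * ((M *ᵥ x) j - b j) + (val - u ⬝ᵥ x) * t) / t := by
        rw [add_div, Finset.sum_div, mul_div_cancel_right₀ _ ht.ne']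
        congr 1
        exact Finset.sum_congr rfl fun j _ => by ring
      rw [h2]
      exact div_nonneg h1 ht.le)
  have hc' : ∀ i, 0 ≤ c i := fun i => hc i (Finset.mem_univ i)
  have hj : ∀ j, ∑ s : S, c (.inl s) * ((M *ᵥ s.1) j - b j) ≤ 0 := fun j => by
    have h1 := hb (Pi.single j 1, 0)
    simp only [Fintype.sum_sum_type, ha1, ha2, Fintype.sum_unique, PUnit.default_eq_unit, ha3,
      LinearMap.coprod_apply] at h1
    simp [Pi.single_apply] at h1
    have := hc' (.inr (.inl j))
    linarith
  have ht : ∑ s : S, c (.inl s) * (val - u ⬝ᵥ s.1) ≤ -1 := by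
    have h1 := hb (0, 1)
    simp only [Fintype.sum_sum_type, ha1, ha2, Fintype.sum_unique, PUnit.default_eq_unit, ha3,
      LinearMap.coprod_apply] at h1
    simp at h1
    have := hc' (.inr (.inr ()))
    linarith
  have hμ : 0 < ∑ s : S, c (.inl s) := by
    refine lt_of_le_of_ne (Finset.sum_nonneg fun s _ => hc' _) fun h0 => ?_
    have := (Finset.sum_eq_zero_iff_of_nonneg fun (s : S) _ => hc' (.inl s)).1 h0.symm
    rw [Finset.sum_congr rfl (fun s hs => by rw [this s hs, zero_mul])] at ht
    simp at ht
    linarith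
  set xb : Fin n → ℝ := Finset.univ.centerMass (fun s : S => c (.inl s)) (fun s => s.1) with hxb
  have hlin : ∀ g : (Fin n → ℝ) →ₗ[ℝ] ℝ,
      g xb = (∑ s : S, c (.inl s))⁻¹ * ∑ s : S, c (.inl s) * g s.1 := fun g => by
    simp [hxb, Finset.centerMass]
  have hxbS : xb ∈ convexHull ℝ S :=
    Finset.centerMass_mem_convexHull _ (fun s _ => hc' _) hμ fun s _ => s.2
  have hxbP : xb ∈ polyhedron M b := fun j => by
    have h1 := hlin ((LinearMap.proj j).comp M.mulVecLin)
    simp only [LinearMap.comp_apply, Matrix.mulVecLin_apply, LinearMap.proj_apply] at h1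
    rw [h1, inv_mul_le_iff₀ hμ]
    have h2 := hj j
    simp only [mul_sub, Finset.sum_sub_distrib, ← Finset.sum_mul] at h2
    linarith
  have hxbX : xb ∈ convexHull ℝ (S ∩ polyhedron M b) := hconv ▸ ⟨hxbS, hxbP⟩
  have hle : u ⬝ᵥ xb ≤ val := by
    have hcv : Convex ℝ {x : Fin n → ℝ | (dotProductBilin ℝ ℝ u) x ≤ val} :=
      convex_halfSpace_le (dotProductBilin ℝ ℝ u).isLinear val
    exact convexHull_min (fun x hx => hmax hx) hcv hxbX
  have h1 := hlin (dotProductBilin ℝ ℝ u)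
  simp only [dotProductBilin_apply_apply] at h1
  rw [h1, inv_mul_le_iff₀ hμ] at hle
  simp only [mul_sub, Finset.sum_sub_distrib, ← Finset.sum_mul] at ht
  linarith

/-! ### Maximizers over standard comonotone sets -/

/-- Over a standard comonotone binary set *every* maximizer of `v` is sorted by `v`: a small
perturbation of `v` makes a given maximizer unique without creating ties. -/
theorem IsBinary.maximizer_sorted {n : ℕ} {S : Set (Fin n → ℝ)} (hS : IsBinary S)
    (hcom : StandardComonotone S) {v x : Fin n → ℝ} (hxS : x ∈ S)
    (hx : ∀ y ∈ S, v ⬝ᵥ y ≤ v ⬝ᵥ x) {i j : Fin n} (hi : x i = 0) (hj : x j = 1) : v i ≤ v j := by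
  by_contra! hlt
  set ε : ℝ := (v i - v j) / 4 with hε
  have hεpos : 0 < ε := by simp only [hε]; linarith
  set v' : Fin n → ℝ := v + ε • (fun k => 2 * x k - 1) with hv'
  have hval : ∀ y : Fin n → ℝ, v' ⬝ᵥ y = v ⬝ᵥ y + ε * ∑ k, (2 * x k - 1) * y k := fun y => by
    rw [hv', add_dotProduct, smul_dotProduct]
    rfl
  have hterm : ∀ y ∈ S, ∀ k, (2 * x k - 1) * y k ≤ (2 * x k - 1) * x k := fun y hy k => by
    rcases hS x hxS k with h | h <;> rcases hS y hy k with h' | h' <;> rw [h, h'] <;> norm_num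
  have hxmax : IsMaximizer (fun y => v' ⬝ᵥ y) S x := by
    refine ⟨hxS, fun y hy => ?_⟩
    simp only [Set.mem_ofPred_eq, hval]
    exact add_le_add (hx y hy)
      (mul_le_mul_of_nonneg_left (Finset.sum_le_sum fun k _ => hterm y hy k) hεpos.le)
  set π : Equiv.Perm (Fin n) := Tuple.sort (fun k => -v' k) with hπ
  have hanti : v' ∈ sortedCone π := fun a b hab => by
    have := Tuple.monotone_sort (fun k => -v' k) hab
    simp only [Function.comp_apply, neg_le_neg_iff] at this
    exact this
  obtain ⟨x', hx's, hx'S, hx'max⟩ := hcom π v' hanti ⟨x, hxmax⟩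
  -- The perturbation decreases strictly away from `x`, so the sorted maximizer is `x` itself.
  have hxx' : x' = x := by
    have h1 := hx'max hxS
    simp only [Set.mem_ofPred_eq, hval] at h1
    have h2 := hx x' hx'S
    have h3 : ∑ k, (2 * x k - 1) * x k ≤ ∑ k, (2 * x k - 1) * x' k := by
      have : ε * ∑ k, (2 * x k - 1) * x k ≤ ε * ∑ k, (2 * x k - 1) * x' k := by linarith
      exact le_of_mul_le_mul_left this hεpos
    have h4 := (Finset.sum_eq_sum_iff_of_le fun k _ => hterm x' hx'S k).1
      (le_antisymm (Finset.sum_le_sum fun k _ => hterm x' hx'S k) h3)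
    funext k
    have h5 := h4 k (Finset.mem_univ k)
    have h6 : 2 * x k - 1 ≠ 0 := by
      rcases hS x hxS k with h | h <;> rw [h] <;> norm_num
    exact mul_left_cancel₀ h6 h5
  subst hxx'
  have hlt' : v' j < v' i := by
    simp only [hv', Pi.add_apply, Pi.smul_apply, smul_eq_mul, hi, hj, hε]
    linarith
  have hord : π.symm i ≤ π.symm j := by
    by_contra! hcon
    have := hanti hcon.le
    simp only [Equiv.apply_symm_apply] at this
    linarith
  have := hx's hord
  simp only [id_eq, Equiv.apply_symm_apply, hi, hj] at this
  linarith

/-- A binary vector sorted by `v` is separated by a threshold. -/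
theorem exists_threshold {n : ℕ} {v x : Fin n → ℝ} (hx : ∀ i, x i = 0 ∨ x i = 1)
    (hs : ∀ i j, x i = 0 → x j = 1 → v i ≤ v j) :
    ∃ lam : ℝ, ∀ i, (lam < v i → x i = 1) ∧ (v i < lam → x i = 0) := by
  classical
  by_cases hne : ({j | x j = 1} : Finset (Fin n)).Nonempty
  · obtain ⟨j, hj, hmin⟩ := Finset.exists_min_image _ v hne
    simp only [Finset.mem_filter, Finset.mem_univ, true_and] at hj hmin
    refine ⟨v j, fun i => ⟨fun h => (hx i).resolve_left fun h0 => ?_,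
      fun h => (hx i).resolve_right fun h1 => ?_⟩⟩
    · exact absurd (hs i j h0 hj) (not_le.2 h)
    · exact absurd (hmin i h1) (not_le.2 h)
  · have h0 : ∀ i, x i = 0 := fun i => (hx i).resolve_right fun h1 => hne ⟨i, by simpa using h1⟩
    refine ⟨∑ k, |v k|, fun i => ⟨fun h => absurd h (not_lt.2 ?_), fun _ => h0 i⟩⟩
    exact (le_abs_self _).trans
      (Finset.single_le_sum (f := fun k => |v k|) (fun k _ => abs_nonneg _) (Finset.mem_univ i))

/-! ### Generic linear objectives -/

/-- Maximizing a convex function over a finite set reduces to linear objectives that avoid any given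
finite family of proper subspaces. -/
theorem exists_generic_objective {r : ℕ} {Y : Set (Fin r → ℝ)} (hY : Y.Finite) (hne : Y.Nonempty)
    {f : (Fin r → ℝ) → ℝ} (hf : ConvexOn ℝ Set.univ f) {κ : Type*} (I : Set κ) (hI : I.Finite)
    (Z : κ → Submodule ℝ (Fin r → ℝ)) (hZ : ∀ k ∈ I, Z k ≠ ⊤) :
    ∃ c : Fin r → ℝ, (∀ k ∈ I, c ∉ Z k) ∧
      ∀ y ∈ Y, (∀ y' ∈ Y, c ⬝ᵥ y' ≤ c ⬝ᵥ y) → ∀ y' ∈ Y, f y' ≤ f y := by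
  obtain ⟨y₀, hy₀, hmax⟩ := Set.exists_max_image Y f hY hne
  set N : Set (Fin r → ℝ) := {y ∈ Y | f y < f y₀} with hN
  have hNfin : N.Finite := hY.subset fun y hy => hy.1
  -- Strictly worse points do not have `y₀` in their convex hull, so an open set of objectives
  -- separates them from `y₀`.
  have hnot : y₀ ∉ convexHull ℝ N := fun hmem => by
    obtain ⟨y, hy, hle⟩ := (hf.subset (Set.subset_univ _)
      (convex_convexHull ℝ N)).exists_ge_of_mem_convexHull (subset_convexHull ℝ N) hmem
    exact absurd hle (not_le.2 hy.2)
  obtain ⟨g, s, hgs, hsg⟩ := geometric_hahn_banach_closed_point (convex_convexHull ℝ N)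
    (hNfin.isClosed_convexHull ℝ) hnot
  set U : Set (Fin r → ℝ) := {c | ∀ y ∈ N, c ⬝ᵥ y < c ⬝ᵥ y₀} with hU
  have hUopen : IsOpen U := by
    have : U = ⋂ y ∈ N, {c | c ⬝ᵥ y < c ⬝ᵥ y₀} := by ext; simp [hU]
    rw [this]
    refine hNfin.isOpen_biInter fun y _ => isOpen_lt ?_ ?_ <;>
    · unfold dotProduct
      fun_prop
  have hUne : U.Nonempty := by
    have hrep : ∀ y, (fun i => g (Pi.single i 1)) ⬝ᵥ y = g y := fun y => by
      conv_rhs => rw [← Finset.univ_sum_single y, map_sum]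
      refine Finset.sum_congr rfl fun i _ => ?_
      rw [mul_comm, ← smul_eq_mul, ← map_smul, ← Pi.single_smul]
      simp
    refine ⟨fun i => g (Pi.single i 1), fun y hy => ?_⟩
    rw [hrep, hrep]
    exact (hgs y (subset_convexHull ℝ N hy)).trans hsg
  -- The proper subspaces form a null set, which does not cover the open set.
  have hnull : MeasureTheory.volume (⋃ k ∈ I, (Z k : Set (Fin r → ℝ))) = 0 :=
    (MeasureTheory.measure_biUnion_null_iff hI.countable).2 fun k hk =>
      MeasureTheory.Measure.addHaar_submodule _ _ (hZ k hk)
  obtain ⟨c, hcU, hc⟩ : ∃ c ∈ U, c ∉ ⋃ k ∈ I, (Z k : Set (Fin r → ℝ)) := by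
    by_contra! hcon
    exact (hUopen.measure_pos MeasureTheory.volume hUne).ne'
      (MeasureTheory.measure_mono_null hcon hnull)
  refine ⟨c, fun k hk hck => hc (Set.mem_biUnion hk hck), fun y hy hymax y' hy' => ?_⟩
  by_contra! hlt
  exact absurd (hymax y₀ hy₀) (not_le.2 (hcU y ⟨hy, hlt.trans_le (hmax y' hy')⟩))

/-! ### Faces of a central hyperplane arrangement -/

section Arrangement

variable {E : Type*} [AddCommGroup E] [Module ℝ E] [FiniteDimensional ℝ E]

theorem finrank_inf_ker (V : Submodule ℝ E) (g : E →ₗ[ℝ] ℝ) (hg : ∃ z ∈ V, g z ≠ 0) :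
    Module.finrank ℝ ↥(V ⊓ LinearMap.ker g) + 1 = Module.finrank ℝ V := by
  have h1 := (g.domRestrict V).finrank_range_add_finrank_ker
  have h2 : Module.finrank ℝ (LinearMap.range (g.domRestrict V)) = 1 := by
    obtain ⟨z, hz, hgz⟩ := hg
    have : LinearMap.range (g.domRestrict V) = ⊤ := by
      rw [LinearMap.range_eq_top]
      refine fun t => ⟨(t / g z) • ⟨z, hz⟩, ?_⟩
      simp [hgz]
    rw [this, finrank_top, Module.finrank_self]
  have h3 : Module.finrank ℝ (LinearMap.ker (g.domRestrict V)) =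
      Module.finrank ℝ ↥(V ⊓ LinearMap.ker g) := by
    have : V ⊓ LinearMap.ker g = (LinearMap.ker (g.domRestrict V)).map V.subtype := by
      ext x
      simp [Submodule.mem_map, LinearMap.mem_ker, and_comm]
    rw [this, LinearEquiv.finrank_eq (Submodule.equivMapOfInjective _ V.injective_subtype _)]
  omega

theorem finrank_le_finrank_inf_ker (V : Submodule ℝ E) (g : E →ₗ[ℝ] ℝ) :
    Module.finrank ℝ V ≤ Module.finrank ℝ ↥(V ⊓ LinearMap.ker g) + 1 := by
  by_cases hg : ∃ z ∈ V, g z ≠ 0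
  · exact (finrank_inf_ker V g hg).ge
  · push Not at hg
    rw [inf_eq_left.2 fun z hz => hg z hz]
    omega

omit [FiniteDimensional ℝ E] in
/-- Finitely many functionals that do not vanish on `V` are simultaneously nonzero at some point. -/
theorem exists_forall_ne_zero {κ : Type*} (I : Finset κ) (V : Submodule ℝ E) (g : κ → E →ₗ[ℝ] ℝ)
    (hg : ∀ k ∈ I, ∃ z ∈ V, g k z ≠ 0) : ∃ z ∈ V, ∀ k ∈ I, g k z ≠ 0 := by
  classical
  have h := Subspace.biUnion_ne_univ_of_top_notMem
    (s := I.image fun k => LinearMap.ker ((g k).domRestrict V)) (by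
      intro hmem
      obtain ⟨k, hk, htop⟩ := Finset.mem_image.1 hmem
      obtain ⟨z, hz, hne⟩ := hg k hk
      have : (⟨z, hz⟩ : V) ∈ LinearMap.ker ((g k).domRestrict V) := htop ▸ Submodule.mem_top
      exact hne (by simpa using this))
  obtain ⟨z, hz⟩ := (Set.ne_univ_iff_exists_notMem _).1 h
  refine ⟨z, z.2, fun k hk h0 => hz ?_⟩
  simp only [Set.mem_iUnion]
  exact ⟨_, Finset.mem_image_of_mem _ hk, by simpa using h0⟩

omit [FiniteDimensional ℝ E] in
/-- Every point `w` can be moved inside `w + K` to a point lying in the closure of its face of the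
arrangement, at which the vanishing functionals have no common zero in `K` but `0`. -/
theorem exists_basic_point {ι : Type*} [Fintype ι] (h : ι → E →ₗ[ℝ] ℝ) (K : Submodule ℝ E)
    (hK : ∀ z ∈ K, (∀ i, h i z = 0) → z = 0) (w : E) :
    ∃ w', w' - w ∈ K ∧ (∀ i, 0 < h i w' → 0 < h i w) ∧ (∀ i, h i w' < 0 → h i w < 0) ∧
      ∀ z ∈ K, (∀ i, h i w' = 0 → h i z = 0) → z = 0 := by
  classical
  induction hN : ({i | h i w ≠ 0} : Finset ι).card using Nat.strong_induction_on generalizing w with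
  | _ N ih =>
    by_cases hw : ∀ z ∈ K, (∀ i, h i w = 0 → h i z = 0) → z = 0
    · exact ⟨w, by simp, fun _ => id, fun _ => id, hw⟩
    push Not at hw
    obtain ⟨z, hzK, hz, hz0⟩ := hw
    have hne : ({i | h i z ≠ 0} : Finset ι).Nonempty := by
      by_contra hcon
      rw [Finset.not_nonempty_iff_eq_empty, Finset.filter_eq_empty_iff] at hcon
      exact hz0 (hK z hzK fun i => by simpa using hcon (Finset.mem_univ i))
    -- Move along `z` until the first functional vanishes.
    obtain ⟨k, hk, hmin⟩ := Finset.exists_min_image _ (fun i => |h i w / h i z|) hne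
    simp only [Finset.mem_filter, Finset.mem_univ, true_and] at hk hmin
    set t := h k w / h k z with ht
    have hval : ∀ i, h i (w - t • z) = h i w - t * h i z := fun i => by simp
    have hbound : ∀ i, |t * h i z| ≤ |h i w| := fun i => by
      by_cases hi : h i z = 0
      · simp [hi]
      · have := hmin i hi
        rw [abs_div (h i w), le_div_iff₀ (abs_pos.2 hi)] at this
        rwa [abs_mul]
    have hpos : ∀ i, 0 < h i (w - t • z) → 0 < h i w := fun i hi => by
      rw [hval] at hi
      have h1 := hbound i
      by_contra! hcon
      rw [abs_of_nonpos hcon] at h1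
      have := (abs_le.1 h1).1
      linarith
    have hneg : ∀ i, h i (w - t • z) < 0 → h i w < 0 := fun i hi => by
      rw [hval] at hi
      have h1 := hbound i
      by_contra! hcon
      rw [abs_of_nonneg hcon] at h1
      have := (abs_le.1 h1).2
      linarith
    have hk0 : h k (w - t • z) = 0 := by
      rw [hval, ht, div_mul_cancel₀ _ hk, sub_self]
    have hcard : ({i | h i (w - t • z) ≠ 0} : Finset ι).card < N := by
      rw [← hN]
      refine Finset.card_lt_card ⟨fun i hi => ?_, fun hsub => ?_⟩
      · simp only [Finset.mem_filter, Finset.mem_univ, true_and] at hi ⊢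
        rcases lt_or_gt_of_ne hi with h1 | h1
        · exact (hneg i h1).ne
        · exact (hpos i h1).ne'
      · have : k ∈ ({i | h i w ≠ 0} : Finset ι) := by
          simp only [Finset.mem_filter, Finset.mem_univ, true_and]
          exact fun h0 => hk (hz k h0)
        have := hsub this
        exact (Finset.mem_filter.1 this).2 hk0
    obtain ⟨w', hw'K, hw'p, hw'n, hw'z⟩ := ih _ hcard (w - t • z) rfl
    refine ⟨w', ?_, fun i hi => hpos i (hw'p i hi), fun i hi => hneg i (hw'n i hi), hw'z⟩
    have : w' - w = (w' - (w - t • z)) - t • z := by abel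
    rw [this]
    exact K.sub_mem hw'K (K.smul_mem _ hzK)

/-- A family of functionals that separates the points of `K` contains a subfamily of `dim K`
functionals that does. -/
theorem exists_separating_subset {ι : Type*} [DecidableEq ι] (h : ι → E →ₗ[ℝ] ℝ) (q : ℕ)
    (K : Submodule ℝ E) (hq : Module.finrank ℝ K = q) (Z : Finset ι)
    (hZ : ∀ z ∈ K, (∀ i ∈ Z, h i z = 0) → z = 0) :
    ∃ B ⊆ Z, B.card = q ∧ ∀ z ∈ K, (∀ i ∈ B, h i z = 0) → z = 0 := by
  induction q generalizing K Z with
  | zero =>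
    refine ⟨∅, by simp, rfl, fun z hz _ => ?_⟩
    have := Submodule.finrank_eq_zero.1 hq
    simpa [this] using hz
  | succ q ih =>
    have hKne : K ≠ ⊥ := fun h0 => by
      rw [h0, finrank_bot] at hq
      omega
    obtain ⟨z, hzK, hz0⟩ := K.ne_bot_iff.1 hKne
    obtain ⟨i, hiZ, hi⟩ : ∃ i ∈ Z, h i z ≠ 0 := by
      by_contra! hcon
      exact hz0 (hZ z hzK hcon)
    have hfr := finrank_inf_ker K (h i) ⟨z, hzK, hi⟩
    obtain ⟨B, hBZ, hBc, hB⟩ := ih (K ⊓ LinearMap.ker (h i)) (by omega) (Z.erase i)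
      (fun y hy hyZ => hZ y hy.1 fun j hj => by
        by_cases hji : j = i
        · subst hji; exact hy.2
        · exact hyZ j (Finset.mem_erase.2 ⟨hji, hj⟩))
    have hiB : i ∉ B := fun hmem => by simpa using hBZ hmem
    refine ⟨insert i B, ?_, by rw [Finset.card_insert_of_notMem hiB, hBc], fun y hy hyB => ?_⟩
    · exact Finset.insert_subset hiZ (hBZ.trans (Finset.erase_subset _ _))
    · exact hB y ⟨hy, hyB i (Finset.mem_insert_self _ _)⟩ fun j hj =>
        hyB j (Finset.mem_insert_of_mem hj)

/-- The points computed from a list of functionals: `FlagRel h Q V l w` says that `w` is a sum of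
directions in the successive intersections of `V` with the kernels of the functionals in `l`. Each
direction is normalized by the next functional, and is scaled so small that none of the first `Q`
functionals changes its sign at the sum of the later directions, unless it vanishes there. -/
def FlagRel (h : ℕ → E →ₗ[ℝ] ℝ) (Q : ℕ) : Submodule ℝ E → List ℕ → E → Prop
  | _, [], w => w = 0
  | V, i :: l, w => ∃ D ∈ V, ((∃ z ∈ V, h i z ≠ 0) → h i D = 1) ∧
      ∃ (w' : E) (δ : ℝ), FlagRel h Q (V ⊓ LinearMap.ker (h i)) l w' ∧ 0 < δ ∧
        (∀ j < Q, h j w' ≠ 0 → δ * |h j D| < |h j w'|) ∧ w = w' + δ • D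

omit [FiniteDimensional ℝ E] in
theorem FlagRel.mem {h : ℕ → E →ₗ[ℝ] ℝ} {Q : ℕ} {V : Submodule ℝ E} {l : List ℕ} {w : E}
    (hw : FlagRel h Q V l w) : w ∈ V := by
  induction l generalizing V w with
  | nil => rw [show w = 0 from hw]; exact V.zero_mem
  | cons i l ih =>
    obtain ⟨D, hD, -, w', δ, hw', -, -, rfl⟩ := hw
    exact V.add_mem (ih hw').1 (V.smul_mem _ hD)

/-- Every face of the arrangement that is open in `V` is reached from a list of `dim V`
functionals. The first functional of the list is a facet of the face; the facet is found on the
segment from a point of the face to a generic point. -/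
theorem exists_flag (h : ℕ → E →ₗ[ℝ] ℝ) (Q R : ℕ) (hRQ : R ≤ Q)
    (hneg : ∀ j < Q, ∃ j' < Q, h j' = -h j) (ρ : ℕ) (V : Submodule ℝ E)
    (hV : Module.finrank ℝ V = ρ + 1) (hR : ∀ z ∈ V, z ≠ 0 → ∃ e < R, h e z ≠ 0)
    (w₀ : E) (hw₀ : w₀ ∈ V) (hgen : ∀ j < Q, h j w₀ = 0 → ∀ z ∈ V, h j z = 0)
    (hnegR : ∀ j < R, ∃ j' < R, h j' = -h j) :
    ∃ l : List ℕ, l.length = ρ ∧ (∀ i ∈ l, i < Q) ∧ ∃ e < R, ∀ w, FlagRel h Q V (l ++ [e]) w →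
      ∀ j < Q, 0 < h j w₀ → 0 < h j w := by
  have hex : ∀ V : Submodule ℝ E, 0 < Module.finrank ℝ V →
      (∀ z ∈ V, z ≠ 0 → ∃ e < R, h e z ≠ 0) → ∀ w ∈ V,
      (∀ j < Q, h j w = 0 → ∀ z ∈ V, h j z = 0) → ∃ e < R, 0 < h e w := by
    intro V hV hR w hw hgen
    have hVne : V ≠ ⊥ := fun h0 => by
      rw [h0, finrank_bot] at hV
      omega
    obtain ⟨y, hyV, hy0⟩ := V.ne_bot_iff.1 hVne
    obtain ⟨e, heR, hey⟩ := hR y hyV hy0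
    have hew : h e w ≠ 0 := fun h0 => hey (hgen e (heR.trans_le hRQ) h0 y hyV)
    rcases lt_or_gt_of_ne hew with h1 | h1
    · obtain ⟨e', he', hee⟩ := hnegR e heR
      exact ⟨e', he', by rw [hee]; simpa using h1⟩
    · exact ⟨e, heR, h1⟩
  induction ρ generalizing V w₀ with
  | zero =>
    obtain ⟨e, heR, hew⟩ := hex V (by omega) hR w₀ hw₀ hgen
    refine ⟨[], rfl, by simp, e, heR, ?_⟩
    rintro w ⟨D, hD, hD1, w', δ, hw', hδ, -, rfl⟩ j hj hjw
    rw [show w' = 0 from hw', zero_add, map_smul, smul_eq_mul]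
    have hD1 := hD1 ⟨w₀, hw₀, hew.ne'⟩
    obtain ⟨t, ht⟩ := exists_smul_eq_of_finrank_eq_one (x := (⟨w₀, hw₀⟩ : V)) (by simpa using hV)
      (fun h0 => by
        have : w₀ = 0 := congrArg Subtype.val h0
        simp [this] at hew) ⟨D, hD⟩
    have ht : t • w₀ = D := congrArg Subtype.val ht
    rw [← ht, map_smul, smul_eq_mul] at hD1
    have htpos : 0 < t := by
      by_contra! hcon
      have := mul_nonpos_of_nonpos_of_nonneg hcon hew.le
      linarith
    rw [← ht, map_smul, smul_eq_mul]
    positivity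
  | succ ρ ih =>
    obtain ⟨e, heR, hew⟩ := hex V (by omega) hR w₀ hw₀ hgen
    -- A generic point `z` with a functional that changes sign between `w₀` and `z`.
    obtain ⟨z, hzV, hz0, hz⟩ : ∃ z ∈ V, h e z < 0 ∧ ∀ i < Q, ∀ j < Q,
        h i w₀ * h j z = h j w₀ * h i z → ∀ x ∈ V, h i w₀ * h j x = h j w₀ * h i x := by
      classical
      set g : ℕ × ℕ → E →ₗ[ℝ] ℝ := fun p => h p.1 w₀ • h p.2 - h p.2 w₀ • h p.1 with hg
      obtain ⟨z, hzV, hz⟩ := exists_forall_ne_zero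
        (insert none (((Finset.range Q ×ˢ Finset.range Q).filter
          fun p => ∃ x ∈ V, g p x ≠ 0).image some)) V
        (fun o : Option (ℕ × ℕ) => match o with
          | none => h e
          | some p => g p) (by
          intro o ho
          rcases Finset.mem_insert.1 ho with rfl | ho
          · exact ⟨w₀, hw₀, hew.ne'⟩
          · obtain ⟨p, hp, rfl⟩ := Finset.mem_image.1 ho
            exact (Finset.mem_filter.1 hp).2)
      have hez : h e z ≠ 0 := hz none (Finset.mem_insert_self _ _)
      have hpz : ∀ i < Q, ∀ j < Q,
          h i w₀ * h j z = h j w₀ * h i z → ∀ x ∈ V, h i w₀ * h j x = h j w₀ * h i x := by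
        intro i hi j hj hij x hx
        by_contra hne
        refine hz (some (i, j)) (Finset.mem_insert_of_mem (Finset.mem_image_of_mem _
          (Finset.mem_filter.2 ⟨by simp [hi, hj], x, hx, ?_⟩))) ?_
        · simpa [hg, sub_eq_zero] using hne
        · simpa [hg, sub_eq_zero] using hij
      rcases lt_or_gt_of_ne hez with h1 | h1
      · exact ⟨z, hzV, h1, hpz⟩
      · exact ⟨-z, V.neg_mem hzV, by simpa using h1, fun i hi j hj hij =>
          hpz i hi j hj (by simpa using hij)⟩
    have hTne : ((Finset.range Q).filter fun i => 0 < h i w₀ ∧ h i z < 0).Nonempty :=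
      ⟨e, by simp [heR.trans_le hRQ, hew, hz0]⟩
    obtain ⟨k, hk, hmin⟩ := Finset.exists_min_image _ (fun i => h i w₀ / (-h i z)) hTne
    simp only [Finset.mem_filter, Finset.mem_range] at hk hmin
    obtain ⟨hkQ, hkw, hkz⟩ := hk
    set t := h k w₀ / (-h k z) with ht
    have htpos : 0 < t := div_pos hkw (by linarith)
    -- The point at which the segment from `w₀` to `z` leaves the face, through the facet of `h k`.
    set w₁ := w₀ + t • z with hw₁
    have hval : ∀ i, h i w₁ = h i w₀ + t * h i z := fun i => by simp [hw₁]
    have hkw₁ : h k w₁ = 0 := by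
      rw [hval, ht]
      have : h k z ≠ 0 := hkz.ne
      field_simp
      ring
    have hw₁V : w₁ ∈ V ⊓ LinearMap.ker (h k) :=
      ⟨V.add_mem hw₀ (V.smul_mem _ hzV), hkw₁⟩
    -- A functional positive at `w₀` stays positive at `w₁`, or it is a positive multiple of `h k`.
    have hdich : ∀ i < Q, 0 < h i w₀ →
        0 < h i w₁ ∨ ∀ x ∈ V, h k w₀ * h i x = h i w₀ * h k x := by
      intro i hi hiw
      rcases le_or_gt 0 (h i z) with h1 | h1
      · left
        rw [hval]
        positivity
      · have h2 := hmin i ⟨hi, hiw, h1⟩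
        rcases h2.lt_or_eq with h3 | h3
        · left
          rw [lt_div_iff₀ (by linarith)] at h3
          rw [hval]
          linarith
        · right
          refine hz k hkQ i hi ?_
          rw [ht, div_eq_div_iff (by linarith) (by linarith)] at h3
          linarith
    have hgen₁ : ∀ j < Q, h j w₁ = 0 → ∀ x ∈ V ⊓ LinearMap.ker (h k), h j x = 0 := by
      have hposcase : ∀ j < Q, 0 < h j w₀ → h j w₁ = 0 →
          ∀ x ∈ V ⊓ LinearMap.ker (h k), h j x = 0 := by
        intro j hj hjw hj0 x hx
        rcases hdich j hj hjw with h1 | h1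
        · exact absurd hj0 h1.ne'
        · have h2 := h1 x hx.1
          rw [show h k x = 0 from hx.2, mul_zero] at h2
          exact (mul_eq_zero.1 h2).resolve_left hkw.ne'
      intro j hj hj0 x hx
      rcases lt_trichotomy (h j w₀) 0 with h1 | h1 | h1
      · obtain ⟨j', hj', hjj⟩ := hneg j hj
        have := hposcase j' hj' (by rw [hjj]; simpa using h1) (by rw [hjj]; simpa using hj0) x hx
        rw [hjj] at this
        simpa using this
      · exact hgen j hj h1 x hx.1
      · exact hposcase j hj h1 hj0 x hx
    have hfr := finrank_inf_ker V (h k) ⟨w₀, hw₀, hkw.ne'⟩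
    have hR₁ : ∀ x ∈ V ⊓ LinearMap.ker (h k), x ≠ 0 → ∃ e < R, h e x ≠ 0 :=
      fun x hx hx0 => hR x hx.1 hx0
    obtain ⟨l, hl, hlQ, e', he', hlw⟩ := ih (V ⊓ LinearMap.ker (h k)) (by omega) hR₁ w₁ hw₁V hgen₁
    refine ⟨k :: l, by simp [hl], by simpa using ⟨hkQ, hlQ⟩, e', he', ?_⟩
    rintro w ⟨D, hD, hD1, w', δ, hw', hδ, hsmall, rfl⟩ j hj hjw
    have hD1 := hD1 ⟨w₀, hw₀, hkw.ne'⟩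
    rw [map_add, map_smul, smul_eq_mul]
    rcases hdich j hj hjw with h1 | h1
    · have h2 := hlw w' hw' j hj h1
      have h3 := hsmall j hj h2.ne'
      rw [abs_of_pos h2] at h3
      have h4 : -(δ * |h j D|) ≤ δ * h j D := by
        have := neg_abs_le (h j D)
        nlinarith
      linarith
    · have h2 := h1 w' (FlagRel.mem hw').1
      rw [show h k w' = 0 from (FlagRel.mem hw').2, mul_zero] at h2
      rw [(mul_eq_zero.1 h2).resolve_left hkw.ne', zero_add]
      have h3 := h1 D hD
      rw [hD1, mul_one] at h3
      have h4 : 0 < h j D := by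
        by_contra! hcon
        have := mul_nonpos_of_nonneg_of_nonpos hkw.le hcon
        linarith
      positivity

end Arrangement

section Arrangement

variable {E : Type*} [AddCommGroup E] [Module ℝ E]

/-- The common kernel of the first `k` functionals selected by `sel`. -/
def selSpace (h : ℕ → E →ₗ[ℝ] ℝ) (sel : ℕ → ℕ) : ℕ → Submodule ℝ E
  | 0 => ⊤
  | k + 1 => selSpace h sel k ⊓ LinearMap.ker (h (sel k))

theorem mem_selSpace {h : ℕ → E →ₗ[ℝ] ℝ} {sel : ℕ → ℕ} {k : ℕ} {z : E} :
    z ∈ selSpace h sel k ↔ ∀ j < k, h (sel j) z = 0 := by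
  induction k with
  | zero => simp [selSpace]
  | succ k ih =>
    rw [selSpace, Submodule.mem_inf, ih, LinearMap.mem_ker]
    constructor
    · rintro ⟨h1, h2⟩ j hj
      rcases Nat.lt_succ_iff_lt_or_eq.1 hj with h3 | rfl
      · exact h1 j h3
      · exact h2
    · exact fun h1 => ⟨fun j hj => h1 j (by omega), h1 k (by omega)⟩

theorem finrank_le_finrank_selSpace [FiniteDimensional ℝ E] (h : ℕ → E →ₗ[ℝ] ℝ) (sel : ℕ → ℕ)
    (k : ℕ) : Module.finrank ℝ E ≤ Module.finrank ℝ (selSpace h sel k) + k := by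
  induction k with
  | zero => rw [selSpace, finrank_top, add_zero]
  | succ k ih =>
    have : Module.finrank ℝ (selSpace h sel k) ≤ Module.finrank ℝ (selSpace h sel (k + 1)) + 1 :=
      finrank_le_finrank_inf_ker (selSpace h sel k) (h (sel k))
    omega

end Arrangement

/-! ### The arrangement of the dual problem -/

/-- The functionals that define the arrangement, as coefficient vectors on `(c, lam, γ)`: the `d`
coordinates, and `(Aᵀ c - Mᵀ γ) i - lam` for each column `i`. The matrices are given by arrays. -/
def baseRow (r d : ℕ) (a₀ a₁ : ℕ → ℕ → ℝ) (i a : ℕ) : ℝ :=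
  if i < d then (if a = i then 1 else 0)
  else if a < r then a₀ a (i - d) else if a = r then -1 else -a₁ (a - (r + 1)) (i - d)

/-- The functionals of `baseRow`, each followed by its negative. -/
def row (r d : ℕ) (a₀ a₁ : ℕ → ℕ → ℝ) (i a : ℕ) : ℝ :=
  if i % 2 = 0 then baseRow r d a₀ a₁ (i / 2) a else -baseRow r d a₀ a₁ (i / 2) a

/-- The linear functional with given coefficients. -/
def lin (d : ℕ) (g : ℕ → ℝ) : (Fin d → ℝ) →ₗ[ℝ] ℝ :=
  ∑ a : Fin d, g a • LinearMap.proj a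

theorem lin_apply {d : ℕ} (g : ℕ → ℝ) (z : Fin d → ℝ) : lin d g z = ∑ a : Fin d, g a * z a := by
  simp [lin, LinearMap.sum_apply]

/-- A matrix as a two-dimensional array, extended by zeros. -/
def toArray {k l : ℕ} (A : Matrix (Fin k) (Fin l) ℝ) (i j : ℕ) : ℝ :=
  if h : i < k ∧ j < l then A ⟨i, h.1⟩ ⟨j, h.2⟩ else 0

@[simp] theorem toArray_val {k l : ℕ} (A : Matrix (Fin k) (Fin l) ℝ) (i : Fin k) (j : Fin l) :
    toArray A i j = A i j := by
  simp [toArray]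

section Dual

variable {r n m : ℕ}

/-- The component `c` of `z = (c, lam, γ)`. -/
def cPart (r m : ℕ) : (Fin (r + (m + 1)) → ℝ) →ₗ[ℝ] (Fin r → ℝ) where
  toFun z a := z (Fin.castAdd (m + 1) a)
  map_add' _ _ := rfl
  map_smul' _ _ := rfl

/-- The component `lam` of `z = (c, lam, γ)`. -/
def lamPart (z : Fin (r + (m + 1)) → ℝ) : ℝ := z (Fin.natAdd r 0)

/-- The component `γ` of `z = (c, lam, γ)`. -/
def gamPart (z : Fin (r + (m + 1)) → ℝ) : Fin m → ℝ := fun j => z (Fin.natAdd r j.succ)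

variable (A : Matrix (Fin r) (Fin n) ℝ) (M : Matrix (Fin m) (Fin n) ℝ)

/-- The functionals of the arrangement on the space of the vectors `(c, lam, γ)`. -/
def rowFun (i : ℕ) : (Fin (r + (m + 1)) → ℝ) →ₗ[ℝ] ℝ :=
  lin (r + (m + 1)) (row r (r + (m + 1)) (toArray A) (toArray M) i)

theorem rowFun_neg (i : ℕ) : ∃ i', i' / 2 = i / 2 ∧ rowFun A M i' = -rowFun A M i := by
  rcases Nat.mod_two_eq_zero_or_one i with h | h
  · refine ⟨i + 1, by omega, LinearMap.ext fun z => ?_⟩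
    have h1 : (i + 1) % 2 ≠ 0 := by omega
    have h2 : (i + 1) / 2 = i / 2 := by omega
    simp [rowFun, lin_apply, row, h, h1, h2]
  · refine ⟨i - 1, by omega, LinearMap.ext fun z => ?_⟩
    have h1 : (i - 1) % 2 = 0 := by omega
    have h2 : (i - 1) / 2 = i / 2 := by omega
    simp [rowFun, lin_apply, row, h, h1, h2]

theorem rowFun_coord (a : Fin (r + (m + 1))) (z : Fin (r + (m + 1)) → ℝ) :
    rowFun A M (2 * a) z = z a := by
  have h1 : 2 * (a : ℕ) % 2 = 0 := by omega
  have h2 : 2 * (a : ℕ) / 2 = a := by omega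
  rw [rowFun, lin_apply, Finset.sum_eq_single a]
  · simp [row, h1, h2, baseRow]
  · intro a' _ hne
    have : (a' : ℕ) ≠ a := fun h => hne (Fin.ext h)
    simp [row, h1, h2, baseRow, this]
  · simp

theorem rowFun_column (i : Fin n) (z : Fin (r + (m + 1)) → ℝ) :
    rowFun A M (2 * (r + (m + 1) + i)) z =
      (Aᵀ *ᵥ cPart r m z - Mᵀ *ᵥ gamPart z) i - lamPart z := by
  have h1 : 2 * (r + (m + 1) + (i : ℕ)) % 2 = 0 := by omega
  have h2 : 2 * (r + (m + 1) + (i : ℕ)) / 2 = r + (m + 1) + i := by omega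
  have h3 : ∀ a, row r (r + (m + 1)) (toArray A) (toArray M) (2 * (r + (m + 1) + (i : ℕ))) a =
      if a < r then toArray A a i else if a = r then -1 else -toArray M (a - (r + 1)) i := by
    intro a
    simp [row, h1, h2, baseRow]
  rw [rowFun, lin_apply]
  simp only [h3]
  rw [Fin.sum_univ_add, Fin.sum_univ_succ]
  have h4 : ∀ j : Fin m, ¬ (r + ((j : ℕ) + 1) < r) := fun j => by omega
  have h5 : ∀ j : Fin m, r + ((j : ℕ) + 1) - (r + 1) = j := fun j => by omega
  simp only [Fin.val_castAdd, Fin.is_lt, if_true, toArray_val, Fin.val_natAdd, Fin.val_zero,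
    add_zero, lt_irrefl, if_false, Fin.val_succ, h4, h5]
  simp [Matrix.mulVec, dotProduct, cPart, lamPart, gamPart]
  ring

/-- The feasible points of the second subproblem at `z = (c, lam, γ)`. -/
def feasible (b : Fin m → ℝ) (X : Set (Fin n → ℝ)) (z : Fin (r + (m + 1)) → ℝ) :
    Set (Fin n → ℝ) :=
  thresholdSet A M (cPart r m z) (lamPart z) (gamPart z) ∩ X ∩ tightSet M b (gamPart z)

variable {A M}

/-- Degenerating `z` to a face in the closure of its own only enlarges the feasible set. -/
theorem feasible_mono {b : Fin m → ℝ} {X : Set (Fin n → ℝ)} {z z' : Fin (r + (m + 1)) → ℝ}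
    (h : ∀ i < 2 * (r + (m + 1) + n), 0 < rowFun A M i z' → 0 < rowFun A M i z) :
    feasible A M b X z ⊆ feasible A M b X z' := by
  have hn : ∀ i < 2 * (r + (m + 1) + n), rowFun A M i z' < 0 → rowFun A M i z < 0 := by
    intro i hi hiz
    obtain ⟨i', hi', he⟩ := rowFun_neg A M i
    have := h i' (by omega) (by rw [he]; simpa using hiz)
    rw [he] at this
    simpa using this
  rintro x ⟨⟨hx, hxX⟩, hxt⟩
  refine ⟨⟨fun i => ⟨fun hi => (hx i).1 ?_, fun hi => (hx i).2 ?_⟩, hxX⟩, fun j hj => hxt j ?_⟩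
  · have := h (2 * (r + (m + 1) + i)) (by omega) (by rw [rowFun_column]; linarith)
    rw [rowFun_column] at this
    linarith
  · have := hn (2 * (r + (m + 1) + i)) (by omega) (by rw [rowFun_column]; linarith)
    rw [rowFun_column] at this
    linarith
  · have hlt : 2 * ((Fin.natAdd r j.succ : Fin (r + (m + 1))) : ℕ) < 2 * (r + (m + 1) + n) := by
      have := (Fin.natAdd r j.succ : Fin (r + (m + 1))).2
      omega
    have h1 := h _ hlt
    have h2 := hn _ hlt
    rw [rowFun_coord, rowFun_coord] at h1 h2
    rcases lt_or_gt_of_ne hj with h3 | h3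
    · exact (h2 h3).ne
    · exact (h1 h3).ne'

/-- If the functionals vanishing at `w` vanish on a space `V` over which `c` ranges freely, then `A`
maps the feasible set at `w` into a line on which the position is determined by `∑ i, x i`. Hence a
convex function of `A x` is maximized at a point of least or of greatest sum. -/
theorem feasible_max_le {b : Fin m → ℝ} {X : Set (Fin n → ℝ)} {f : (Fin r → ℝ) → ℝ}
    (hf : ConvexOn ℝ Set.univ f) (V : Submodule ℝ (Fin (r + (m + 1)) → ℝ))
    (hV : ∀ c : Fin r → ℝ, ∃ z ∈ V, cPart r m z = c) {w : Fin (r + (m + 1)) → ℝ}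
    (hw : ∀ i < 2 * (r + (m + 1) + n), rowFun A M i w = 0 → ∀ z ∈ V, rowFun A M i z = 0)
    {x y x₀ : Fin n → ℝ} (hx : IsMinimizer (fun z => ∑ i, z i) (feasible A M b X w) x)
    (hy : IsMaximizer (fun z => ∑ i, z i) (feasible A M b X w) y)
    (hx₀ : x₀ ∈ feasible A M b X w) :
    f (A *ᵥ x₀) ≤ max (f (A *ᵥ x)) (f (A *ᵥ y)) := by
  -- For `z ∈ V`, each column is fixed by the threshold at `w` or has reduced cost zero at `z`, and
  -- each constraint is tight or has multiplier zero at `z`.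
  have key : ∀ x ∈ feasible A M b X w, ∀ x' ∈ feasible A M b X w, ∀ z ∈ V,
      cPart r m z ⬝ᵥ (A *ᵥ x) - cPart r m z ⬝ᵥ (A *ᵥ x') =
        lamPart z * (∑ i, x i) - lamPart z * ∑ i, x' i := by
    intro x hx x' hx' z hz
    have h1 : ∑ i, ((Aᵀ *ᵥ cPart r m z - Mᵀ *ᵥ gamPart z) i - lamPart z) * (x i - x' i) = 0 := by
      refine Finset.sum_eq_zero fun i _ => ?_
      rw [← rowFun_column]
      rcases lt_trichotomy (rowFun A M (2 * (r + (m + 1) + i)) w) 0 with h | h | h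
      · rw [rowFun_column, sub_neg] at h
        rw [(hx.1.1 i).2 h, (hx'.1.1 i).2 h, sub_self, mul_zero]
      · rw [hw _ (by omega) h z hz, zero_mul]
      · rw [rowFun_column, sub_pos] at h
        rw [(hx.1.1 i).1 h, (hx'.1.1 i).1 h, sub_self, mul_zero]
    have h2 : ∀ j, gamPart z j * (M *ᵥ x) j = gamPart z j * (M *ᵥ x') j := fun j => by
      by_cases h : gamPart w j = 0
      · have hlt : 2 * ((Fin.natAdd r j.succ : Fin (r + (m + 1))) : ℕ) < 2 * (r + (m + 1) + n) := by
          have := (Fin.natAdd r j.succ : Fin (r + (m + 1))).2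
          omega
        have := hw _ hlt (by rw [rowFun_coord]; exact h) z hz
        rw [rowFun_coord] at this
        rw [show gamPart z j = 0 from this, zero_mul, zero_mul]
      · rw [hx.2 j h, hx'.2 j h]
    have h3 : gamPart z ⬝ᵥ (M *ᵥ x) = gamPart z ⬝ᵥ (M *ᵥ x') :=
      Finset.sum_congr rfl fun j _ => h2 j
    have h4 : ∀ x : Fin n → ℝ,
        ∑ i, ((Aᵀ *ᵥ cPart r m z - Mᵀ *ᵥ gamPart z) i - lamPart z) * x i =
        cPart r m z ⬝ᵥ (A *ᵥ x) - gamPart z ⬝ᵥ (M *ᵥ x) - lamPart z * ∑ i, x i := fun x => by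
      rw [Finset.mul_sum, Matrix.dotProduct_mulVec, Matrix.dotProduct_mulVec,
        ← Matrix.mulVec_transpose, ← Matrix.mulVec_transpose, ← sub_dotProduct, dotProduct,
        ← Finset.sum_sub_distrib]
      exact Finset.sum_congr rfl fun i _ => by ring
    have h5 := h4 x
    have h6 := h4 x'
    simp only [mul_sub, Finset.sum_sub_distrib] at h1
    rw [h5, h6, h3] at h1
    linarith
  have hsep : ∀ u v : Fin r → ℝ, (∀ z ∈ V, cPart r m z ⬝ᵥ u = cPart r m z ⬝ᵥ v) → u = v := by
    intro u v huv
    funext a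
    obtain ⟨z, hz, hza⟩ := hV (Pi.single a 1)
    simpa [hza] using huv z hz
  have hxle : ∑ i, x i ≤ ∑ i, x₀ i := hx.2 hx₀
  have hyle : ∑ i, x₀ i ≤ ∑ i, y i := hy.2 hx₀
  obtain ⟨s, t, hs, ht, hst, hcomb⟩ : ∃ s t : ℝ, 0 ≤ s ∧ 0 ≤ t ∧ s + t = 1 ∧
      s * (∑ i, x i) + t * (∑ i, y i) = ∑ i, x₀ i := by
    have : ∑ i, x₀ i ∈ segment ℝ (∑ i, x i) (∑ i, y i) := by
      rw [segment_eq_Icc (hxle.trans hyle)]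
      exact ⟨hxle, hyle⟩
    obtain ⟨s, t, hs, ht, hst, h⟩ := this
    exact ⟨s, t, hs, ht, hst, h⟩
  have hA : A *ᵥ x₀ = s • (A *ᵥ x) + t • (A *ᵥ y) := by
    refine hsep _ _ fun z hz => ?_
    rw [dotProduct_add, dotProduct_smul, dotProduct_smul, smul_eq_mul, smul_eq_mul]
    have h1 := key x hx.1 x₀ hx₀ z hz
    have h2 := key y hy.1 x₀ hx₀ z hz
    rw [← hcomb] at h1 h2
    have h3 : s = 1 - t := by linarith
    subst h3
    linear_combination (-(1 - t)) * h1 - t * h2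
  rw [hA]
  exact hf.le_max_of_mem_segment (Set.mem_univ _) (Set.mem_univ _) ⟨s, t, hs, ht, hst, rfl⟩

theorem IsBinary.finite {S : Set (Fin n → ℝ)} (hS : IsBinary S) : S.Finite :=
  (Set.Finite.pi' fun _ : Fin n => Set.toFinite ({0, 1} : Set ℝ)).subset fun x hx i => by
    simpa using hS x hx i

/-- For a suitable choice of `m + 1` functionals and of a list of `r` further ones, every vector
`(c, lam, γ)` computed from them has an optimal solution of the original problem among the two
answers to the second subproblem. -/
theorem exists_selection (hr : 0 < r) {b : Fin m → ℝ} {f : (Fin r → ℝ) → ℝ}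
    {S X : Set (Fin n → ℝ)} (hf : ConvexOn ℝ Set.univ f) (hS : IsBinary S)
    (hcom : StandardComonotone S) (hX : X = S ∩ polyhedron M b)
    (hconv : convexHull ℝ (S ∩ polyhedron M b) = convexHull ℝ S ∩ polyhedron M b)
    (hne : X.Nonempty) :
    ∃ a g : ℕ → ℕ, (∀ i j, i < j → j < m + 1 → a i < a j) ∧
      (∀ i < m + 1, a i < 2 * (r + (m + 1) + n)) ∧ (∀ i < r, g i < 2 * (r + (m + 1) + n)) ∧
      g (r - 1) < 2 * r ∧
      ∀ w, FlagRel (rowFun A M) (2 * (r + (m + 1) + n)) (selSpace (rowFun A M) a (m + 1))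
          ((List.range r).map g) w →
        (feasible A M b X w).Nonempty ∧
        ∀ x y, IsMinimizer (fun z => ∑ i, z i) (feasible A M b X w) x →
          IsMaximizer (fun z => ∑ i, z i) (feasible A M b X w) y →
          (∀ z ∈ X, f (A *ᵥ z) ≤ f (A *ᵥ x)) ∨ (∀ z ∈ X, f (A *ᵥ z) ≤ f (A *ᵥ y)) := by
  classical
  set d := r + (m + 1) with hd
  set Q := 2 * (d + n) with hQ
  set h := rowFun A M with hh
  have hSfin := hS.finite
  have hXfin : X.Finite := hX ▸ hSfin.inter_of_left _
  set K : Submodule ℝ (Fin d → ℝ) := LinearMap.ker (cPart r m) with hKdef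
  have hneg : ∀ j < Q, ∃ j' < Q, h j' = -h j := fun j hj => by
    obtain ⟨j', h1, h2⟩ := rowFun_neg A M j
    exact ⟨j', by omega, h2⟩
  set VB : Finset (Fin Q) → Submodule ℝ (Fin d → ℝ) := fun B => ⨅ i ∈ B, LinearMap.ker (h i)
    with hVB
  -- `V_B` meets the space `K` of the multipliers trivially, hence has dimension at most `r`.
  have hdim : ∀ V : Submodule ℝ (Fin d → ℝ), V ⊓ K = ⊥ → Module.finrank ℝ V ≤ r := by
    intro V hVK
    have hinj : Function.Injective ((cPart r m).domRestrict V) := by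
      rw [← LinearMap.ker_eq_bot, LinearMap.ker_eq_bot']
      rintro ⟨z, hz⟩ hz0
      have : z ∈ V ⊓ K := ⟨hz, hz0⟩
      rw [hVK] at this
      exact Subtype.ext this
    simpa using LinearMap.finrank_le_finrank_of_injective hinj
  -- An objective `c` for which the dual solutions below are nondegenerate.
  obtain ⟨c, hc, hcopt⟩ := exists_generic_objective (hXfin.image (A *ᵥ ·)) (hne.image _) hf
    {p : Finset (Fin Q) × Fin Q | VB p.1 ⊓ K = ⊥ ∧ ∃ z ∈ VB p.1, h p.2 z ≠ 0} (Set.toFinite _)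
    (fun p => (VB p.1 ⊓ LinearMap.ker (h p.2)).map (cPart r m)) (by
      rintro ⟨B, i⟩ ⟨h1, h2⟩ htop
      have h3 := finrank_inf_ker (VB B) (h i) h2
      have h4 := hdim _ h1
      have h5 := Submodule.finrank_map_le (cPart r m) (VB B ⊓ LinearMap.ker (h i))
      rw [htop, finrank_top, Module.finrank_fin_fun] at h5
      exact Nat.not_succ_le_self _ ((Nat.succ_le_succ h5).trans (h3.le.trans h4)))
  obtain ⟨x₀, hx₀X, hx₀max⟩ := Set.exists_max_image X (fun x => c ⬝ᵥ (A *ᵥ x)) hXfin hne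
  have hopt : ∀ z ∈ X, f (A *ᵥ z) ≤ f (A *ᵥ x₀) := fun z hz =>
    hcopt _ ⟨x₀, hx₀X, rfl⟩ (by rintro _ ⟨y, hy, rfl⟩; exact hx₀max y hy) _ ⟨z, hz, rfl⟩
  have hcA : ∀ x, (Aᵀ *ᵥ c) ⬝ᵥ x = c ⬝ᵥ (A *ᵥ x) := fun x => by
    rw [Matrix.mulVec_transpose, ← Matrix.dotProduct_mulVec]
  obtain ⟨γ, hγ, hγmax⟩ := exists_multiplier hSfin M b (Aᵀ *ᵥ c) hconv (x₀ := x₀)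
    ⟨hX ▸ hx₀X, fun x hx => by
      simp only [Set.mem_ofPred_eq, hcA]
      exact hx₀max x (hX ▸ hx)⟩
  have hx₀S : x₀ ∈ S := (hX ▸ hx₀X : x₀ ∈ S ∩ polyhedron M b).1
  obtain ⟨lam, hlam⟩ := exists_threshold (hS x₀ hx₀S)
    fun i j hi hj => hS.maximizer_sorted hcom hx₀S hγmax hi hj
  set w₀ : Fin d → ℝ := Fin.append c (Fin.cons lam γ) with hw₀
  have hw₀c : cPart r m w₀ = c := by
    funext a; simp [cPart, hw₀]
  have hx₀w₀ : x₀ ∈ feasible A M b X w₀ := by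
    have h1 : lamPart w₀ = lam := by simp [lamPart, hw₀]
    have h2 : gamPart w₀ = γ := by funext j; simp [gamPart, hw₀]
    refine ⟨⟨?_, hx₀X⟩, ?_⟩
    · rw [hw₀c, h1, h2]
      exact hlam
    · rw [h2]
      exact hγ
  -- Move `lam` and `γ` to a basic dual solution.
  obtain ⟨w₁, hw₁K, hw₁p, -, hw₁z⟩ := exists_basic_point (fun i : Fin Q => h i) K (by
    intro z _ hz
    funext a
    have := hz ⟨2 * a, by have := a.2; omega⟩
    rwa [rowFun_coord] at this) w₀
  have hw₁c : cPart r m w₁ = c := by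
    rw [← hw₀c]
    exact sub_eq_zero.1 (by rw [← map_sub]; exact hw₁K)
  have hx₀w₁ : x₀ ∈ feasible A M b X w₁ := feasible_mono (fun i hi => hw₁p ⟨i, hi⟩) hx₀w₀
  have hKdim : Module.finrank ℝ K = m + 1 := by
    have h1 := LinearMap.finrank_range_add_finrank_ker (cPart r m)
    have h2 : LinearMap.range (cPart r m) = ⊤ := by
      rw [LinearMap.range_eq_top]
      exact fun c => ⟨Fin.append c 0, by funext a; simp [cPart]⟩
    rw [h2, finrank_top, Module.finrank_fin_fun, Module.finrank_fin_fun] at h1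
    exact Nat.add_left_cancel h1
  -- The `m + 1` functionals that determine the basic solution.
  obtain ⟨B, hBZ, hBcard, hB⟩ := exists_separating_subset (fun i : Fin Q => h i) (m + 1) K hKdim
    ({i | h i w₁ = 0} : Finset (Fin Q)) (fun z hz hzZ =>
      hw₁z z hz fun i hi => hzZ i (by simpa using hi))
  set e := B.orderEmbOfFin hBcard with he
  set a : ℕ → ℕ := fun i => if hi : i < m + 1 then (e ⟨i, hi⟩ : Fin Q) else 0 with ha
  set V := selSpace h a (m + 1) with hVdef
  have hVV : V = VB B := by
    ext z
    simp only [hVdef, mem_selSpace, hVB, Submodule.mem_iInf, LinearMap.mem_ker]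
    constructor
    · intro hz i hi
      have : i ∈ Set.range e := by rw [he, Finset.range_orderEmbOfFin]; exact hi
      obtain ⟨k, rfl⟩ := this
      have := hz k k.2
      simp only [ha, k.2, dif_pos] at this
      exact this
    · intro hz j hj
      simp only [ha, hj, dif_pos]
      exact hz (e ⟨j, hj⟩) (Finset.orderEmbOfFin_mem _ _ _)
  have hVK : VB B ⊓ K = ⊥ := by
    rw [Submodule.eq_bot_iff]
    rintro z ⟨hz, hzK⟩
    refine hB z hzK fun i hi => ?_
    simp only [hVB, SetLike.mem_coe, Submodule.mem_iInf, LinearMap.mem_ker] at hz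
    exact hz i hi
  have hVdim : Module.finrank ℝ V = r := by
    refine le_antisymm (hdim V (hVV ▸ hVK)) ?_
    have := finrank_le_finrank_selSpace h a (m + 1)
    rw [Module.finrank_fin_fun] at this
    exact Nat.add_le_add_iff_right.1 this
  have hw₁V : w₁ ∈ V := by
    rw [hVV]
    simp only [hVB, Submodule.mem_iInf, LinearMap.mem_ker]
    exact fun i hi => by simpa using hBZ hi
  -- By the choice of `c`, only the functionals that vanish on `V` vanish at `w₁`.
  have hgen : ∀ j < Q, h j w₁ = 0 → ∀ z ∈ V, h j z = 0 := by
    intro j hj hj0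
    by_contra! hcon
    obtain ⟨z, hz, hz0⟩ := hcon
    refine hc (B, ⟨j, hj⟩) ⟨hVK, z, hVV ▸ hz, hz0⟩ ⟨w₁, ⟨hVV ▸ hw₁V, hj0⟩, hw₁c⟩
  have hVc : ∀ z ∈ V, cPart r m z = 0 → z = 0 := fun z hz hz0 => by
    have : z ∈ VB B ⊓ K := ⟨hVV ▸ hz, hz0⟩
    rwa [hVK] at this
  -- The last functional can be taken among the first `2 r`, which are the coordinates of `c` and
  -- their negatives, because these separate the points of `V`.
  obtain ⟨l, hl, hlQ, k, hk, hflag⟩ := exists_flag h Q (2 * r) (by omega) hneg (r - 1) V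
    (by omega) (by
      intro z hz hz0
      by_contra! hcon
      refine hz0 (hVc z hz ?_)
      funext a
      have := hcon (2 * (Fin.castAdd (m + 1) a : Fin (r + (m + 1)))) (by simp)
      rwa [hh, rowFun_coord] at this) w₁ hw₁V hgen (by
      intro j hj
      obtain ⟨j', h1, h2⟩ := rowFun_neg A M j
      exact ⟨j', by omega, h2⟩)
  have hlist : (List.range r).map (fun i => (l ++ [k]).getD i 0) = l ++ [k] := by
    have hlen : (l ++ [k]).length = r := by simp [hl]; omega
    refine List.ext_getElem (by simp [hlen]) fun i h1 h2 => ?_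
    simp only [List.getElem_map, List.getElem_range]
    exact List.getD_eq_getElem _ _ h2
  refine ⟨a, fun i => (l ++ [k]).getD i 0, fun i j hij hj => ?_, fun i hi => ?_, fun i hi => ?_, ?_,
    fun w hw => ?_⟩
  · have hi : i < m + 1 := by omega
    simp only [ha, hi, hj, dif_pos]
    exact e.strictMono (show (⟨i, hi⟩ : Fin (m + 1)) < ⟨j, hj⟩ from hij)
  · simp only [ha, hi, dif_pos]
    exact (e ⟨i, hi⟩).2
  · have h1 : i < (l ++ [k]).length := by simp [hl]; omega
    change (l ++ [k]).getD i 0 < Q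
    rw [List.getD_eq_getElem _ _ h1]
    have h2 : (l ++ [k])[i] ∈ l ++ [k] := List.getElem_mem h1
    rcases List.mem_append.1 h2 with h3 | h3
    · exact hlQ _ h3
    · rw [List.mem_singleton.1 h3]
      omega
  · rw [← hl]
    simpa using hk
  · rw [hlist] at hw
    have hwV := FlagRel.mem hw
    have hpos := hflag w hw
    have hpos' : ∀ j < Q, 0 < h j w → 0 < h j w₁ := by
      intro j hj hjw
      rcases lt_trichotomy (h j w₁) 0 with h1 | h1 | h1
      · obtain ⟨j', hj', hjj⟩ := hneg j hj
        have := hpos j' hj' (by rw [hjj]; simpa using h1)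
        rw [hjj] at this
        simp only [LinearMap.neg_apply] at this
        linarith
      · rw [hgen j hj h1 w hwV] at hjw
        exact absurd hjw (lt_irrefl _)
      · exact h1
    have hmem : x₀ ∈ feasible A M b X w :=
      feasible_mono (z := w₁) hpos' hx₀w₁
    refine ⟨⟨x₀, hmem⟩, fun x y hx hy => ?_⟩
    have hgen' : ∀ j < Q, h j w = 0 → ∀ z ∈ V, h j z = 0 := by
      intro j hj hj0
      rcases lt_trichotomy (h j w₁) 0 with h1 | h1 | h1
      · obtain ⟨j', hj', hjj⟩ := hneg j hj
        have := hpos j' hj' (by rw [hjj]; simpa using h1)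
        rw [hjj] at this
        simp [hj0] at this
      · exact hgen j hj h1
      · exact absurd hj0 (hpos j hj h1).ne'
    have hsurj : ∀ c : Fin r → ℝ, ∃ z ∈ V, cPart r m z = c := by
      have hinj : Function.Injective ((cPart r m).domRestrict V) := by
        rw [← LinearMap.ker_eq_bot, LinearMap.ker_eq_bot']
        rintro ⟨z, hz⟩ hz0
        exact Subtype.ext (hVc z hz hz0)
      have := (LinearMap.injective_iff_surjective_of_finrank_eq_finrank
        (by rw [hVdim, Module.finrank_fin_fun])).1 hinj
      intro c
      obtain ⟨z, hz⟩ := this c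
      exact ⟨z, z.2, hz⟩
    have hle := feasible_max_le hf V hsurj hgen' hx hy hmem
    rcases le_max_iff.1 hle with h1 | h1
    · exact Or.inl fun z hz => (hopt z hz).trans h1
    · exact Or.inr fun z hz => (hopt z hz).trans h1

end Dual

/-! ### Reasoning about programs -/

section Machine

variable {r n m : ℕ} {O : Oracles r n m}

/-- Total correctness with a time bound: started in `s`, the program `p` halts within `T` steps in a
state that satisfies `P`. -/
def Runs (O : Oracles r n m) (p : Prog) (s : State) (T : ℕ) (P : State → Prop) : Prop :=
  ∃ s' t, Exec O p s s' t ∧ t ≤ T ∧ P s'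

/-- The states `s` and `s'` agree except possibly on the integer arrays in `ns` and the real arrays
in `rs`. -/
structure Same (ns rs : List ℕ) (s s' : State) : Prop where
  nat : ∀ k, k ∉ ns → s'.nat k = s.nat k
  real : ∀ k, k ∉ rs → s'.real k = s.real k

theorem Same.trans {ns rs ns' rs' ns'' rs'' : List ℕ} {s s' s'' : State} (h : Same ns rs s s')
    (h' : Same ns' rs' s' s'') (hn : ns ⊆ ns'') (hn' : ns' ⊆ ns'') (hr : rs ⊆ rs'')
    (hr' : rs' ⊆ rs'') : Same ns'' rs'' s s'' :=
  ⟨fun k hk => (h'.nat k fun h => hk (hn' h)).trans (h.nat k fun h => hk (hn h)),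
    fun k hk => (h'.real k fun h => hk (hr' h)).trans (h.real k fun h => hk (hr h))⟩

theorem Same.mono {ns rs ns' rs' : List ℕ} {s s' : State} (h : Same ns rs s s') (hn : ns ⊆ ns')
    (hr : rs ⊆ rs') : Same ns' rs' s s' :=
  ⟨fun k hk => h.nat k fun h => hk (hn h), fun k hk => h.real k fun h => hk (hr h)⟩

theorem Same.setNat {ns rs : List ℕ} (s : State) {k : ℕ} (i v : ℕ) (hk : k ∈ ns) :
    Same ns rs s (s.setNat k i v) :=
  ⟨fun k' hk' => by
    have : k' ≠ k := fun h => hk' (h ▸ hk)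
    funext i'
    simp [State.setNat, this], fun _ _ => rfl⟩

theorem Same.setReal {ns rs : List ℕ} (s : State) {k : ℕ} (i j : ℕ) (v : ℝ) (hk : k ∈ rs) :
    Same ns rs s (s.setReal k i j v) :=
  ⟨fun _ _ => rfl, fun k' hk' => by
    have : k' ≠ k := fun h => hk' (h ▸ hk)
    funext i' j'
    simp [State.setReal, this]⟩

@[simp] theorem setNat_real (s : State) (k i v : ℕ) : (s.setNat k i v).real = s.real := rfl

@[simp] theorem setReal_nat (s : State) (k i j : ℕ) (v : ℝ) : (s.setReal k i j v).nat = s.nat := rfl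

theorem setNat_nat (s : State) (k i v k' i' : ℕ) :
    (s.setNat k i v).nat k' i' = if k' = k ∧ i' = i then v else s.nat k' i' := rfl

theorem setReal_real (s : State) (k i j : ℕ) (v : ℝ) (k' i' j' : ℕ) :
    (s.setReal k i j v).real k' i' j' = if k' = k ∧ i' = i ∧ j' = j then v else s.real k' i' j' :=
  rfl

@[simp] theorem setNat_nat_self (s : State) (k i v : ℕ) : (s.setNat k i v).nat k i = v := by
  simp [setNat_nat]

@[simp] theorem setReal_real_self (s : State) (k i j : ℕ) (v : ℝ) :
    (s.setReal k i j v).real k i j = v := by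
  simp [setReal_real]

theorem Runs.mono {p : Prog} {s : State} {T T' : ℕ} {P P' : State → Prop} (h : Runs O p s T P)
    (hT : T ≤ T') (hP : ∀ s', P s' → P' s') : Runs O p s T' P' := by
  obtain ⟨s', t, h1, h2, h3⟩ := h
  exact ⟨s', t, h1, h2.trans hT, hP s' h3⟩

theorem Runs.setNat {k : ℕ} {i e : NExp} {s : State} {T : ℕ} {P : State → Prop}
    (hT : i.cost + e.cost + 1 ≤ T) (h : P (s.setNat k (i.eval s) (e.eval s))) :
    Runs O (.setNat k i e) s T P :=
  ⟨_, _, .setNat k i e s, hT, h⟩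

theorem Runs.setReal {k : ℕ} {i j : NExp} {e : RExp} {s : State} {T : ℕ} {P : State → Prop}
    (hT : i.cost + j.cost + e.cost + 1 ≤ T)
    (h : P (s.setReal k (i.eval s) (j.eval s) (e.eval s))) :
    Runs O (.setReal k i j e) s T P :=
  ⟨_, _, .setReal k i j e s, hT, h⟩

theorem Runs.seq {p q : Prog} {s : State} {T T' T'' : ℕ} {P P' : State → Prop}
    (hT : T + T' ≤ T'') (h : Runs O p s T P) (h' : ∀ s', P s' → Runs O q s' T' P') :
    Runs O (.seq p q) s T'' P' := by
  obtain ⟨s', t, h1, h2, h3⟩ := h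
  obtain ⟨s'', t', h4, h5, h6⟩ := h' s' h3
  exact ⟨s'', t + t', .seq h1 h4, (add_le_add h2 h5).trans hT, h6⟩

theorem Runs.branch {c : Test} {p q : Prog} {s : State} (T : ℕ) {T' : ℕ} {P : State → Prop}
    (hT : c.cost + T ≤ T') (h : c.holds s → Runs O p s T P) (h' : ¬ c.holds s → Runs O q s T P) :
    Runs O (.branch c p q) s T' P := by
  by_cases hc : c.holds s
  · obtain ⟨s', t, h1, h2, h3⟩ := h hc
    exact ⟨s', _, .branchTrue hc h1, (by omega : c.cost + t ≤ T'), h3⟩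
  · obtain ⟨s', t, h1, h2, h3⟩ := h' hc
    exact ⟨s', _, .branchFalse hc h1, (by omega : c.cost + t ≤ T'), h3⟩

/-- A loop whose test holds exactly during its first `N` iterations. -/
theorem Runs.loop {c : Test} {p : Prog} {s : State} {N T : ℕ} (Inv : ℕ → State → Prop)
    (h0 : Inv 0 s) (hcont : ∀ i < N, ∀ s', Inv i s' → c.holds s')
    (hend : ∀ s', Inv N s' → ¬ c.holds s')
    (hstep : ∀ i < N, ∀ s', Inv i s' → Runs O p s' T (Inv (i + 1))) :
    Runs O (.loop c p) s (N * (c.cost + T) + c.cost) (Inv N) := by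
  have key : ∀ j i, i + j = N → ∀ s', Inv i s' →
      Runs O (.loop c p) s' (j * (c.cost + T) + c.cost) (Inv N) := by
    intro j
    induction j with
    | zero =>
      rintro i rfl s' hs'
      exact ⟨s', _, .loopFalse (hend s' hs'), by omega, hs'⟩
    | succ j ih =>
      intro i hi s' hs'
      obtain ⟨s1, t1, h1, h2, h3⟩ := hstep i (by omega) s' hs'
      obtain ⟨s2, t2, h4, h5, h6⟩ := ih (i + 1) (by omega) s1 h3
      refine ⟨s2, _, .loopTrue (hcont i (by omega) s' hs') h1 h4, ?_, h6⟩
      have : (j + 1) * (c.cost + T) = j * (c.cost + T) + (c.cost + T) := by ring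
      omega
  exact key N 0 (by omega) s h0

/-- The integer scalar stored in entry `0` of array `k`. -/
abbrev nv (k : ℕ) : NExp := .get k (.const 0)

/-- The real scalar stored in entry `(0, 0)` of array `k`. -/
abbrev rv (k : ℕ) : RExp := .get k (.const 0) (.const 0)

/-- `for v = 0, …, lim - 1` do `body`. -/
abbrev forLoop (v : ℕ) (lim : NExp) (body : Prog) : Prog :=
  .seq (.setNat v (.const 0) (.const 0))
    (.loop (.natLt (nv v) lim) (.seq body (.setNat v (.const 0) (.add (nv v) (.const 1)))))

/-- A statement without effect on the arrays in use. -/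
abbrev skip : Prog := .setNat 28 (.const 0) (.const 0)

theorem Runs.skip {s : State} : Runs O skip s 3 (fun s' => Same [28] [] s s') :=
  .setNat (by decide) (Same.setNat _ _ _ (by simp))

/-- Loops of at most `L` iterations with loop counter `v`, where `φ i` holds after `i`
iterations. -/
theorem Runs.forLoop {v : ℕ} {lim : NExp} {body : Prog} {s : State} {N T : ℕ} (L : ℕ)
    (ns rs : List ℕ) (φ : ℕ → State → Prop) (hNL : N ≤ L) (hL : 1 ≤ L) (hcost : lim.cost ≤ 10)
    (hv : v ∉ ns) (hlim : ∀ s', Same (v :: ns) rs s s' → lim.eval s' = N)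
    (hφ : ∀ i s' x, φ i s' → φ i (s'.setNat v 0 x)) (h0 : φ 0 s)
    (hstep : ∀ i < N, ∀ s', Same (v :: ns) rs s s' → s'.nat v 0 = i → φ i s' →
      Runs O body s' T (fun s'' => Same ns rs s' s'' ∧ φ (i + 1) s'')) :
    Runs O (forLoop v lim body) s (L * (T + 40)) (fun s' => Same (v :: ns) rs s s' ∧ φ N s') := by
  have hmem : v ∈ v :: ns := List.mem_cons_self
  have hsub : ns ⊆ v :: ns := List.subset_cons_self _ _
  have key := Runs.loop (O := O) (c := .natLt (nv v) lim)
    (p := .seq body (.setNat v (.const 0) (.add (nv v) (.const 1)))) (s := s.setNat v 0 0)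
    (N := N) (T := T + 6) (fun i s' => Same (v :: ns) rs s s' ∧ s'.nat v 0 = i ∧ φ i s')
    ⟨Same.setNat _ _ _ hmem, by simp, hφ _ _ _ h0⟩
    (fun i hi s' h => by
      simp only [Test.holds, NExp.eval, hlim s' h.1, h.2.1]
      exact hi)
    (fun s' h => by
      simp only [Test.holds, NExp.eval, hlim s' h.1, h.2.1]
      exact lt_irrefl _)
    (fun i hi s' h => by
      refine Runs.seq le_rfl (hstep i hi s' h.1 h.2.1 h.2.2) fun s'' h'' =>
        Runs.setNat (by simp [NExp.cost]) ?_
      have h1 : s''.nat v 0 = i := by rw [h''.1.nat v hv, h.2.1]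
      simp only [NExp.eval, h1]
      refine ⟨?_, by simp, hφ _ _ _ h''.2⟩
      exact (h.1.trans h''.1 (List.Subset.refl _) hsub (List.Subset.refl _)
        (List.Subset.refl _)).trans (Same.setNat (ns := v :: ns) (rs := rs) _ _ _ hmem)
        (List.Subset.refl _) (List.Subset.refl _) (List.Subset.refl _) (List.Subset.refl _))
  obtain ⟨s', t, h1, h2, h3⟩ := key
  refine ⟨s', _, .seq (.setNat v (.const 0) (.const 0) s) h1, ?_, h3.1, h3.2.2⟩
  have hc : (Test.natLt (nv v) lim).cost ≤ 13 := by
    simp only [Test.cost, NExp.cost]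
    omega
  have h4 : N * ((Test.natLt (nv v) lim).cost + (T + 6)) ≤ L * (T + 19) :=
    Nat.mul_le_mul hNL (by omega)
  have h5 : L * (T + 40) = L * (T + 19) + L * 21 := by ring
  simp only [NExp.cost]
  omega

/-- Assignment to the first `N` entries of a row of a real array. -/
theorem Runs.fillRow {v k : ℕ} {lim row : NExp} {e : RExp} {s : State} {N ρ T : ℕ} (L : ℕ)
    (g : ℕ → ℝ) (hNL : N ≤ L) (hL : 1 ≤ L) (hcost : lim.cost ≤ 10)
    (hT : row.cost + (nv v).cost + e.cost + 1 ≤ T)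
    (hlim : ∀ s', Same [v] [k] s s' → lim.eval s' = N)
    (hrow : ∀ s', Same [v] [k] s s' → row.eval s' = ρ)
    (he : ∀ a < N, ∀ s', Same [v] [k] s s' → s'.nat v 0 = a →
      (∀ i j, i ≠ ρ ∨ a ≤ j → s'.real k i j = s.real k i j) → e.eval s' = g a) :
    Runs O (Prog.seq (.setNat v (.const 0) (.const 0)) (.loop (.natLt (nv v) lim)
        (.seq (.setReal k row (nv v) e) (.setNat v (.const 0) (.add (nv v) (.const 1))))))
      s (L * (T + 40))
      (fun s' => Same [v] [k] s s' ∧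
        ∀ i j, s'.real k i j = if i = ρ ∧ j < N then g j else s.real k i j) := by
  refine Runs.forLoop L [] [k] (fun a s' => ∀ i j, s'.real k i j =
    if i = ρ ∧ j < a then g j else s.real k i j) hNL hL hcost (by simp) hlim
    (fun _ _ _ h => h) (by simp) ?_
  intro a ha s' hs hva hφ
  refine Runs.setReal hT ⟨Same.setReal _ _ _ _ (by simp), fun i j => ?_⟩
  have h1 := he a ha s' hs hva fun i j hij => by
    rw [hφ i j, if_neg]
    rintro ⟨h1, h2⟩
    rcases hij with h | h
    · exact h h1
    · omega
  have h2 : (nv v).eval s' = a := hva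
  rw [setReal_real, hrow s' hs, h1, h2, hφ i j]
  by_cases hi : i = ρ
  · by_cases hj : j = a
    · simp [hi, hj]
    · have : j < a + 1 ↔ j < a := by omega
      simp [hi, hj, this]
  · simp [hi]

end Machine

/-! ### The coefficients of the arrangement -/

/-!
Memory of the program, besides the arrays that hold the input and serve the subroutines.

* Integer scalars: `3`, `4`, `5`, `27` for `d = r + (m + 1)`, `m + 1`, the number `Q = 2 (d + n)` of
  functionals and `d + n`; `8` for the existence of an output; `9` for the pivot, `10` for the
  selected functional, `11` for the carry, `12` for a position; `20` to `26` for loop counters.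
* Integer arrays: `6` for the increasing sequence and `7` for the digit string that are enumerated.
* Real arrays: `7` for the functionals, `8` for a spanning set, `9` for the directions, row `0` of
  `10` for the vector `(c, lam, γ)`, `11` to `13` for scalars, `14` for products.

The constants in the time bounds are generous.
-/

section Machine

variable {r n m : ℕ} {O : Oracles r n m}
variable {A : Matrix (Fin r) (Fin n) ℝ} {M : Matrix (Fin m) (Fin n) ℝ}

/-- Real scalar `11` receives the coefficient with indices `20` and `22` of `baseRow`. -/
def coefProg : Prog :=
  .branch (.natLt (nv 20) (nv 3))
    (.branch (.natLt (nv 22) (nv 20)) (.setReal 11 (.const 0) (.const 0) (.const 0))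
      (.branch (.natLt (nv 20) (nv 22)) (.setReal 11 (.const 0) (.const 0) (.const 0))
        (.setReal 11 (.const 0) (.const 0) (.const 1))))
    (.branch (.natLt (nv 22) (.get 0 (.const 0)))
      (.setReal 11 (.const 0) (.const 0) (.get 0 (nv 22) (.sub (nv 20) (nv 3))))
      (.branch (.natLt (.get 0 (.const 0)) (nv 22))
        (.setReal 11 (.const 0) (.const 0) (.sub (.const 0)
          (.get 1 (.sub (nv 22) (.add (.get 0 (.const 0)) (.const 1))) (.sub (nv 20) (nv 3)))))
        (.setReal 11 (.const 0) (.const 0) (.sub (.const 0) (.const 1)))))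

/-- Real array `7` receives the rows of the arrangement. -/
def rowsProg : Prog :=
  forLoop 20 (nv 27) <| forLoop 22 (nv 3) <| .seq coefProg <|
    .seq (.setReal 7 (.add (nv 20) (nv 20)) (nv 22) (rv 11))
      (.setReal 7 (.add (.add (nv 20) (nv 20)) (.const 1)) (nv 22) (.sub (.const 0) (rv 11)))

/-- Integer arrays `3`, `4`, `5` and `27` receive the dimension `d = r + (m + 1)` of the
arrangement, the number `m + 1`, the number `2 (d + n)` of rows, and `d + n`. -/
def setupProg : Prog :=
  .seq (.setNat 3 (.const 0) (.add (.get 0 (.const 0)) (.add (.get 0 (.const 2)) (.const 1)))) <|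
  .seq (.setNat 4 (.const 0) (.add (.get 0 (.const 2)) (.const 1))) <|
  .seq (.setNat 27 (.const 0) (.add (nv 3) (.get 0 (.const 1)))) <|
  .seq (.setNat 5 (.const 0) (.add (nv 27) (nv 27))) rowsProg

/-- The memory holds the parameters of the instance and the rows of the arrangement. -/
structure Env (A : Matrix (Fin r) (Fin n) ℝ) (M : Matrix (Fin m) (Fin n) ℝ) (s : State) :
    Prop where
  hr : s.nat 0 0 = r
  hn : s.nat 0 1 = n
  hm : s.nat 0 2 = m
  hd : s.nat 3 0 = r + (m + 1)
  hq : s.nat 4 0 = m + 1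
  hQ : s.nat 5 0 = 2 * (r + (m + 1) + n)
  rows : ∀ i < 2 * (r + (m + 1) + n), ∀ a < r + (m + 1),
    s.real 7 i a = row r (r + (m + 1)) (toArray A) (toArray M) i a

theorem Env.same {s s' : State} (h : Env A M s) {ns rs : List ℕ} (hs : Same ns rs s s')
    (h0 : 0 ∉ ns) (h3 : 3 ∉ ns) (h4 : 4 ∉ ns) (h5 : 5 ∉ ns) (h7 : 7 ∉ rs) : Env A M s' := by
  refine ⟨?_, ?_, ?_, ?_, ?_, ?_, ?_⟩
  · rw [hs.nat 0 h0, h.hr]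
  · rw [hs.nat 0 h0, h.hn]
  · rw [hs.nat 0 h0, h.hm]
  · rw [hs.nat 3 h3, h.hd]
  · rw [hs.nat 4 h4, h.hq]
  · rw [hs.nat 5 h5, h.hQ]
  · rw [hs.real 7 h7]
    exact h.rows

theorem Env.rowFun_getVec {s : State} (h : Env A M s) {j : ℕ} (hj : j < 2 * (r + (m + 1) + n))
    (k i : ℕ) : rowFun A M j (s.getVec (r + (m + 1)) k i) =
      ∑ a ∈ Finset.range (r + (m + 1)), s.real 7 j a * s.real k i a := by
  rw [rowFun, lin_apply, ← Fin.sum_univ_eq_sum_range (fun a => s.real 7 j a * s.real k i a)]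
  exact Finset.sum_congr rfl fun a _ => by rw [h.rows j hj a a.2]; rfl

theorem input_real_zero (A : Matrix (Fin r) (Fin n) ℝ) (M : Matrix (Fin m) (Fin n) ℝ)
    (b : Fin m → ℝ) : (input A M b).real 0 = toArray A := by
  funext i j
  simp [input, toArray]

theorem input_real_one (A : Matrix (Fin r) (Fin n) ℝ) (M : Matrix (Fin m) (Fin n) ℝ)
    (b : Fin m → ℝ) : (input A M b).real 1 = toArray M := by
  funext i j
  simp [input, toArray]

theorem runs_coef (s : State) : Runs O coefProg s 50 (fun s' => Same [] [11] s s' ∧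
    s'.real 11 0 0 =
      baseRow (s.nat 0 0) (s.nat 3 0) (s.real 0) (s.real 1) (s.nat 20 0) (s.nat 22 0)) := by
  refine Runs.branch 45 (by decide) (fun h => ?_) (fun h => ?_)
  · simp only [Test.holds, NExp.eval] at h
    refine Runs.branch 40 (by decide) (fun h' => ?_) (fun h' => ?_)
    · simp only [Test.holds, NExp.eval] at h'
      refine Runs.setReal (by decide) ⟨Same.setReal _ _ _ _ (by simp), ?_⟩
      simp [RExp.eval, NExp.eval, baseRow, h, h'.ne]
    · simp only [Test.holds, NExp.eval] at h'
      refine Runs.branch 30 (by decide) (fun h'' => ?_) (fun h'' => ?_)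
      · simp only [Test.holds, NExp.eval] at h''
        refine Runs.setReal (by decide) ⟨Same.setReal _ _ _ _ (by simp), ?_⟩
        simp [RExp.eval, NExp.eval, baseRow, h, h''.ne']
      · simp only [Test.holds, NExp.eval] at h''
        refine Runs.setReal (by decide) ⟨Same.setReal _ _ _ _ (by simp), ?_⟩
        have : s.nat 22 0 = s.nat 20 0 := by omega
        simp [RExp.eval, NExp.eval, baseRow, h, this]
  · simp only [Test.holds, NExp.eval] at h
    refine Runs.branch 40 (by decide) (fun h' => ?_) (fun h' => ?_)
    · simp only [Test.holds, NExp.eval] at h'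
      refine Runs.setReal (by decide) ⟨Same.setReal _ _ _ _ (by simp), ?_⟩
      simp only [RExp.eval, NExp.eval, baseRow, h, h', if_true, if_false, setReal_real_self]
    · simp only [Test.holds, NExp.eval] at h'
      refine Runs.branch 30 (by decide) (fun h'' => ?_) (fun h'' => ?_)
      · simp only [Test.holds, NExp.eval] at h''
        refine Runs.setReal (by decide) ⟨Same.setReal _ _ _ _ (by simp), ?_⟩
        simp only [RExp.eval, NExp.eval, baseRow, h, h', h''.ne', if_false, setReal_real_self,
          Nat.cast_zero, zero_sub]
      · simp only [Test.holds, NExp.eval] at h''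
        refine Runs.setReal (by decide) ⟨Same.setReal _ _ _ _ (by simp), ?_⟩
        have : s.nat 22 0 = s.nat 0 0 := by omega
        simp [RExp.eval, NExp.eval, baseRow, h, this]

theorem runs_setup (b : Fin m → ℝ) (W : ℕ) (hW : 1 ≤ W) (hnW : n ≤ W) :
    Runs O setupProg (input A M b) ((r + (m + 1)) * ((r + (m + 1)) * W) * 1000)
      (fun s => Env A M s ∧ s.nat 8 0 = 0) := by
  set d := r + (m + 1) with hd
  have hd1 : 1 ≤ d := by omega
  set s₀ := input A M b with hs₀
  set s₁ : State := (((s₀.setNat 3 0 d).setNat 4 0 (m + 1)).setNat 27 0 (d + n)).setNat 5 0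
    (2 * (d + n)) with hs₁
  have hloop : Runs O rowsProg s₁
      ((d + n) * (d * (100 + 40) + 40)) (fun s => Same [20, 22] [7, 11] s₁ s ∧
        ∀ i < d + n, ∀ a < d, s.real 7 (i + i) a = baseRow r d (toArray A) (toArray M) i a ∧
          s.real 7 (i + i + 1) a = -baseRow r d (toArray A) (toArray M) i a) := by
    refine Runs.forLoop (d + n) [22] [7, 11] (N := d + n) (fun k s => ∀ i < k, ∀ a < d,
      s.real 7 (i + i) a = baseRow r d (toArray A) (toArray M) i a ∧
        s.real 7 (i + i + 1) a = -baseRow r d (toArray A) (toArray M) i a)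
      le_rfl (by omega) (by decide) (by decide)
      (fun s hs => by simp only [NExp.eval, hs.nat 27 (by decide)]; simp [hs₁, setNat_nat])
      (fun _ _ _ h => h) (by simp) ?_
    intro i hi s hs hi20 hφ
    refine Runs.mono (Runs.forLoop d [] [7, 11] (N := d) (T := 100)
      (fun k s' => (∀ i' < i, ∀ a < d,
        s'.real 7 (i' + i') a = baseRow r d (toArray A) (toArray M) i' a ∧
          s'.real 7 (i' + i' + 1) a = -baseRow r d (toArray A) (toArray M) i' a) ∧ ∀ a < k,
        s'.real 7 (i + i) a = baseRow r d (toArray A) (toArray M) i a ∧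
          s'.real 7 (i + i + 1) a = -baseRow r d (toArray A) (toArray M) i a)
      le_rfl hd1 (by decide) (by decide) ?_ (fun _ _ _ h => h) ⟨hφ, by simp⟩ ?_) le_rfl ?_
    · intro s' hs'
      simp only [NExp.eval, hs'.nat 3 (by decide), hs.nat 3 (by decide)]
      simp [hs₁, setNat_nat]
    · intro a ha s' hs' ha22 hφ'
      have hn3 : s'.nat 3 0 = d := by
        rw [hs'.nat 3 (by decide), hs.nat 3 (by decide)]
        simp [hs₁, setNat_nat]
      have hn0 : s'.nat 0 0 = r := by
        rw [hs'.nat 0 (by decide), hs.nat 0 (by decide)]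
        simp [hs₁, setNat_nat, hs₀, input]
      have hn20 : s'.nat 20 0 = i := by rw [hs'.nat 20 (by decide), hi20]
      have hr0 : s'.real 0 = toArray A := by
        rw [hs'.real 0 (by decide), hs.real 0 (by decide), ← input_real_zero A M b]
        rfl
      have hr1 : s'.real 1 = toArray M := by
        rw [hs'.real 1 (by decide), hs.real 1 (by decide), ← input_real_one A M b]
        rfl
      refine Runs.seq (T := 50) (T' := 50) (by norm_num)
        (P := fun s'' => Same [] [11] s' s'' ∧
          s''.real 11 0 0 = baseRow r d (toArray A) (toArray M) i a) ?_ ?_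
      · have := runs_coef (O := O) s'
        rwa [hn0, hn3, hn20, ha22, hr0, hr1] at this
      · rintro s2 ⟨hs2, hx⟩
        have h20 : s2.nat 20 0 = i := by rw [hs2.nat 20 (by decide), hn20]
        have h22 : s2.nat 22 0 = a := by rw [hs2.nat 22 (by decide), ha22]
        have h7 : s2.real 7 = s'.real 7 := hs2.real 7 (by decide)
        refine Runs.seq (T := 25) (T' := 25) (by norm_num)
          (Runs.setReal (P := fun s3 => s3 = _) (by decide) rfl) ?_
        rintro s3 rfl
        refine Runs.setReal (by decide) ⟨?_, ?_, ?_⟩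
        · exact (hs2.trans (Same.setReal (ns := []) (rs := [7]) _ _ _ _ (by simp))
            (by simp) (by simp) (ns'' := []) (rs'' := [7, 11]) (by simp) (by simp)).trans
            (Same.setReal (ns := []) (rs := [7]) _ _ _ _ (by simp)) (by simp) (by simp) (by simp)
            (by simp)
        · intro i' hi' a' ha'
          have := hφ'.1 i' hi' a' ha'
          have e1 : ¬ (i' + i' = i + i) := by omega
          have e2 : ¬ (i' + i' = i + i + 1) := by omega
          have e3 : ¬ (i' + i' + 1 = i + i) := by omega
          have e4 : ¬ (i' + i' + 1 = i + i + 1) := by omega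
          simp only [NExp.eval, setReal_nat, h20, h22, setReal_real, e1, e2, e3, e4, h7]
          simpa using this
        · intro a' ha'
          have e1 : ¬ (i + i + 1 = i + i) := by omega
          have e2 : ¬ (i + i = i + i + 1) := by omega
          by_cases haa : a' = a
          · simp [NExp.eval, RExp.eval, h20, h22, setReal_real, haa, hx]
          · have := hφ'.2 a' (by omega)
            simp only [NExp.eval, setReal_nat, h20, h22, setReal_real, haa, h7]
            simpa using this
    · rintro s' ⟨hs', h1, h2⟩
      refine ⟨hs', fun i' hi' a ha => ?_⟩
      rcases Nat.lt_succ_iff_lt_or_eq.1 hi' with h3 | rfl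
      · exact h1 i' h3 a ha
      · exact h2 a ha
  refine Runs.seq (T := 10) (T' := 30 + (d + n) * (d * (100 + 40) + 40)) ?_
    (Runs.setNat (P := fun s => s = _) (by decide) rfl) ?_
  · have h1 : 1 ≤ d * W := Nat.mul_pos hd1 hW
    have h2 : d + n ≤ d * W + d * W := by
      have : d * 1 ≤ d * W := Nat.mul_le_mul_left _ hW
      have : 1 * W ≤ d * W := Nat.mul_le_mul_right _ hd1
      omega
    have h3 : (d + n) * (d * (100 + 40) + 40) ≤ (d * W + d * W) * (d * 180) :=
      Nat.mul_le_mul h2 (by omega)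
    have h4 : (d * W + d * W) * (d * 180) = d * (d * W) * 360 := by ring
    have h5 : 1 * 1 ≤ d * (d * W) := Nat.mul_le_mul hd1 h1
    omega
  rintro s rfl
  refine Runs.seq (T := 10) (T' := 20 + (d + n) * (d * (100 + 40) + 40)) (by omega)
    (Runs.setNat (P := fun s => s = _) (by decide) rfl) ?_
  rintro s rfl
  refine Runs.seq (T := 10) (T' := 10 + (d + n) * (d * (100 + 40) + 40)) (by omega)
    (Runs.setNat (P := fun s => s = _) (by decide) rfl) ?_
  rintro s rfl
  refine Runs.seq (T := 10) (T' := (d + n) * (d * (100 + 40) + 40)) (by omega)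
    (Runs.setNat (P := fun s => s = _) (by decide) rfl) ?_
  rintro s rfl
  suffices H : ∀ s, s = s₁ → Runs O rowsProg s ((d + n) * (d * (100 + 40) + 40))
      (fun s' => Env A M s' ∧ s'.nat 8 0 = 0) by
    refine H _ ?_
    rw [hs₁]
    simp only [NExp.eval, setNat_nat, hs₀, input, hd]
    simp [two_mul]
  rintro s rfl
  refine Runs.mono hloop le_rfl ?_
  rintro s ⟨hs, hrow⟩
  refine ⟨⟨?_, ?_, ?_, ?_, ?_, ?_, ?_⟩, ?_⟩
  · rw [hs.nat 0 (by decide)]; simp [hs₁, setNat_nat, hs₀, input]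
  · rw [hs.nat 0 (by decide)]; simp [hs₁, setNat_nat, hs₀, input]
  · rw [hs.nat 0 (by decide)]; simp [hs₁, setNat_nat, hs₀, input]
  · rw [hs.nat 3 (by decide)]; simp [hs₁, setNat_nat, hd]
  · rw [hs.nat 4 (by decide)]; simp [hs₁, setNat_nat]
  · rw [hs.nat 5 (by decide)]; simp [hs₁, hd]
  · intro i hi a ha
    have := hrow (i / 2) (by omega) a ha
    rcases Nat.mod_two_eq_zero_or_one i with h | h
    · rw [show i / 2 + i / 2 = i by omega] at this
      rw [this.1]
      simp [row, h]
      rfl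
    · rw [show i / 2 + i / 2 + 1 = i by omega] at this
      rw [this.2]
      simp [row, h]
      rfl
  · rw [hs.nat 8 (by decide)]; simp [hs₁, setNat_nat, hs₀, input]

end Machine

section Machine

variable {r n m : ℕ} {O : Oracles r n m}
variable {A : Matrix (Fin r) (Fin n) ℝ} {M : Matrix (Fin m) (Fin n) ℝ}

/-! ### Elimination -/

/-- Real scalar `k` receives the sum of `e` over all values of the counter `22` below `d`. -/
def sumProg (k : ℕ) (e : RExp) : Prog :=
  .seq (.setReal k (.const 0) (.const 0) (.const 0))
    (forLoop 22 (nv 3) (.setReal k (.const 0) (.const 0) (.add (rv k) e)))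

theorem runs_sum {k d : ℕ} {e : RExp} {s : State} (hd : s.nat 3 0 = d) (hd1 : 1 ≤ d) (g : ℕ → ℝ)
    (hcost : e.cost ≤ 15) (he : ∀ a < d, ∀ s', Same [22] [k] s s' → s'.nat 22 0 = a →
      e.eval s' = g a) :
    Runs O (sumProg k e) s (d * 70) (fun s' => Same [22] [k] s s' ∧
      s'.real k 0 0 = ∑ a ∈ Finset.range d, g a) := by
  refine Runs.seq (T := 4) (T' := d * (25 + 40)) (by omega)
    (P := fun s' => Same [] [k] s s' ∧ s'.real k 0 0 = 0)
    (Runs.setReal (by simp [NExp.cost, RExp.cost])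
      ⟨Same.setReal _ _ _ _ (by simp), by simp [NExp.eval, RExp.eval]⟩) ?_
  rintro s₁ ⟨hs₁, hk⟩
  refine Runs.mono (Runs.forLoop d [] [k] (N := d)
    (fun i s' => s'.real k 0 0 = ∑ a ∈ Finset.range i, g a) le_rfl hd1 (by decide) (by simp) ?_
    (fun _ _ _ h => h) (by simp [hk]) ?_) le_rfl ?_
  · intro s' hs'
    simp only [NExp.eval]
    rw [hs'.nat 3 (by decide), hs₁.nat 3 (by decide), hd]
  · intro a ha s' hs' ha22 hφ
    refine Runs.setReal ?_ ⟨Same.setReal _ _ _ _ (by simp), ?_⟩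
    · simp only [NExp.cost, RExp.cost]
      omega
    · have h1 := he a ha s' (hs₁.trans hs' (by simp) (by simp) (by simp) (by simp)) ha22
      simp only [NExp.eval, RExp.eval, setReal_real_self, hφ, h1, Finset.sum_range_succ]
  · rintro s' ⟨hs', h⟩
    exact ⟨hs₁.trans hs' (by simp) (by simp) (by simp) (by simp), h⟩

/-- Real array `8` receives the identity matrix. -/
def identityProg : Prog :=
  forLoop 21 (nv 3) <| .seq (forLoop 22 (nv 3) (.setReal 8 (nv 21) (nv 22) (.const 0)))
    (.setReal 8 (nv 21) (nv 21) (.const 1))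

theorem runs_identity {d : ℕ} {s : State} (hd : s.nat 3 0 = d) (hd1 : 1 ≤ d) :
    Runs O identityProg s (d * (d * 110)) (fun s' => Same [21, 22] [8] s s' ∧
      ∀ b < d, ∀ a < d, s'.real 8 b a = if a = b then 1 else 0) := by
  refine Runs.mono (Runs.forLoop d [22] [8] (N := d) (T := d * 60 + 10)
    (fun i s' => ∀ b < i, ∀ a < d, s'.real 8 b a = if a = b then 1 else 0) le_rfl hd1 (by decide)
    (by decide) ?_ (fun _ _ _ h => h) (by simp) ?_) (Nat.mul_le_mul_left d (by omega)) fun _ h => h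
  · intro s' hs'
    simp only [NExp.eval]
    rw [hs'.nat 3 (by decide), hd]
  · intro i hi s' hs' hi21 hφ
    refine Runs.seq (T := d * (20 + 40)) (T' := 10) le_rfl
      (Runs.fillRow d (N := d) (ρ := i) (fun _ => 0) le_rfl hd1 (by decide) (by decide) ?_ ?_ ?_) ?_
    · intro s'' hs''
      simp only [NExp.eval]
      rw [hs''.nat 3 (by decide), hs'.nat 3 (by decide), hd]
    · intro s'' hs''
      simp only [NExp.eval]
      rw [hs''.nat 21 (by decide), hi21]
    · intros
      simp [RExp.eval]
    · rintro s'' ⟨hs'', h⟩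
      refine Runs.setReal (by decide) ⟨hs''.trans (Same.setReal (ns := []) (rs := [8]) _ _ _ _
        (by simp)) (by simp) (by simp) (by simp) (by simp), fun b hb a ha => ?_⟩
      have h21 : (nv 21).eval s'' = i := by
        simp only [NExp.eval]
        rw [hs''.nat 21 (by decide), hi21]
      rw [h21, setReal_real, h]
      by_cases hbi : b = i
      · subst hbi
        by_cases hab : a = b
        · simp [hab, RExp.eval]
        · simp [hab, ha]
      · simp [hbi, hφ b (by omega) a ha]

/-- The products of the row selected by integer scalar `10` with the rows of real array `8` are
stored in real array `14`. Integer scalar `9` receives the index of a nonzero one, if there is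
one. -/
def dotsProg : Prog :=
  .seq (.setNat 9 (.const 0) (.const 0)) <| forLoop 21 (nv 3) <|
    .seq (sumProg 11 (.mul (.get 7 (nv 10) (nv 22)) (.get 8 (nv 21) (nv 22)))) <|
    .seq (.setReal 14 (.const 0) (nv 21) (rv 11)) <|
    .branch (.realLt (.const 0) (.mul (rv 11) (rv 11))) (.setNat 9 (.const 0) (nv 21)) skip

/-- The pivot is recognized by the sign of a square, since tests compare only by `<`. -/
theorem runs_dots {d : ℕ} {s : State} (hd : s.nat 3 0 = d) (hd1 : 1 ≤ d) (g : ℕ → ℝ)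
    (hg : ∀ b, g b = ∑ a ∈ Finset.range d, s.real 7 (s.nat 10 0) a * s.real 8 b a) :
    Runs O dotsProg s (d * (d * 160)) (fun s' => Same [9, 21, 22, 28] [11, 14] s s' ∧
      (∀ b < d, s'.real 14 0 b = g b) ∧ s'.nat 9 0 < d ∧
        ((∃ b < d, g b ≠ 0) → g (s'.nat 9 0) ≠ 0)) := by
  refine Runs.seq (T := 3) (T' := d * (d * 100 + 10 + 40)) ?_
    (P := fun s' => Same [9] [] s s' ∧ s'.nat 9 0 = 0)
    (Runs.setNat (by decide) ⟨Same.setNat _ _ _ (by simp), by simp [NExp.eval]⟩) ?_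
  · have h1 : d * (d * 100 + 10 + 40) ≤ d * (d * 150) := Nat.mul_le_mul_left d (by omega)
    have h2 : 1 * 1 ≤ d * d := Nat.mul_le_mul hd1 hd1
    have h3 : d * (d * 160) = d * (d * 150) + d * d * 10 := by ring
    omega
  rintro s₁ ⟨hs₁, h9⟩
  refine Runs.mono (Runs.forLoop d [9, 22, 28] [11, 14] (N := d) (T := d * 100 + 10)
    (fun i s' => (∀ b < i, s'.real 14 0 b = g b) ∧ s'.nat 9 0 < d ∧
      ((∃ b < i, g b ≠ 0) → g (s'.nat 9 0) ≠ 0)) le_rfl hd1 (by decide) (by decide) ?_ ?_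
      ⟨by simp, by omega, by simp⟩ ?_) le_rfl ?_
  · intro s' hs'
    simp only [NExp.eval]
    rw [hs'.nat 3 (by decide), hs₁.nat 3 (by decide), hd]
  · intro i s' x h
    simpa [setNat_nat] using h
  · intro i hi s' hs' hi21 hφ
    refine Runs.seq (T := d * 70) (T' := 40) (by omega) (runs_sum (d := d) ?_ hd1
      (fun a => s.real 7 (s.nat 10 0) a * s.real 8 i a) (by decide) ?_) ?_
    · rw [hs'.nat 3 (by decide), hs₁.nat 3 (by decide), hd]
    · intro a ha s'' hs'' ha22
      simp only [NExp.eval, RExp.eval]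
      rw [ha22, hs''.nat 10 (by decide), hs''.nat 21 (by decide), hi21, hs''.real 7 (by decide),
        hs''.real 8 (by decide), hs'.nat 10 (by decide), hs'.real 7 (by decide),
        hs'.real 8 (by decide), hs₁.nat 10 (by decide), hs₁.real 7 (by decide),
        hs₁.real 8 (by decide)]
    · rintro s'' ⟨hs'', hx⟩
      rw [← hg] at hx
      have h21 : s''.nat 21 0 = i := by rw [hs''.nat 21 (by decide), hi21]
      have h9 : s''.nat 9 = s'.nat 9 := hs''.nat 9 (by decide)
      refine Runs.seq (T := 8) (T' := 32) (by norm_num)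
        (P := fun s3 => Same [] [14] s'' s3 ∧ (∀ b < i + 1, s3.real 14 0 b = g b))
        (Runs.setReal (by decide) ⟨Same.setReal _ _ _ _ (by simp), fun b hb => ?_⟩) ?_
      · simp only [NExp.eval, RExp.eval, setReal_real, h21, hx]
        by_cases hbi : b = i
        · simp [hbi]
        · have := hφ.1 b (by omega)
          simpa [hbi, hs''.real 14 (by decide)] using this
      · rintro s3 ⟨hs3, h14⟩
        have h21 : s3.nat 21 0 = i := by rw [hs3.nat 21 (by decide), h21]
        have hx : s3.real 11 0 0 = g i := by rw [hs3.real 11 (by decide), hx]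
        have h9 : s3.nat 9 = s'.nat 9 := by rw [hs3.nat 9 (by decide), h9]
        have hss : Same [9, 22, 28] [11, 14] s' s3 :=
          hs''.trans hs3 (by simp) (by simp) (by simp) (by simp)
        refine Runs.branch 20 (by decide) (fun hc => ?_) (fun hc => ?_)
        · simp only [Test.holds, RExp.eval, NExp.eval, hx, Nat.cast_zero] at hc
          refine Runs.setNat (by decide) ⟨hss.trans (Same.setNat (ns := [9]) (rs := []) _ _ _
            (by simp)) (by simp) (by simp) (by simp) (by simp), h14, ?_, ?_⟩
          · simp only [NExp.eval, setNat_nat_self, h21]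
            exact hi
          · simp only [NExp.eval, setNat_nat_self, h21]
            exact fun _ h0 => by simp [h0] at hc
        · simp only [Test.holds, RExp.eval, NExp.eval, hx, Nat.cast_zero] at hc
          have h0 : g i = 0 := by
            by_contra h0
            exact hc (mul_self_pos.2 h0)
          refine Runs.mono Runs.skip (by norm_num) fun s4 hs4 => ⟨hss.trans hs4 (by simp) (by simp)
            (by simp) (by simp), ?_, ?_, ?_⟩
          · rw [hs4.real 14 (by decide)]
            exact h14
          · rw [hs4.nat 9 (by decide), h9]
            exact hφ.2.1
          · rw [hs4.nat 9 (by decide), h9]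
            rintro ⟨b, hb, hgb⟩
            refine hφ.2.2 ⟨b, ?_, hgb⟩
            rcases Nat.lt_succ_iff_lt_or_eq.1 hb with h | rfl
            · exact h
            · exact absurd h0 hgb
  · rintro s' ⟨hs', h⟩
    exact ⟨hs₁.trans hs' (by simp) (by simp) (by simp) (by simp), h⟩

/-- The row with index `20` of real array `9` receives the pivot row of array `8`, normalized. -/
def dirProg : Prog :=
  forLoop 22 (nv 3) (.setReal 9 (nv 20) (nv 22)
    (.div (.get 8 (nv 9) (nv 22)) (.get 14 (.const 0) (nv 9))))

/-- Multiples of the normalized pivot row are subtracted from all rows of real array `8`. -/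
def eliminateProg : Prog :=
  forLoop 21 (nv 3) <| forLoop 22 (nv 3) (.setReal 8 (nv 21) (nv 22)
    (.sub (.get 8 (nv 21) (nv 22))
      (.mul (.get 14 (.const 0) (nv 21)) (.get 9 (nv 20) (nv 22)))))

theorem runs_dir {d : ℕ} {s : State} (hd : s.nat 3 0 = d) (hd1 : 1 ≤ d) :
    Runs O dirProg s (d * 70) (fun s' => Same [22] [9] s s' ∧ ∀ i j, s'.real 9 i j =
      if i = s.nat 20 0 ∧ j < d then s.real 8 (s.nat 9 0) j / s.real 14 0 (s.nat 9 0)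
      else s.real 9 i j) := by
  refine Runs.mono (Runs.fillRow d (N := d) (ρ := s.nat 20 0) (T := 30)
    (fun j => s.real 8 (s.nat 9 0) j / s.real 14 0 (s.nat 9 0)) le_rfl hd1
    (by decide) (by decide) ?_ ?_ ?_) le_rfl fun _ h => h
  · intro s' hs'
    simp only [NExp.eval]
    rw [hs'.nat 3 (by decide), hd]
  · intro s' hs'
    simp only [NExp.eval]
    rw [hs'.nat 20 (by decide)]
  · intro a ha s' hs' ha22 _
    simp only [NExp.eval, RExp.eval]
    rw [ha22, hs'.nat 9 (by decide), hs'.real 8 (by decide), hs'.real 14 (by decide)]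

theorem runs_eliminate {d : ℕ} {s : State} (hd : s.nat 3 0 = d) (hd1 : 1 ≤ d) :
    Runs O eliminateProg s (d * (d * 120)) (fun s' => Same [21, 22] [8] s s' ∧
      ∀ b < d, ∀ a < d, s'.real 8 b a =
        s.real 8 b a - s.real 14 0 b * s.real 9 (s.nat 20 0) a) := by
  refine Runs.mono (Runs.forLoop d [22] [8] (N := d) (T := d * (40 + 40))
    (fun i s' => ∀ b a, a < d → s'.real 8 b a = if b < i then
      s.real 8 b a - s.real 14 0 b * s.real 9 (s.nat 20 0) a else s.real 8 b a) le_rfl hd1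
    (by decide) (by decide) ?_ (fun _ _ _ h => h) (by simp) ?_)
    (Nat.mul_le_mul_left d (by omega)) ?_
  · intro s' hs'
    simp only [NExp.eval]
    rw [hs'.nat 3 (by decide), hd]
  · intro i hi s' hs' hi21 hφ
    refine Runs.mono (Runs.fillRow d (N := d) (ρ := i)
      (fun a => s'.real 8 i a - s.real 14 0 i * s.real 9 (s.nat 20 0) a) le_rfl hd1
      (by decide) (by decide) ?_ ?_ ?_) le_rfl ?_
    · intro s'' hs''
      simp only [NExp.eval]
      rw [hs''.nat 3 (by decide), hs'.nat 3 (by decide), hd]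
    · intro s'' hs''
      simp only [NExp.eval]
      rw [hs''.nat 21 (by decide), hi21]
    · intro a ha s'' hs'' ha22 hun
      simp only [NExp.eval, RExp.eval]
      rw [ha22, hs''.nat 21 (by decide), hi21, hun i a (Or.inr le_rfl), hs''.real 14 (by decide),
        hs''.real 9 (by decide), hs''.nat 20 (by decide), hs'.real 14 (by decide),
        hs'.real 9 (by decide), hs'.nat 20 (by decide)]
    · rintro s'' ⟨hs'', h⟩
      refine ⟨hs'', fun b a ha => ?_⟩
      rw [h]
      by_cases hbi : b = i
      · simp [hbi, ha, hφ i a ha]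
      · have : b < i + 1 ↔ b < i := by omega
        simp only [hbi, false_and, if_false, this]
        exact hφ b a ha
  · rintro s' ⟨hs', h⟩
    exact ⟨hs', fun b hb a ha => by rw [h b a ha, if_pos hb]⟩

/-- Integer scalar `10` receives the entry with index `20` of the concatenation of the first `m + 1`
entries of array `6` with array `7`. -/
def selectProg : Prog :=
  .branch (.natLt (nv 20) (nv 4)) (.setNat 10 (.const 0) (.get 6 (nv 20)))
    (.setNat 10 (.const 0) (.get 7 (.sub (nv 20) (nv 4))))

/-- The concatenation of the first `q` entries of `a` with `g`. -/
def selection (q : ℕ) (a g : ℕ → ℕ) (k : ℕ) : ℕ := if k < q then a k else g (k - q)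

theorem runs_select {s : State} : Runs O selectProg s 20 (fun s' => Same [10] [] s s' ∧
    s'.nat 10 0 = selection (s.nat 4 0) (s.nat 6) (s.nat 7) (s.nat 20 0)) := by
  refine Runs.branch 10 (by decide) (fun h => ?_) (fun h => ?_) <;>
  · simp only [Test.holds, NExp.eval] at h
    refine Runs.setNat (by decide) ⟨Same.setNat _ _ _ (by simp), ?_⟩
    simp [NExp.eval, selection, h]

/-- One elimination step. -/
def stepProg : Prog :=
  .seq selectProg <| .seq dotsProg <| .seq dirProg eliminateProg

/-- The rows of real array `8` span `V`. -/
def Spans (d : ℕ) (V : Submodule ℝ (Fin d → ℝ)) (s : State) : Prop :=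
  (∀ b < d, s.getVec d 8 b ∈ V) ∧
    ∀ z ∈ V, ∃ c : ℕ → ℝ, z = ∑ b ∈ Finset.range d, c b • (s.getVec d 8 b : Fin d → ℝ)

/-- The vector `D` of `V` is normalized by `h`, unless `h` vanishes on `V`. -/
def IsDirection {E : Type*} [AddCommGroup E] [Module ℝ E] (V : Submodule ℝ E) (h : E →ₗ[ℝ] ℝ)
    (D : E) : Prop :=
  D ∈ V ∧ ((∃ z ∈ V, h z ≠ 0) → h D = 1)

/-- A step passes from a spanning set of `V` to one of the intersection of `V` with the kernel of
the selected functional. -/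
theorem runs_step {s : State} (hs : Env A M s) {V : Submodule ℝ (Fin (r + (m + 1)) → ℝ)}
    (hV : Spans (r + (m + 1)) V s) {j : ℕ}
    (hj : j = selection (m + 1) (s.nat 6) (s.nat 7) (s.nat 20 0))
    (hjQ : j < 2 * (r + (m + 1) + n)) :
    Runs O stepProg s ((r + (m + 1)) * ((r + (m + 1)) * 400)) (fun s' =>
      Same [9, 10, 21, 22, 28] [8, 9, 11, 14] s s' ∧
      Spans (r + (m + 1)) (V ⊓ LinearMap.ker (rowFun A M j)) s' ∧
      IsDirection V (rowFun A M j) (s'.getVec (r + (m + 1)) 9 (s.nat 20 0)) ∧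
      ∀ i, i ≠ s.nat 20 0 → s'.real 9 i = s.real 9 i) := by
  have hd1 : 1 ≤ (r + (m + 1)) := by omega
  have hdd : (r + (m + 1)) * 1 ≤ (r + (m + 1)) * (r + (m + 1)) :=
    Nat.mul_le_mul_left (r + (m + 1)) hd1
  have hdd' : ∀ c, (r + (m + 1)) * ((r + (m + 1)) * c) = (r + (m + 1)) * (r + (m + 1)) * c :=
    fun c => by ring
  refine Runs.mono (T := (r + (m + 1)) * (r + (m + 1)) * 400) ?_ (hdd' 400).ge fun _ h => h
  refine Runs.seq (T := 20) (T' := (r + (m + 1)) * (r + (m + 1)) * 380) (by omega) runs_select ?_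
  rintro s₁ ⟨hs₁, h10⟩
  rw [hs.hq, ← hj] at h10
  have hE₁ : Env A M s₁ := hs.same hs₁ (by decide) (by decide) (by decide) (by decide) (by decide)
  have h8 : s₁.real 8 = s.real 8 := hs₁.real 8 (by decide)
  refine Runs.seq (T := (r + (m + 1)) * (r + (m + 1)) * 160)
    (T' := (r + (m + 1)) * (r + (m + 1)) * 220) (by omega)
    ((runs_dots (d := (r + (m + 1))) hE₁.hd hd1
      (fun b => rowFun A M j (s.getVec (r + (m + 1)) 8 b)) fun b => ?_).mono
    (hdd' 160).le fun _ h => h) ?_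
  · have := hE₁.rowFun_getVec hjQ 8 b
    have e : s₁.getVec (r + (m + 1)) 8 b = s.getVec (r + (m + 1)) 8 b :=
      funext fun a => congrFun (congrFun h8 b) a
    rw [h10, ← this, e]
  rintro s₂ ⟨hs₂, h14, h9, hpv⟩
  have h8₂ : s₂.real 8 = s.real 8 := by rw [hs₂.real 8 (by decide), h8]
  have h20₂ : s₂.nat 20 0 = s.nat 20 0 := by rw [hs₂.nat 20 (by decide), hs₁.nat 20 (by decide)]
  have h3₂ : s₂.nat 3 0 = (r + (m + 1)) := by rw [hs₂.nat 3 (by decide), hE₁.hd]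
  set p := s₂.nat 9 0 with hp
  refine Runs.seq (T := (r + (m + 1)) * 70) (T' := (r + (m + 1)) * (r + (m + 1)) * 120)
    (by omega) (runs_dir (d := (r + (m + 1))) h3₂ hd1) ?_
  rintro s₃ ⟨hs₃, hdir⟩
  have h3₃ : s₃.nat 3 0 = (r + (m + 1)) := by rw [hs₃.nat 3 (by decide), h3₂]
  refine Runs.mono (runs_eliminate (d := (r + (m + 1))) h3₃ hd1) (hdd' 120).le ?_
  rintro s₄ ⟨hs₄, hel⟩
  set h := rowFun A M j with hh
  set D : Fin (r + (m + 1)) → ℝ := s₄.getVec (r + (m + 1)) 9 (s.nat 20 0) with hD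
  -- If `h` vanishes on `V`, then the division by zero gives `D = 0`.
  have hDp : D = (h (s.getVec (r + (m + 1)) 8 p))⁻¹ • s.getVec (r + (m + 1)) 8 p := by
    funext a
    simp only [hD, State.getVec, hs₄.real 9 (by decide), hdir, h20₂, true_and, a.2, if_true,
      ← hp, h14 p h9, h8₂, Pi.smul_apply, smul_eq_mul]
    ring
  have hrow : ∀ b < (r + (m + 1)), s₄.getVec (r + (m + 1)) 8 b =
      s.getVec (r + (m + 1)) 8 b - h (s.getVec (r + (m + 1)) 8 b) • D := by
    intro b hb
    funext a
    have h20₃ : s₃.nat 20 0 = s.nat 20 0 := by rw [hs₃.nat 20 (by decide), h20₂]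
    have e1 := hel b hb a a.2
    rw [h20₃, hs₃.real 8 (by decide), hs₃.real 14 (by decide), h14 b hb, h8₂] at e1
    simp only [State.getVec, e1, Pi.sub_apply, Pi.smul_apply, smul_eq_mul, hD,
      hs₄.real 9 (by decide)]
  have hDV : D ∈ V := hDp ▸ V.smul_mem _ (hV.1 p h9)
  have hex : (∃ z ∈ V, h z ≠ 0) → ∃ b < (r + (m + 1)), h (s.getVec (r + (m + 1)) 8 b) ≠ 0 := by
    rintro ⟨z, hz, hhz⟩
    by_contra! hcon
    obtain ⟨c, rfl⟩ := hV.2 z hz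
    refine hhz ?_
    rw [map_sum]
    refine Finset.sum_eq_zero fun b hb => ?_
    rw [map_smul, hcon b (Finset.mem_range.1 hb), smul_zero]
  have hD1 : (∃ z ∈ V, h z ≠ 0) → h D = 1 := by
    intro hz
    have := hpv (hex hz)
    rw [hDp, map_smul, smul_eq_mul]
    exact inv_mul_cancel₀ this
  refine ⟨?_, ⟨?_, ?_⟩, ⟨hDV, hD1⟩, ?_⟩
  · have e1 : Same [9, 10, 21, 22, 28] [8, 9, 11, 14] s s₂ :=
      hs₁.trans hs₂ (by simp) (by simp) (by simp) (by simp)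
    have e2 : Same [9, 10, 21, 22, 28] [8, 9, 11, 14] s s₃ :=
      e1.trans hs₃ (by simp) (by simp) (by simp) (by simp)
    exact e2.trans hs₄ (by simp) (by simp) (by simp) (by simp)
  · intro b hb
    rw [hrow b hb]
    refine ⟨V.sub_mem (hV.1 b hb) (V.smul_mem _ hDV), ?_⟩
    change h _ = 0
    rw [map_sub, map_smul, smul_eq_mul]
    by_cases hz : ∃ z ∈ V, h z ≠ 0
    · rw [hD1 hz, mul_one, sub_self]
    · push Not at hz
      rw [hz _ (hV.1 b hb), zero_mul, sub_zero]
  · rintro z ⟨hzV, hz0⟩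
    obtain ⟨c, hc⟩ := hV.2 z hzV
    refine ⟨c, ?_⟩
    have e1 : ∑ b ∈ Finset.range (r + (m + 1)), c b •
        (s₄.getVec (r + (m + 1)) 8 b : Fin (r + (m + 1)) → ℝ) = z - h z • D := by
      have e2 : h z = ∑ b ∈ Finset.range (r + (m + 1)), c b * h (s.getVec (r + (m + 1)) 8 b) := by
        rw [hc, map_sum]
        exact Finset.sum_congr rfl fun b _ => by rw [map_smul, smul_eq_mul]
      rw [e2, Finset.sum_smul]
      conv_rhs => rw [hc]
      rw [← Finset.sum_sub_distrib]
      refine Finset.sum_congr rfl fun b hb => ?_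
      rw [hrow b (Finset.mem_range.1 hb), smul_sub, mul_smul]
    rw [e1, show h z = 0 from hz0, zero_smul, sub_zero]
  · intro i hi
    funext a
    rw [hs₄.real 9 (by decide), hdir, if_neg (by rw [h20₂]; tauto), hs₂.real 9 (by decide),
      hs₁.real 9 (by decide)]

end Machine

section Machine

variable {r n m : ℕ} {O : Oracles r n m}
variable {A : Matrix (Fin r) (Fin n) ℝ} {M : Matrix (Fin m) (Fin n) ℝ}

/-- All elimination steps; row `k` of real array `9` receives the direction of step `k`. -/
def directionsProg : Prog := .seq identityProg (forLoop 20 (nv 3) stepProg)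

theorem runs_directions {s : State} (hs : Env A M s)
    (hQ : ∀ k < r + (m + 1),
      selection (m + 1) (s.nat 6) (s.nat 7) k < 2 * (r + (m + 1) + n)) :
    Runs O directionsProg s ((r + (m + 1)) * ((r + (m + 1)) * ((r + (m + 1)) * 600))) (fun s' =>
      Same [9, 10, 20, 21, 22, 28] [8, 9, 11, 14] s s' ∧ ∀ k < r + (m + 1),
        IsDirection (selSpace (rowFun A M) (selection (m + 1) (s.nat 6) (s.nat 7)) k)
          (rowFun A M (selection (m + 1) (s.nat 6) (s.nat 7) k))
          (s'.getVec (r + (m + 1)) 9 k)) := by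
  have hd1 : 1 ≤ r + (m + 1) := by omega
  refine Runs.seq (T := (r + (m + 1)) * ((r + (m + 1)) * 110))
    (T' := (r + (m + 1)) * ((r + (m + 1)) * ((r + (m + 1)) * 400) + 40)) ?_
    (runs_identity hs.hd hd1) ?_
  · rw [← mul_add]
    refine Nat.mul_le_mul_left _ ?_
    have h1 : (r + (m + 1)) * 1 ≤ (r + (m + 1)) * (r + (m + 1)) := Nat.mul_le_mul_left _ hd1
    have h2 : ∀ c, (r + (m + 1)) * ((r + (m + 1)) * c) = (r + (m + 1)) * (r + (m + 1)) * c :=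
      fun c => by ring
    rw [h2, h2]
    omega
  rintro s₁ ⟨hs₁, hid⟩
  set σ := selection (m + 1) (s.nat 6) (s.nat 7) with hσ
  have hE₁ : Env A M s₁ := hs.same hs₁ (by decide) (by decide) (by decide) (by decide) (by decide)
  refine Runs.mono (Runs.forLoop (r + (m + 1)) [9, 10, 21, 22, 28] [8, 9, 11, 14] (N := r + (m + 1))
    (fun k s' => Spans (r + (m + 1)) (selSpace (rowFun A M) σ k) s' ∧ ∀ i < k,
      IsDirection (selSpace (rowFun A M) σ i) (rowFun A M (σ i)) (s'.getVec (r + (m + 1)) 9 i))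
    le_rfl hd1 (by decide) (by decide) ?_ (fun _ _ _ h => h) ⟨⟨?_, ?_⟩, by simp⟩ ?_) le_rfl ?_
  · intro s' hs'
    simp only [NExp.eval]
    rw [hs'.nat 3 (by decide), hE₁.hd]
  · simp [selSpace]
  · intro z _
    refine ⟨fun b => if hb : b < r + (m + 1) then z ⟨b, hb⟩ else 0, ?_⟩
    funext a
    rw [Finset.sum_apply, Finset.sum_eq_single (a : ℕ)]
    · simp [State.getVec, hid a a.2 a a.2]
    · intro b hb hba
      have : (a : ℕ) ≠ b := fun h => hba h.symm
      simp [State.getVec, hid b (Finset.mem_range.1 hb) a a.2, this]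
    · simp
  · intro k hk s' hs' hk20 hφ
    have hE' : Env A M s' :=
      hE₁.same hs' (by decide) (by decide) (by decide) (by decide) (by decide)
    have hk' : σ k = selection (m + 1) (s'.nat 6) (s'.nat 7) (s'.nat 20 0) := by
      rw [hs'.nat 6 (by decide), hs'.nat 7 (by decide), hk20, hs₁.nat 6 (by decide),
        hs₁.nat 7 (by decide)]
    refine Runs.mono (runs_step hE' hφ.1 hk' (hQ k hk)) le_rfl ?_
    rintro s'' ⟨h1, h2, h3, h4⟩
    rw [hk20] at h3 h4
    refine ⟨h1, h2, fun i hi => ?_⟩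
    rcases Nat.lt_succ_iff_lt_or_eq.1 hi with hik | rfl
    · have : s''.getVec (r + (m + 1)) 9 i = s'.getVec (r + (m + 1)) 9 i :=
        funext fun a => congrFun (h4 i hik.ne) a
      rw [this]
      exact hφ.2 i hik
    · exact h3
  · rintro s' ⟨h1, -, h2⟩
    exact ⟨hs₁.trans h1 (by simp) (by simp) (by simp) (by simp), h2⟩

/-! ### The candidate vectors -/

/-- Real scalar `13` receives a factor by which the direction with index `26` can be scaled without
changing the sign of any row at the vector in real array `10`, unless it vanishes there. With the
values `x` and `y` of a row at the vector and the direction, `x ^ 2 / (x ^ 2 + y ^ 2)` is such a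
factor for the row, and it is at most `1`, so that the product over the rows is a common one. -/
def scaleProg : Prog :=
  .seq (.setReal 13 (.const 0) (.const 0) (.const 1)) <| forLoop 23 (nv 5) <|
    .seq (sumProg 11 (.mul (.get 7 (nv 23) (nv 22)) (.get 10 (.const 0) (nv 22)))) <|
    .seq (sumProg 12 (.mul (.get 7 (nv 23) (nv 22)) (.get 9 (nv 26) (nv 22)))) <|
    .branch (.realLt (.const 0) (.mul (rv 11) (rv 11)))
      (.setReal 13 (.const 0) (.const 0) (.mul (rv 13) (.div (.mul (rv 11) (rv 11))
        (.add (.mul (rv 11) (rv 11)) (.mul (rv 12) (rv 12)))))) skip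

theorem scale_mul_abs_lt {x y : ℝ} (hx : x ≠ 0) :
    0 < x * x / (x * x + y * y) ∧ x * x / (x * x + y * y) ≤ 1 ∧
      x * x / (x * x + y * y) * |y| < |x| := by
  have hx2 : 0 < x * x := mul_self_pos.2 hx
  have hy2 : 0 ≤ y * y := mul_self_nonneg y
  have hpos : 0 < x * x + y * y := by linarith
  refine ⟨by positivity, (div_le_one hpos).2 (by linarith), ?_⟩
  rw [div_mul_eq_mul_div, div_lt_iff₀ hpos]
  have h1 : 0 < |x| := abs_pos.2 hx
  rw [← abs_mul_abs_self x, ← abs_mul_abs_self y]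
  have h3 : |x| * |y| < |x| * |x| + |y| * |y| := by
    nlinarith [sq_nonneg (|x| - |y|), abs_nonneg y, mul_pos h1 h1]
  nlinarith

theorem runs_scale {s : State} (hs : Env A M s) :
    Runs O scaleProg s (2 * (r + (m + 1) + n) * ((r + (m + 1)) * 300)) (fun s' =>
      Same [22, 23, 28] [11, 12, 13] s s' ∧ 0 < s'.real 13 0 0 ∧
      ∀ j < 2 * (r + (m + 1) + n), rowFun A M j (s.getVec (r + (m + 1)) 10 0) ≠ 0 →
        s'.real 13 0 0 * |rowFun A M j (s.getVec (r + (m + 1)) 9 (s.nat 26 0))| <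
          |rowFun A M j (s.getVec (r + (m + 1)) 10 0)|) := by
  have hd1 : 1 ≤ r + (m + 1) := by omega
  refine Runs.seq (T := 4)
    (T' := 2 * (r + (m + 1) + n) * ((r + (m + 1)) * 140 + 60 + 40)) ?_
    (P := fun s' => Same [] [13] s s' ∧ s'.real 13 0 0 = 1)
    (Runs.setReal (by decide) ⟨Same.setReal _ _ _ _ (by simp), by simp [NExp.eval, RExp.eval]⟩) ?_
  · have hQ1 : 1 ≤ 2 * (r + (m + 1) + n) := by omega
    generalize 2 * (r + (m + 1) + n) = Q at hQ1 ⊢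
    generalize r + (m + 1) = d at hd1 ⊢
    nlinarith [Nat.mul_le_mul_left Q hd1]
  rintro s₁ ⟨hs₁, hδ₁⟩
  have hE₁ : Env A M s₁ := hs.same hs₁ (by decide) (by decide) (by decide) (by decide) (by decide)
  refine Runs.mono (Runs.forLoop (2 * (r + (m + 1) + n)) [22, 28] [11, 12, 13]
    (N := 2 * (r + (m + 1) + n))
    (fun i s' => (0 < s'.real 13 0 0 ∧ s'.real 13 0 0 ≤ 1) ∧
      ∀ j < i, rowFun A M j (s.getVec (r + (m + 1)) 10 0) ≠ 0 →
        s'.real 13 0 0 * |rowFun A M j (s.getVec (r + (m + 1)) 9 (s.nat 26 0))| <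
          |rowFun A M j (s.getVec (r + (m + 1)) 10 0)|) le_rfl (by omega) (by decide) (by decide)
    ?_ (fun _ _ _ h => h) (by simp [hδ₁]) ?_) le_rfl ?_
  · intro s' hs'
    simp only [NExp.eval]
    rw [hs'.nat 5 (by decide), hE₁.hQ]
  · intro i hi s' hs' hi23 hφ
    have hs1' : Same [22, 23, 28] [11, 12, 13] s s' :=
      hs₁.trans hs' (by simp) (by simp) (by simp) (by simp)
    refine Runs.seq (T := (r + (m + 1)) * 70) (T' := (r + (m + 1)) * 70 + 60) (by omega)
      (runs_sum (d := r + (m + 1)) (by rw [hs1'.nat 3 (by decide), hs.hd]) hd1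
      (fun a => s.real 7 i a * s.real 10 0 a) (by decide) ?_) ?_
    · intro a ha s'' hs'' ha22
      simp only [NExp.eval, RExp.eval]
      rw [ha22, hs''.nat 23 (by decide), hi23, hs''.real 7 (by decide), hs''.real 10 (by decide),
        hs1'.real 7 (by decide), hs1'.real 10 (by decide)]
    rintro s₂ ⟨hs₂, hx⟩
    rw [← hs.rowFun_getVec hi] at hx
    refine Runs.seq (T := (r + (m + 1)) * 70) (T' := 60) (by omega)
      (runs_sum (d := r + (m + 1))
      (by rw [hs₂.nat 3 (by decide), hs1'.nat 3 (by decide), hs.hd]) hd1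
      (fun a => s.real 7 i a * s.real 9 (s.nat 26 0) a) (by decide) ?_) ?_
    · intro a ha s'' hs'' ha22
      simp only [NExp.eval, RExp.eval]
      rw [ha22, hs''.nat 23 (by decide), hs''.nat 26 (by decide), hs''.real 7 (by decide),
        hs''.real 9 (by decide), hs₂.nat 23 (by decide), hi23, hs₂.nat 26 (by decide),
        hs₂.real 7 (by decide), hs₂.real 9 (by decide), hs1'.real 7 (by decide),
        hs1'.real 9 (by decide), hs1'.nat 26 (by decide)]
    rintro s₃ ⟨hs₃, hy⟩
    rw [← hs.rowFun_getVec hi] at hy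
    have hx₃ : s₃.real 11 0 0 = rowFun A M i (s.getVec (r + (m + 1)) 10 0) := by
      rw [hs₃.real 11 (by decide), hx]
    have h13 : s₃.real 13 0 0 = s'.real 13 0 0 := by
      rw [hs₃.real 13 (by decide), hs₂.real 13 (by decide)]
    have hss : Same [22, 28] [11, 12, 13] s' s₃ :=
      hs₂.trans hs₃ (by simp) (by simp) (by simp) (by simp)
    set x := rowFun A M i (s.getVec (r + (m + 1)) 10 0) with hxd
    set y := rowFun A M i (s.getVec (r + (m + 1)) 9 (s.nat 26 0)) with hyd
    refine Runs.branch 50 (by decide) (fun hc => ?_) (fun hc => ?_)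
    · simp only [Test.holds, RExp.eval, NExp.eval, hx₃, Nat.cast_zero] at hc
      have hx0 : x ≠ 0 := fun h0 => by simp [h0] at hc
      obtain ⟨e1, e2, e3⟩ := scale_mul_abs_lt (y := y) hx0
      refine Runs.setReal (by decide) ⟨hss.trans (Same.setReal (ns := []) (rs := [13]) _ _ _ _
        (by simp)) (by simp) (by simp) (by simp) (by simp), ?_⟩
      simp only [NExp.eval, RExp.eval, setReal_real_self, hx₃, hy, h13]
      refine ⟨⟨mul_pos hφ.1.1 e1, mul_le_one₀ hφ.1.2 e1.le e2⟩, fun j hj hjw => ?_⟩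
      rcases Nat.lt_succ_iff_lt_or_eq.1 hj with hji | rfl
      · refine lt_of_le_of_lt (mul_le_mul_of_nonneg_right ?_ (abs_nonneg _)) (hφ.2 j hji hjw)
        exact mul_le_of_le_one_right hφ.1.1.le e2
      · refine lt_of_le_of_lt (mul_le_mul_of_nonneg_right ?_ (abs_nonneg _)) e3
        exact mul_le_of_le_one_left e1.le hφ.1.2
    · simp only [Test.holds, RExp.eval, NExp.eval, hx₃, Nat.cast_zero] at hc
      have h0 : x = 0 := by
        by_contra h0
        exact hc (mul_self_pos.2 h0)
      refine Runs.mono Runs.skip (by norm_num) fun s₄ hs₄ => ⟨hss.trans hs₄ (by simp) (by simp)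
        (by simp) (by simp), ?_⟩
      rw [hs₄.real 13 (by decide), h13]
      refine ⟨hφ.1, fun j hj hjw => ?_⟩
      rcases Nat.lt_succ_iff_lt_or_eq.1 hj with hji | rfl
      · exact hφ.2 j hji hjw
      · exact absurd h0 hjw
  · rintro s' ⟨hs', h⟩
    exact ⟨hs₁.trans hs' (by simp) (by simp) (by simp) (by simp), h.1.1, h.2⟩

/-- Real array `10` receives the sum of the last `r` directions, scaled from the last one on. -/
def perturbProg : Prog :=
  .seq (forLoop 22 (nv 3) (.setReal 10 (.const 0) (nv 22) (.const 0))) <|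
  forLoop 24 (.get 0 (.const 0)) <|
    .seq (.setNat 26 (.const 0) (.sub (.sub (nv 3) (.const 1)) (nv 24))) <|
    .seq scaleProg <|
    forLoop 22 (nv 3) (.setReal 10 (.const 0) (nv 22)
      (.add (.get 10 (.const 0) (nv 22)) (.mul (rv 13) (.get 9 (nv 26) (nv 22)))))

/-- The loop runs through the list of functionals backwards, as the recursion of `FlagRel`
does. -/
theorem runs_perturb {s : State} (hs : Env A M s) (W : ℕ) (hW : 1 ≤ W) (hnW : n ≤ W) (σ : ℕ → ℕ)
    (hdir : ∀ k < r + (m + 1), IsDirection (selSpace (rowFun A M) σ k) (rowFun A M (σ k))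
      (s.getVec (r + (m + 1)) 9 k)) :
    Runs O perturbProg s ((r + (m + 1)) * ((r + (m + 1)) * ((r + (m + 1)) * (W * 1500))))
      (fun s' => Same [22, 23, 24, 26, 28] [10, 11, 12, 13] s s' ∧
        FlagRel (rowFun A M) (2 * (r + (m + 1) + n)) (selSpace (rowFun A M) σ (m + 1))
          ((List.range r).map fun i => σ (m + 1 + i)) (s'.getVec (r + (m + 1)) 10 0)) := by
  have hd1 : 1 ≤ r + (m + 1) := by omega
  refine Runs.seq (T := (r + (m + 1)) * (20 + 40)) (T' := (r + (m + 1)) *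
    (2 * (r + (m + 1) + n) * ((r + (m + 1)) * 300) + (r + (m + 1)) * 80 + 20 + 40)) ?_
    (Runs.fillRow (r + (m + 1)) (N := r + (m + 1)) (ρ := 0) (fun _ => 0) le_rfl hd1 (by decide)
      (by decide) ?_ (fun _ _ => rfl) (fun _ _ _ _ _ _ => by simp [RExp.eval])) ?_
  · generalize r + (m + 1) = d at hd1 ⊢
    rw [← mul_add]
    refine Nat.mul_le_mul_left d ?_
    have h1 : d * 1 ≤ d * W := Nat.mul_le_mul_left d hW
    have h2 : 1 * W ≤ d * W := Nat.mul_le_mul_right W hd1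
    have h3 : 2 * (d + n) * (d * 300) ≤ 2 * (d * W + d * W) * (d * 300) :=
      Nat.mul_le_mul_right _ (by omega)
    have h4 : 2 * (d * W + d * W) * (d * 300) = d * (d * (W * 1200)) := by ring
    have h5 : d * (d * W) * 1 = d * (d * W) := by ring
    have h6 : d * 1 ≤ d * (d * W) := Nat.mul_le_mul_left d (by omega)
    have h7 : d * (d * (W * 1500)) = d * (d * (W * 1200)) + d * (d * W) * 300 := by ring
    omega
  · intro s' hs'
    simp only [NExp.eval]
    rw [hs'.nat 3 (by decide), hs.hd]
  rintro s₁ ⟨hs₁, h10⟩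
  have hE₁ : Env A M s₁ := hs.same hs₁ (by decide) (by decide) (by decide) (by decide) (by decide)
  refine Runs.mono (Runs.forLoop (r + (m + 1)) [22, 23, 26, 28] [10, 11, 12, 13] (N := r)
    (fun i s' => FlagRel (rowFun A M) (2 * (r + (m + 1) + n))
      (selSpace (rowFun A M) σ (r + (m + 1) - i)) ((List.range' (r + (m + 1) - i) i).map σ)
      (s'.getVec (r + (m + 1)) 10 0)) (by omega) hd1 (by decide) (by decide) ?_ (fun _ _ _ h => h)
      ?_ ?_) le_rfl ?_
  · intro s' hs'
    simp only [NExp.eval]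
    rw [hs'.nat 0 (by decide), hE₁.hr]
  · simp only [List.range'_zero, List.map_nil, FlagRel]
    funext a
    simp [State.getVec, h10]
  · intro i hi s' hs' hi24 hφ
    have hE' : Env A M s' :=
      hE₁.same hs' (by decide) (by decide) (by decide) (by decide) (by decide)
    obtain ⟨k, hk⟩ : ∃ k, k = r + (m + 1) - (i + 1) := ⟨_, rfl⟩
    have hk1 : r + (m + 1) - i = k + 1 := by omega
    refine Runs.seq (T := 20)
      (T' := 2 * (r + (m + 1) + n) * ((r + (m + 1)) * 300) + (r + (m + 1)) * 80) (by omega)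
      (P := fun s'' => Same [26] [] s' s'' ∧ s''.nat 26 0 = k)
      (Runs.setNat (by decide) ⟨Same.setNat _ _ _ (by simp), ?_⟩) ?_
    · simp only [NExp.eval, setNat_nat_self, hE'.hd, hi24]
      omega
    rintro s₂ ⟨hs₂, h26⟩
    have hE₂ : Env A M s₂ :=
      hE'.same hs₂ (by decide) (by decide) (by decide) (by decide) (by decide)
    refine Runs.seq le_rfl (runs_scale hE₂) ?_
    rintro s₃ ⟨hs₃, hδ, hsmall⟩
    rw [h26] at hsmall
    refine Runs.mono (Runs.fillRow (r + (m + 1)) (N := r + (m + 1)) (ρ := 0) (T := 40)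
      (fun a => s'.real 10 0 a + s₃.real 13 0 0 * s.real 9 k a) le_rfl hd1 (by decide)
      (by decide) ?_ (fun _ _ => rfl) ?_) le_rfl ?_
    · intro s'' hs''
      simp only [NExp.eval]
      rw [hs''.nat 3 (by decide), hs₃.nat 3 (by decide), hE₂.hd]
    · intro a ha s'' hs'' ha22 hun
      simp only [NExp.eval, RExp.eval]
      rw [ha22, hun 0 a (Or.inr le_rfl), hs''.real 13 (by decide), hs''.real 9 (by decide),
        hs''.nat 26 (by decide), hs₃.nat 26 (by decide), h26, hs₃.real 9 (by decide),
        hs₃.real 10 (by decide), hs₂.real 9 (by decide), hs₂.real 10 (by decide),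
        hs'.real 9 (by decide), hs₁.real 9 (by decide)]
    · rintro s₄ ⟨hs₄, hw⟩
      refine ⟨?_, ?_⟩
      · have e1 : Same [22, 23, 26, 28] [10, 11, 12, 13] s' s₃ :=
          hs₂.trans hs₃ (by simp) (by simp) (by simp) (by simp)
        exact e1.trans hs₄ (by simp) (by simp) (by simp) (by simp)
      · have e1 : s₂.getVec (r + (m + 1)) 10 0 = s'.getVec (r + (m + 1)) 10 0 :=
          funext fun a => by rw [State.getVec, State.getVec, hs₂.real 10 (by decide)]
        have e2 : s₂.getVec (r + (m + 1)) 9 k = s.getVec (r + (m + 1)) 9 k :=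
          funext fun a => by
            rw [State.getVec, State.getVec, hs₂.real 9 (by decide), hs'.real 9 (by decide),
              hs₁.real 9 (by decide)]
        rw [e1, e2] at hsmall
        rw [hk1] at hφ
        rw [← hk, List.range'_succ, List.map_cons]
        obtain ⟨hD, hD1⟩ := hdir k (by omega)
        refine ⟨_, hD, hD1, _, _, hφ, hδ, hsmall, ?_⟩
        funext a
        simp [State.getVec, hw]
  · rintro s' ⟨hs', h⟩
    refine ⟨hs₁.trans hs' (by simp) (by simp) (by simp) (by simp), ?_⟩
    rw [show r + (m + 1) - r = m + 1 by omega, List.range'_eq_map_range, List.map_map] at h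
    exact h

/-! ### The two subproblems -/

/-- The second subroutine is called with the vector `(c, lam, γ)` in real array `10`. -/
def callProg : Prog :=
  .seq (forLoop 22 (.get 0 (.const 0))
    (.setReal 3 (.const 0) (nv 22) (.get 10 (.const 0) (nv 22)))) <|
  .seq (.setReal 3 (.const 1) (.const 0) (.get 10 (.const 0) (.get 0 (.const 0)))) <|
  .seq (forLoop 22 (.get 0 (.const 2)) (.setReal 3 (.const 2) (nv 22)
    (.get 10 (.const 0) (.add (.add (.get 0 (.const 0)) (.const 1)) (nv 22))))) .callLP

theorem runs_call {s : State} (hs : Env A M s) {w : Fin (r + (m + 1)) → ℝ}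
    (hw : w = s.getVec (r + (m + 1)) 10 0) :
    Runs O callProg s ((r + (m + 1)) * 150 + O.LP) (fun s' => Same [2, 22] [3, 5] s s' ∧
      ((O.lp (cPart r m w) (lamPart w) (gamPart w) = none ∧ s'.nat 2 1 = 0) ∨
        ∃ x y, O.lp (cPart r m w) (lamPart w) (gamPart w) = some (x, y) ∧ s'.nat 2 1 = 1 ∧
          s'.getVec n 5 0 = x ∧ s'.getVec n 5 1 = y)) := by
  have hd1 : 1 ≤ r + (m + 1) := by omega
  refine Runs.seq (T := (r + (m + 1)) * (20 + 40)) (T' := (r + (m + 1)) * 90 + O.LP) (by omega)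
    (Runs.fillRow (r + (m + 1)) (N := r) (ρ := 0) (fun a => s.real 10 0 a) (by omega) hd1
      (by decide) (by decide) ?_ (fun _ _ => rfl) ?_) ?_
  · intro s' hs'
    simp only [NExp.eval]
    rw [hs'.nat 0 (by decide), hs.hr]
  · intro a ha s' hs' ha22 _
    simp only [NExp.eval, RExp.eval]
    rw [ha22, hs'.real 10 (by decide)]
  rintro s₁ ⟨hs₁, hc⟩
  refine Runs.seq (T := 15) (T' := (r + (m + 1)) * (30 + 40) + O.LP + 1) (by omega)
    (P := fun s' => Same [] [3] s₁ s' ∧ s'.real 3 1 0 = s.real 10 0 r ∧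
      ∀ a, s'.real 3 0 a = s₁.real 3 0 a)
    (Runs.setReal (by decide) ⟨Same.setReal _ _ _ _ (by simp), ?_, ?_⟩) ?_
  · simp only [NExp.eval, RExp.eval, setReal_real_self]
    rw [hs₁.nat 0 (by decide), hs.hr, hs₁.real 10 (by decide)]
  · intro a
    simp [NExp.eval, RExp.eval, setReal_real]
  rintro s₂ ⟨hs₂, hlam, hc₂⟩
  refine Runs.seq (T := (r + (m + 1)) * (30 + 40)) (T' := O.LP + 1) (by omega)
    (Runs.fillRow (r + (m + 1)) (N := m) (ρ := 2) (fun a => s.real 10 0 (r + 1 + a)) (by omega) hd1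
      (by decide) (by decide) ?_ (fun _ _ => rfl) ?_) ?_
  · intro s' hs'
    simp only [NExp.eval]
    rw [hs'.nat 0 (by decide), hs₂.nat 0 (by decide), hs₁.nat 0 (by decide), hs.hm]
  · intro a ha s' hs' ha22 _
    simp only [NExp.eval, RExp.eval]
    rw [ha22, hs'.real 10 (by decide), hs'.nat 0 (by decide), hs₂.real 10 (by decide),
      hs₂.nat 0 (by decide), hs₁.real 10 (by decide), hs₁.nat 0 (by decide), hs.hr]
  rintro s₃ ⟨hs₃, hg⟩
  refine ⟨_, _, .callLP s₃, le_rfl, ?_⟩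
  have e1 : s₃.getVec r 3 0 = cPart r m w := by
    funext a
    simp [State.getVec, hg, hc₂, hc, hw, cPart]
  have e2 : s₃.real 3 1 0 = lamPart w := by
    simp [State.getVec, hg, hlam, hw, lamPart]
  have e3 : s₃.getVec m 3 2 = gamPart w := by
    funext a
    simp [State.getVec, hg, hw, gamPart, add_comm, add_left_comm]
  have hss : Same [2, 22] [3, 5] s s₃ :=
    (hs₁.trans hs₂ (by simp) (by simp) (by simp) (by simp) (ns'' := [2, 22]) (rs'' := [3, 5])).trans
      hs₃ (by simp) (by simp) (by simp) (by simp)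
  rw [State.afterLP, e1, e2, e3]
  rcases h : O.lp (cPart r m w) (lamPart w) (gamPart w) with _ | ⟨x, y⟩
  · exact ⟨hss.trans (Same.setNat (ns := [2]) (rs := []) _ _ _ (by simp)) (by simp) (by simp)
      (by simp) (by simp), Or.inl ⟨rfl, by simp⟩⟩
  · refine ⟨⟨fun k hk => ?_, fun k hk => ?_⟩, Or.inr ⟨x, y, rfl, ?_, ?_, ?_⟩⟩
    · have h2 : k ≠ 2 := fun h => hk (by simp [h])
      funext i
      simp [State.setVec, setNat_nat, h2, hss.nat k hk]
    · have h5 : k ≠ 5 := fun h => hk (by simp [h])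
      funext i j
      simp [State.setVec, h5, hss.real k hk]
    · simp [State.setVec]
    · funext i
      simp [State.getVec, State.setVec]
    · funext i
      simp [State.getVec, State.setVec]

end Machine

/-! ### Processing a candidate vector -/

section Machine

variable {r n m : ℕ} {O : Oracles r n m}
variable {A : Matrix (Fin r) (Fin n) ℝ} {M : Matrix (Fin m) (Fin n) ℝ}

/-- The answer of the first subroutine is copied to the output. Integer scalar `8` records that
there is an output. -/
def updateProg : Prog :=
  .seq (.setReal 6 (.const 1) (.const 0) (.get 4 (.const 1) (.const 0))) <|
  .seq (forLoop 23 (.get 0 (.const 1))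
    (.setReal 6 (.const 0) (nv 23) (.get 4 (.const 0) (nv 23))))
    (.setNat 8 (.const 0) (.const 1))

theorem runs_update {s : State} (hs : Env A M s) {W : ℕ} (hW : 1 ≤ W) (hnW : n ≤ W) :
    Runs O updateProg s (W * 100) (fun s' => Same [8, 23] [6] s s' ∧ s'.nat 8 0 = 1 ∧
      outputPoint n s' = s.getVec n 4 0 ∧ outputValue s' = s.real 4 1 0) := by
  refine Runs.seq (T := 10) (T' := W * 60 + 10) (by omega)
    (P := fun s' => Same [] [6] s s' ∧ s'.real 6 1 0 = s.real 4 1 0)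
    (Runs.setReal (by decide) ⟨Same.setReal _ _ _ _ (by simp),
      by simp [NExp.eval, RExp.eval]⟩) ?_
  rintro s₁ ⟨hs₁, hv⟩
  refine Runs.seq (T := W * (20 + 40)) (T' := 10) le_rfl
    (Runs.fillRow W (N := n) (ρ := 0) (fun a => s.real 4 0 a) hnW hW (by decide) (by decide) ?_
      (fun _ _ => rfl) ?_) ?_
  · intro s' hs'
    simp only [NExp.eval]
    rw [hs'.nat 0 (by decide), hs₁.nat 0 (by decide), hs.hn]
  · intro a ha s' hs' ha23 _
    simp only [NExp.eval, RExp.eval]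
    rw [ha23, hs'.real 4 (by decide), hs₁.real 4 (by decide)]
  rintro s₂ ⟨hs₂, hp⟩
  refine Runs.setNat (by decide) ⟨(hs₁.trans hs₂ (by simp) (by simp) (by simp) (by simp)
    (ns'' := [23]) (rs'' := [6])).trans (Same.setNat (ns := [8]) (rs := []) _ _ _ (by simp))
    (by simp) (by simp) (by simp) (by simp), by simp [NExp.eval], ?_, ?_⟩
  · funext i
    simp [outputPoint, State.getVec, hp]
  · simp [outputValue, hp, hv]

/-- If there is an output, then it is a feasible point with its objective value. -/
def Valid (A : Matrix (Fin r) (Fin n) ℝ) (f : (Fin r → ℝ) → ℝ) (X : Set (Fin n → ℝ))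
    (s : State) : Prop :=
  s.nat 8 0 ≠ 0 → outputPoint n s ∈ X ∧ outputValue s = f (A *ᵥ outputPoint n s)

/-- There is an output of value at least `t`. -/
def Beats (t : ℝ) (s : State) : Prop := s.nat 8 0 ≠ 0 ∧ t ≤ outputValue s

theorem valid_congr {f : (Fin r → ℝ) → ℝ} {X : Set (Fin n → ℝ)} {s s' : State}
    (h8 : s'.nat 8 0 = s.nat 8 0) (h6 : s'.real 6 = s.real 6) :
    Valid A f X s' ↔ Valid A f X s := by
  have h : outputPoint n s' = outputPoint n s := funext fun i => congrFun (congrFun h6 0) i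
  rw [Valid, Valid, h, outputValue, outputValue, h6, h8]

theorem beats_congr {s s' : State} (h8 : s'.nat 8 0 = s.nat 8 0) (h6 : s'.real 6 = s.real 6)
    {t : ℝ} : Beats t s' ↔ Beats t s := by
  rw [Beats, Beats, outputValue, outputValue, h6, h8]

/-- The first subroutine is called with the support of the row of real array `5` with index `25`,
and the output is updated if the answer improves it. -/
def answerProg : Prog :=
  .seq (forLoop 23 (.get 0 (.const 1))
    (.branch (.realLt (.const 0) (.mul (.get 5 (nv 25) (nv 23)) (.get 5 (nv 25) (nv 23))))
      (.setNat 1 (nv 23) (.const 1)) (.setNat 1 (nv 23) (.const 0)))) <|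
  .seq .callSupport <|
  .branch (.natLt (.const 0) (.get 2 (.const 0)))
    (.branch (.natLt (.const 0) (nv 8))
      (.branch (.realLt (.get 6 (.const 1) (.const 0)) (.get 4 (.const 1) (.const 0)))
        updateProg skip)
      updateProg)
    skip

/-- A binary point is determined by its support, so that the first subroutine, called with the
support of a feasible point, returns this point. -/
theorem IsBinary.eq_of_supp_eq {X : Set (Fin n → ℝ)} (hX : IsBinary X) {x y : Fin n → ℝ}
    (hx : x ∈ X) (hy : y ∈ X) (h : supp x = supp y) : x = y := by
  funext i
  have h1 : x i ≠ 0 ↔ y i ≠ 0 := by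
    have := Finset.ext_iff.1 h i
    simpa [supp] using this
  rcases hX x hx i with h2 | h2 <;> rcases hX y hy i with h3 | h3 <;> simp_all

theorem runs_answer {f : (Fin r → ℝ) → ℝ} {X : Set (Fin n → ℝ)} (hX : IsBinary X)
    (hO : O.SolvesFixedSupport A f X) {s : State} (hs : Env A M s) {W : ℕ} (hW : 1 ≤ W)
    (hnW : n ≤ W) (hTW : O.T₁ ≤ W) :
    Runs O answerProg s (W * 300) (fun s' => Same [1, 2, 8, 23, 28] [4, 6] s s' ∧
      (Valid A f X s → Valid A f X s') ∧ (∀ t, Beats t s → Beats t s') ∧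
      (s.getVec n 5 (s.nat 25 0) ∈ X →
        Beats (f (A *ᵥ s.getVec n 5 (s.nat 25 0))) s')) := by
  refine Runs.seq (T := W * (30 + 40)) (T' := W * 230) (by omega)
    (Runs.forLoop W [1] [] (N := n) (fun i s' => ∀ j < i, s'.nat 1 j ≠ 0 ↔
      s.real 5 (s.nat 25 0) j ≠ 0) hnW hW (by decide) (by decide) ?_ ?_ (by simp) ?_) ?_
  · intro s' hs'
    simp only [NExp.eval]
    rw [hs'.nat 0 (by decide), hs.hn]
  · intro i s' x h j hj
    simpa [setNat_nat] using h j hj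
  · intro i hi s' hs' hi23 hφ
    have h5 : s'.real 5 = s.real 5 := hs'.real 5 (by decide)
    have h25 : s'.nat 25 = s.nat 25 := hs'.nat 25 (by decide)
    refine Runs.branch 6 (by decide) (fun hc => ?_) (fun hc => ?_)
    · simp only [Test.holds, RExp.eval, NExp.eval, Nat.cast_zero, h5, h25, hi23, mul_self_pos] at hc
      refine Runs.setNat (by decide) ⟨Same.setNat _ _ _ (by simp), fun j hj => ?_⟩
      simp only [NExp.eval, hi23, setNat_nat]
      by_cases hji : j = i
      · simp [hji, hc]
      · simpa [hji] using hφ j (by omega)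
    · simp only [Test.holds, RExp.eval, NExp.eval, Nat.cast_zero, h5, h25, hi23, mul_self_pos] at hc
      refine Runs.setNat (by decide) ⟨Same.setNat _ _ _ (by simp), fun j hj => ?_⟩
      simp only [NExp.eval, hi23, setNat_nat]
      by_cases hji : j = i
      · simp [hji, hc]
      · simpa [hji] using hφ j (by omega)
  rintro s₁ ⟨hs₁, h1⟩
  set x : Fin n → ℝ := s.getVec n 5 (s.nat 25 0) with hx
  have hI : ({i : Fin n | s₁.nat 1 i ≠ 0} : Finset (Fin n)) = supp x := by
    ext i
    simpa [supp, hx, State.getVec] using h1 i i.2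
  have hsupp := hO (supp x)
  have key : ∀ s₂, s₂ = s₁.afterSupport O → Runs O
      (.branch (.natLt (.const 0) (.get 2 (.const 0)))
        (.branch (.natLt (.const 0) (nv 8))
          (.branch (.realLt (.get 6 (.const 1) (.const 0)) (.get 4 (.const 1) (.const 0)))
            updateProg skip)
          updateProg)
        skip) s₂ (W * 200) (fun s' => Same [2, 8, 23, 28] [4, 6] s₁ s' ∧
      (Valid A f X s₁ → Valid A f X s') ∧ (∀ t, Beats t s₁ → Beats t s') ∧
      (x ∈ X → Beats (f (A *ᵥ x)) s')) := by
    intro s₂ hs₂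
    rw [State.afterSupport, hI] at hs₂
    rcases hsup : O.support (supp x) with _ | ⟨y, val⟩
    · rw [hsup] at hs₂
      refine Runs.branch 10 (le_trans (b := 20) (by decide) (by omega)) (fun hc => ?_)
        (fun _ => ?_)
      · simp [hs₂, Test.holds, NExp.eval] at hc
      · refine Runs.mono Runs.skip (by norm_num) fun s' hs' => ?_
        have h8 : s'.nat 8 0 = s₁.nat 8 0 := by
          rw [hs'.nat 8 (by decide), hs₂]
          simp [setNat_nat]
        have h6 : s'.real 6 = s₁.real 6 := by rw [hs'.real 6 (by decide), hs₂]; rfl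
        refine ⟨?_, ?_, ?_, ?_⟩
        · exact (Same.setNat (ns := [2]) (rs := []) s₁ 0 0 (by simp)).trans (hs₂ ▸ hs') (by simp)
            (by simp) (by simp) (by simp)
        · exact (valid_congr h8 h6).2
        · exact fun t => (beats_congr h8 h6).2
        · intro hxX
          refine absurd ⟨x, ⟨hxX, rfl⟩, fun y hy => ?_⟩ (hsupp.2 hsup)
          rw [hX.eq_of_supp_eq hy.1 hxX hy.2]
          exact le_refl (f (A *ᵥ x))
    · obtain ⟨⟨⟨hyX, hysupp⟩, -⟩, hval⟩ := hsupp.1 y val hsup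
      rw [hsup] at hs₂
      have h4 : s₂.getVec n 4 0 = y := by
        funext i
        simp [hs₂, State.getVec, State.setVec, setReal_real]
      have h41 : s₂.real 4 1 0 = val := by simp [hs₂]
      have hss : Same [2] [4] s₁ s₂ := by
        refine ⟨fun k hk => ?_, fun k hk => ?_⟩
        · have h2 : k ≠ 2 := fun h => hk (by simp [h])
          funext i
          simp [hs₂, State.setVec, setNat_nat, h2]
        · have h4 : k ≠ 4 := fun h => hk (by simp [h])
          funext i j
          simp [hs₂, State.setVec, setReal_real, h4]
      have hE₂ : Env A M s₂ := (hs.same hs₁ (by decide) (by decide) (by decide) (by decide)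
        (by decide)).same hss (by decide) (by decide) (by decide) (by decide) (by decide)
      have h8 : s₂.nat 8 = s₁.nat 8 := hss.nat 8 (by decide)
      have h6 : s₂.real 6 = s₁.real 6 := hss.real 6 (by decide)
      have hxy : x ∈ X → f (A *ᵥ x) = val := fun hxX => by
        rw [hval, hX.eq_of_supp_eq hyX hxX hysupp]
      have hupd : (∀ t, Beats t s₁ → t ≤ val) → Runs O updateProg s₂ (W * 100) (fun s' =>
          Same [2, 8, 23, 28] [4, 6] s₁ s' ∧
          (Valid A f X s₁ → Valid A f X s') ∧ (∀ t, Beats t s₁ → Beats t s') ∧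
          (x ∈ X → Beats (f (A *ᵥ x)) s')) := by
        intro hle
        refine Runs.mono (runs_update hE₂ hW hnW) le_rfl ?_
        rintro s' ⟨h1, h2, h3, h4'⟩
        refine ⟨hss.trans h1 (by simp) (by simp) (by simp) (by simp), fun _ _ => ?_,
          fun t ht => ⟨by omega, ?_⟩, fun hxX => ⟨by omega, ?_⟩⟩
        · rw [h3, h4', h4, h41]
          exact ⟨hyX, hval⟩
        · rw [h4', h41]
          exact hle t ht
        · rw [h4', h41, hxy hxX]
      refine Runs.branch (W * 150) ?_ (fun _ => ?_) (fun hc => ?_)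
      · exact le_trans (Nat.add_le_add_right (m := 20) (by decide) _) (by omega)
      · refine Runs.branch (W * 130) ?_ (fun hc => ?_) (fun hc => ?_)
        · exact le_trans (Nat.add_le_add_right (m := 20) (by decide) _) (by omega)
        · simp only [Test.holds, NExp.eval, h8] at hc
          refine Runs.branch (W * 110) ?_ (fun hc' => ?_) (fun hc' => ?_)
          · exact le_trans (Nat.add_le_add_right (m := 20) (by decide) _) (by omega)
          · simp only [Test.holds, RExp.eval, NExp.eval, h41, h6] at hc'
            refine Runs.mono (hupd fun t ht => ?_) (by omega) fun _ h => h
            exact ht.2.trans hc'.le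
          · simp only [Test.holds, RExp.eval, NExp.eval, h41, h6, not_lt] at hc'
            refine Runs.mono Runs.skip (by omega) fun s' hs' => ?_
            have h8' : s'.nat 8 = s₁.nat 8 := by rw [hs'.nat 8 (by decide), h8]
            have h6' : s'.real 6 = s₁.real 6 := by rw [hs'.real 6 (by decide), h6]
            refine ⟨hss.trans hs' (by simp) (by simp) (by simp) (by simp), ?_, ?_, ?_⟩
            · exact (valid_congr (by rw [h8']) h6').2
            · exact fun t => (beats_congr (by rw [h8']) h6').2
            · intro hxX
              refine ⟨by rw [h8']; omega, ?_⟩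
              rw [hxy hxX, outputValue, h6']
              exact hc'
        · simp only [Test.holds, NExp.eval, h8, not_lt, nonpos_iff_eq_zero] at hc
          exact Runs.mono (hupd fun t ht => absurd hc ht.1) (by omega) fun _ h => h
      · simp [hs₂, Test.holds, NExp.eval, State.setVec] at hc
  refine Runs.seq (T := W + 1) (T' := W * 200) (by omega)
    (P := fun s₂ => s₂ = s₁.afterSupport O) ⟨_, _, .callSupport s₁, by omega, rfl⟩ ?_
  intro s₂ hs₂
  refine Runs.mono (key s₂ hs₂) le_rfl ?_
  rintro s' ⟨h1, h2, h3, h4⟩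
  have h8 : s₁.nat 8 = s.nat 8 := hs₁.nat 8 (by decide)
  have h6 : s₁.real 6 = s.real 6 := hs₁.real 6 (by decide)
  exact ⟨hs₁.trans h1 (by simp) (by simp) (by simp) (by simp),
    fun h => h2 ((valid_congr (by rw [h8]) h6).2 h),
    fun t ht => h3 t ((beats_congr (by rw [h8]) h6).2 ht), h4⟩

/-- Both answers of the second subroutine are processed. -/
def answersProg : Prog :=
  .branch (.natLt (.const 0) (.get 2 (.const 1))) (forLoop 25 (.const 2) answerProg) skip

theorem runs_answers {f : (Fin r → ℝ) → ℝ} {X : Set (Fin n → ℝ)} (hX : IsBinary X)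
    (hO : O.SolvesFixedSupport A f X) {s : State} (hs : Env A M s) {W : ℕ} (hW : 1 ≤ W)
    (hnW : n ≤ W) (hTW : O.T₁ ≤ W) :
    Runs O answersProg s (W * 800) (fun s' => Same [1, 2, 8, 23, 25, 28] [4, 6] s s' ∧
      (Valid A f X s → Valid A f X s') ∧ (∀ t, Beats t s → Beats t s') ∧
      (s.nat 2 1 = 1 → ∀ ρ < 2, s.getVec n 5 ρ ∈ X → Beats (f (A *ᵥ s.getVec n 5 ρ)) s')) := by
  refine Runs.branch (2 * (W * 300 + 40)) ?_ (fun hc => ?_) (fun hc => ?_)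
  · exact le_trans (Nat.add_le_add_right (m := 20) (by decide) _) (by omega)
  · refine Runs.mono (Runs.forLoop 2 [1, 2, 8, 23, 28] [4, 6] (N := 2) (fun i s' =>
      (Valid A f X s → Valid A f X s') ∧ (∀ t, Beats t s → Beats t s') ∧
      ∀ ρ < i, s.getVec n 5 ρ ∈ X → Beats (f (A *ᵥ s.getVec n 5 ρ)) s') le_rfl (by norm_num)
      (by decide) (by decide) (fun _ _ => rfl) (fun _ _ _ h =>
        ⟨fun hv => (valid_congr (by simp [setNat_nat]) rfl).2 (h.1 hv),
          fun t ht => (beats_congr (by simp [setNat_nat]) rfl).2 (h.2.1 t ht),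
          fun ρ hρ hρX => (beats_congr (by simp [setNat_nat]) rfl).2 (h.2.2 ρ hρ hρX)⟩)
      ⟨id, fun _ => id, by simp⟩ ?_) le_rfl ?_
    · intro i hi s' hs' hi25 hφ
      refine Runs.mono (runs_answer hX hO (hs.same hs' (by decide) (by decide) (by decide)
        (by decide) (by decide)) hW hnW hTW) le_rfl ?_
      rintro s'' ⟨h1, h2, h3, h4⟩
      have h5 : s'.real 5 = s.real 5 := hs'.real 5 (by decide)
      refine ⟨h1, fun h => h2 (hφ.1 h), fun t ht => h3 t (hφ.2.1 t ht), fun ρ hρ hρX => ?_⟩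
      rcases Nat.lt_succ_iff_lt_or_eq.1 hρ with h | rfl
      · exact h3 _ (hφ.2.2 ρ h hρX)
      · rw [hi25] at h4
        have e : s'.getVec n 5 ρ = s.getVec n 5 ρ := funext fun j => congrFun (congrFun h5 ρ) j
        rw [e] at h4
        exact h4 hρX
    · rintro s' ⟨h1, h2, h3, h4⟩
      exact ⟨h1.mono (by simp) (by simp), h2, h3, fun _ => h4⟩
  · refine Runs.mono Runs.skip (by omega) fun s' hs' => ?_
    have h8 : s'.nat 8 = s.nat 8 := hs'.nat 8 (by decide)
    have h6 : s'.real 6 = s.real 6 := hs'.real 6 (by decide)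
    refine ⟨hs'.mono (by simp) (by simp), ?_, ?_, fun h1 => ?_⟩
    · exact (valid_congr (by rw [h8]) h6).2
    · exact fun t => (beats_congr (by rw [h8]) h6).2
    · simp [Test.holds, NExp.eval, h1] at hc

/-- Every vector computed from the functionals with indices `a` and `g` has an optimal solution
among the two answers to the second subproblem. -/
def Decisive (A : Matrix (Fin r) (Fin n) ℝ) (M : Matrix (Fin m) (Fin n) ℝ) (b : Fin m → ℝ)
    (f : (Fin r → ℝ) → ℝ) (X : Set (Fin n → ℝ)) (a g : ℕ → ℕ) : Prop :=
  ∀ w, FlagRel (rowFun A M) (2 * (r + (m + 1) + n)) (selSpace (rowFun A M) a (m + 1))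
      ((List.range r).map g) w →
    (feasible A M b X w).Nonempty ∧
    ∀ x y, IsMinimizer (fun z => ∑ i, z i) (feasible A M b X w) x →
      IsMaximizer (fun z => ∑ i, z i) (feasible A M b X w) y →
      (∀ z ∈ X, f (A *ᵥ z) ≤ f (A *ᵥ x)) ∨ (∀ z ∈ X, f (A *ᵥ z) ≤ f (A *ᵥ y))

theorem Decisive.congr {b : Fin m → ℝ} {f : (Fin r → ℝ) → ℝ} {X : Set (Fin n → ℝ)}
    {a g a' g' : ℕ → ℕ} (h : Decisive A M b f X a g) (ha : ∀ i < m + 1, a' i = a i)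
    (hg : ∀ i < r, g' i = g i) : Decisive A M b f X a' g' := by
  have h1 : selSpace (rowFun A M) a' (m + 1) = selSpace (rowFun A M) a (m + 1) := by
    ext z
    simp only [mem_selSpace]
    exact forall₂_congr fun j hj => by rw [ha j hj]
  have h2 : (List.range r).map g' = (List.range r).map g :=
    List.map_congr_left fun i hi => hg i (List.mem_range.1 hi)
  unfold Decisive
  rw [h1, h2]
  exact h

/-- The candidate vector for the current selection is computed, and both answers for it are
processed. -/
def candidateProg : Prog :=
  .seq directionsProg <| .seq perturbProg <| .seq callProg answersProg

/-- A candidate never destroys the output found so far; a decisive selection makes it optimal. -/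
theorem runs_candidate {b : Fin m → ℝ} {f : (Fin r → ℝ) → ℝ} {X : Set (Fin n → ℝ)}
    (hX : IsBinary X) (hO : O.SolvesFixedSupport A f X) (hLP : O.SolvesLP A M b X)
    {W : ℕ} (hW : O.T₁ + O.LP = W) (hW1 : 1 ≤ W) (hnW : n ≤ W) {s : State} (hs : Env A M s)
    (h6 : ∀ k < m + 1, s.nat 6 k < 2 * (r + (m + 1) + n))
    (h7 : ∀ k < r, s.nat 7 k < 2 * (r + (m + 1) + n)) :
    Runs O candidateProg s ((r + (m + 1)) * ((r + (m + 1)) * ((r + (m + 1)) * (W * 4000))))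
      (fun s' => Same [1, 2, 8, 9, 10, 20, 21, 22, 23, 24, 25, 26, 28]
          [3, 4, 5, 6, 8, 9, 10, 11, 12, 13, 14] s s' ∧
        (Valid A f X s → Valid A f X s') ∧ (∀ t, Beats t s → Beats t s') ∧
        (Decisive A M b f X (s.nat 6) (s.nat 7) → ∀ z ∈ X, Beats (f (A *ᵥ z)) s')) := by
  have hd1 : 1 ≤ r + (m + 1) := by omega
  have hbound : (r + (m + 1)) * ((r + (m + 1)) * ((r + (m + 1)) * 600)) +
      ((r + (m + 1)) * ((r + (m + 1)) * ((r + (m + 1)) * (W * 1500))) +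
        (((r + (m + 1)) * 150 + W) + W * 800)) ≤
      (r + (m + 1)) * ((r + (m + 1)) * ((r + (m + 1)) * (W * 4000))) := by
    generalize r + (m + 1) = d at hd1 ⊢
    have h1 : d * (d * (d * 1)) ≤ d * (d * (d * W)) := by gcongr
    have h2 : d * (1 * (1 * 1)) ≤ d * (d * (d * W)) := by gcongr
    have h3 : 1 * (1 * (1 * W)) ≤ d * (d * (d * W)) := by gcongr
    have e1 : d * (d * (d * 600)) = d * (d * (d * 1)) * 600 := by ring
    have e2 : d * (d * (d * (W * 1500))) = d * (d * (d * W)) * 1500 := by ring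
    have e3 : d * (d * (d * (W * 4000))) = d * (d * (d * W)) * 4000 := by ring
    omega
  have hsel : ∀ k < r + (m + 1),
      selection (m + 1) (s.nat 6) (s.nat 7) k < 2 * (r + (m + 1) + n) := by
    intro k hk
    unfold selection
    split_ifs with h
    · exact h6 k h
    · exact h7 _ (by omega)
  refine Runs.mono (T := _ + (_ + (_ + _))) ?_ hbound fun _ h => h
  refine Runs.seq le_rfl (runs_directions hs hsel) ?_
  rintro s₁ ⟨hs₁, hdir⟩
  have hE₁ : Env A M s₁ := hs.same hs₁ (by decide) (by decide) (by decide) (by decide) (by decide)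
  refine Runs.seq le_rfl (runs_perturb hE₁ W hW1 hnW _ hdir) ?_
  rintro s₂ ⟨hs₂, hflag⟩
  have hE₂ : Env A M s₂ := hE₁.same hs₂ (by decide) (by decide) (by decide) (by decide) (by decide)
  refine Runs.seq le_rfl (Runs.mono (runs_call hE₂ rfl) (by omega) fun _ h => h) ?_
  rintro s₃ ⟨hs₃, hcall⟩
  have hE₃ : Env A M s₃ := hE₂.same hs₃ (by decide) (by decide) (by decide) (by decide) (by decide)
  refine Runs.mono (runs_answers hX hO hE₃ hW1 hnW (by omega)) le_rfl ?_
  rintro s₄ ⟨hs₄, hval, hbeat, hans⟩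
  have hss : Same [1, 2, 8, 9, 10, 20, 21, 22, 23, 24, 25, 26, 28]
      [3, 4, 5, 6, 8, 9, 10, 11, 12, 13, 14] s s₂ :=
    hs₁.trans hs₂ (by simp) (by simp) (by simp) (by simp)
  have hss' : Same [1, 2, 8, 9, 10, 20, 21, 22, 23, 24, 25, 26, 28]
      [3, 4, 5, 6, 8, 9, 10, 11, 12, 13, 14] s s₃ :=
    hss.trans hs₃ (by simp) (by simp) (by simp) (by simp)
  have e8 : s₃.nat 8 = s.nat 8 := by
    rw [hs₃.nat 8 (by decide), hs₂.nat 8 (by decide), hs₁.nat 8 (by decide)]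
  have e6 : s₃.real 6 = s.real 6 := by
    rw [hs₃.real 6 (by decide), hs₂.real 6 (by decide), hs₁.real 6 (by decide)]
  refine ⟨hss'.trans hs₄ (by simp) (by simp) (by simp) (by simp), ?_, ?_, ?_⟩
  · exact fun h => hval ((valid_congr (by rw [e8]) e6).2 h)
  · exact fun t ht => hbeat t ((beats_congr (by rw [e8]) e6).2 ht)
  · intro hdec z hz
    have hdec' := hdec.congr (a' := selection (m + 1) (s.nat 6) (s.nat 7))
      (g' := fun i => selection (m + 1) (s.nat 6) (s.nat 7) (m + 1 + i))
      (fun i hi => by simp [selection, hi])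
      (fun i hi => by
        rw [selection, if_neg (by omega), Nat.add_sub_cancel_left])
    obtain ⟨hne, hopt⟩ := hdec' _ hflag
    set w := s₂.getVec (r + (m + 1)) 10 0 with hw
    have hsolve := hLP (cPart r m w) (lamPart w) (gamPart w)
    rcases hcall with ⟨hnone, -⟩ | ⟨x, y, hsome, h21, hx, hy⟩
    · exact absurd (hsolve.2 hnone) hne.ne_empty
    · obtain ⟨hmin, hmax⟩ := hsolve.1 x y hsome
      have hxX : x ∈ X := hmin.1.1.2
      have hyX : y ∈ X := hmax.1.1.2
      have hbx := hans h21 0 (by norm_num) (hx ▸ hxX)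
      have hby := hans h21 1 (by norm_num) (hy ▸ hyX)
      rw [hx] at hbx
      rw [hy] at hby
      rcases hopt x y hmin hmax with h | h
      · exact ⟨hbx.1, (h z hz).trans hbx.2⟩
      · exact ⟨hby.1, (h z hz).trans hby.2⟩

end Machine

/-! ### Number systems for the enumeration -/

theorem exists_digits {Q : ℕ} : ∀ (l : ℕ) (g : ℕ → ℕ), (∀ k < l, g k < Q) →
    ∃ t < Q ^ l, ∀ k < l, t / Q ^ k % Q = g k
  | 0, _, _ => ⟨0, by simp, by simp⟩
  | l + 1, g, hg => by
    obtain ⟨t, ht, h⟩ := exists_digits l (fun k => g (k + 1)) fun k hk => hg _ (by omega)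
    have h0 := hg 0 (by omega)
    have hQ : 0 < Q := by omega
    have hdiv : (g 0 + Q * t) / Q = t := by
      rw [Nat.add_mul_div_left _ _ hQ, Nat.div_eq_of_lt h0, zero_add]
    refine ⟨g 0 + Q * t, ?_, fun k hk => ?_⟩
    · rw [pow_succ, ← Nat.div_lt_iff_lt_mul hQ, hdiv]
      exact ht
    · cases k with
      | zero => simp [Nat.mod_eq_of_lt h0]
      | succ k => rw [pow_succ', ← Nat.div_div_eq_div_mul, hdiv, h k (by omega)]

/-- Adding `1` to `t` changes the digit with index `k` exactly if there is a carry into it, that is,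
if `Q ^ k` divides `t + 1`. -/
theorem succ_div_pow_mod {Q t k : ℕ} (hQ : 0 < Q) :
    (Q ^ k ∣ t + 1 →
      (t / Q ^ k % Q + 1 < Q → (t + 1) / Q ^ k % Q = t / Q ^ k % Q + 1 ∧ ¬ Q ^ (k + 1) ∣ t + 1) ∧
      (¬ t / Q ^ k % Q + 1 < Q → (t + 1) / Q ^ k % Q = 0 ∧ Q ^ (k + 1) ∣ t + 1)) ∧
    (¬ Q ^ k ∣ t + 1 → (t + 1) / Q ^ k % Q = t / Q ^ k % Q ∧ ¬ Q ^ (k + 1) ∣ t + 1) := by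
  have hlt := Nat.mod_lt (t / Q ^ k) hQ
  refine ⟨fun h => ?_, fun h => ⟨by rw [Nat.succ_div_of_not_dvd h], fun h' =>
    h ((pow_dvd_pow Q k.le_succ).trans h')⟩⟩
  have hdvd : Q ^ (k + 1) ∣ t + 1 ↔ (t + 1) / Q ^ k % Q = 0 := by
    rw [← Nat.dvd_iff_mod_eq_zero, Nat.dvd_div_iff_mul_dvd h, pow_succ]
  rw [hdvd, Nat.succ_div_of_dvd h]
  refine ⟨fun h1 => ?_, fun h1 => ?_⟩
  · rw [← Nat.mod_add_mod, Nat.mod_eq_of_lt h1]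
    exact ⟨rfl, by omega⟩
  · have h2 : t / Q ^ k % Q + 1 = Q := by omega
    rw [← Nat.mod_add_mod, h2, Nat.mod_self]
    exact ⟨rfl, rfl⟩

/-- The position of `a 0 < ⋯ < a (q - 1)` in the colexicographic order of the `q`-element sets of
natural numbers. -/
def colexRank (q : ℕ) (a : ℕ → ℕ) : ℕ := ∑ k ∈ Finset.range q, (a k).choose (k + 1)

theorem colexRank_succ (q : ℕ) (a : ℕ → ℕ) :
    colexRank (q + 1) a = colexRank q a + (a q).choose (q + 1) := Finset.sum_range_succ _ _

theorem colexRank_lt {a : ℕ → ℕ} : ∀ {q N : ℕ}, (∀ k, k + 1 < q → a k < a (k + 1)) →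
    (∀ k, k + 1 = q → a k < N) → colexRank q a < N.choose q
  | 0, N, _, _ => by simp [colexRank]
  | q + 1, N, h, hN => by
    have ih := colexRank_lt (q := q) (N := a q) (fun k hk => h k (by omega))
      (fun k hk => hk ▸ h k (by omega))
    have h1 : (a q + 1).choose (q + 1) ≤ N.choose (q + 1) := Nat.choose_le_choose _ (hN q rfl)
    rw [Nat.choose_succ_succ'] at h1
    rw [colexRank_succ]
    omega

theorem choose_le_colexRank {a : ℕ → ℕ} {q N : ℕ} (h : N ≤ a q) :
    N.choose (q + 1) ≤ colexRank (q + 1) a :=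
  (Nat.choose_le_choose _ h).trans (by rw [colexRank_succ]; omega)

theorem colexRank_injective {a b : ℕ → ℕ} : ∀ {q : ℕ}, (∀ k, k + 1 < q → a k < a (k + 1)) →
    (∀ k, k + 1 < q → b k < b (k + 1)) → colexRank q a = colexRank q b → ∀ k < q, a k = b k
  | 0, _, _, _ => by simp
  | q + 1, ha, hb, h => by
    have hq : a q = b q := by
      rcases lt_trichotomy (a q) (b q) with h1 | h1 | h1
      · have h2 := colexRank_lt (N := b q) ha fun k hk => by rwa [Nat.succ_injective hk]
        have h3 := choose_le_colexRank (a := b) (le_refl (b q))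
        omega
      · exact h1
      · have h2 := colexRank_lt (N := a q) hb fun k hk => by rwa [Nat.succ_injective hk]
        have h3 := choose_le_colexRank (a := a) (le_refl (a q))
        omega
    rw [colexRank_succ, colexRank_succ, hq] at h
    intro k hk
    rcases Nat.lt_succ_iff_lt_or_eq.1 hk with hk | rfl
    · exact colexRank_injective (fun k hk => ha k (by omega)) (fun k hk => hb k (by omega))
        (Nat.add_right_cancel h) k hk
    · exact hq

theorem colexRank_of_consecutive {a : ℕ → ℕ} : ∀ {p : ℕ}, (∀ k < p, a (k + 1) = a k + 1) →
    colexRank (p + 1) a + 1 = (a p + 1).choose (p + 1)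
  | 0, _ => by simp [colexRank]
  | p + 1, h => by
    have ih := colexRank_of_consecutive (p := p) fun k hk => h k (by omega)
    rw [colexRank_succ, h p (by omega), Nat.choose_succ_succ' (a p + 1) (p + 1), ← ih]
    omega

/-- The successor in colexicographic order: the first element that can be increased is increased,
and the smaller ones are reset. -/
theorem colexRank_next {a a' : ℕ → ℕ} {p : ℕ} (h : ∀ k < p, a (k + 1) = a k + 1)
    (h1 : ∀ k < p, a' k = k) (h2 : a' p = a p + 1) : ∀ {q : ℕ}, p < q →
    (∀ k, p < k → k < q → a' k = a k) → colexRank q a' = colexRank q a + 1 := by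
  intro q hq
  induction q, hq using Nat.le_induction with
  | base =>
    intro _
    rw [colexRank_of_consecutive h, colexRank_succ, h2, add_eq_right]
    exact Finset.sum_eq_zero fun k hk => by
      rw [h1 k (Finset.mem_range.1 hk), Nat.choose_succ_self]
  | succ q hq ih =>
    intro h3
    rw [colexRank_succ, colexRank_succ, ih fun k hk hk' => h3 k hk (by omega), h3 q hq (by omega)]
    omega

/-- The factorial gained by choosing sets instead of tuples absorbs the powers of the
dimension. -/
theorem exists_enumeration_bound (r : ℕ) : ∃ C : ℕ, ∀ n m : ℕ, 0 < r → r ≤ n →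
    (2 * (r + (m + 1) + n)).choose (m + 1) * (2 * r * (2 * (r + (m + 1) + n)) ^ (r - 1)) *
      (r + (m + 1)) ^ 3 ≤ C * (n + m) ^ (r + m) := by
  obtain ⟨K, hK⟩ := exists_nat_ge (Real.exp 48)
  refine ⟨2 * r * (6 ^ r * (r + 1) ^ 3 * K), fun n m hr hn => ?_⟩
  have hfac : 48 ^ m ≤ K * (m + 1).factorial := by
    have h1 : (48 : ℝ) ^ (m + 1) / (m + 1).factorial ≤ K :=
      (Real.pow_div_factorial_le_exp 48 (by norm_num) (m + 1)).trans hK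
    rw [div_le_iff₀ (by positivity)] at h1
    have h2 : 48 ^ (m + 1) ≤ K * (m + 1).factorial := by exact_mod_cast h1
    exact (Nat.pow_le_pow_right (by norm_num) m.le_succ).trans h2
  set Q := 2 * (r + (m + 1) + n) with hQ
  have hQ6 : Q ≤ 6 * (n + m) := by omega
  have hd : r + (m + 1) ≤ (r + 1) * 2 ^ m := by
    have h1 : m + 1 ≤ 2 ^ m := Nat.lt_two_pow_self
    have h2 : r + (m + 1) ≤ (r + 1) * (m + 1) := by nlinarith
    exact h2.trans (Nat.mul_le_mul_left _ h1)
  have hchoose : Q.choose (m + 1) * (m + 1).factorial ≤ Q ^ (m + 1) := by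
    rw [mul_comm, ← Nat.descFactorial_eq_factorial_mul_choose]
    exact Nat.descFactorial_le_pow _ _
  refine Nat.le_of_mul_le_mul_right ?_ (Nat.factorial_pos (m + 1))
  calc Q.choose (m + 1) * (2 * r * Q ^ (r - 1)) * (r + (m + 1)) ^ 3 * (m + 1).factorial
      = 2 * r * (Q.choose (m + 1) * (m + 1).factorial * Q ^ (r - 1)) * (r + (m + 1)) ^ 3 := by ring
    _ ≤ 2 * r * (Q ^ (m + 1) * Q ^ (r - 1)) * ((r + 1) * 2 ^ m) ^ 3 := by gcongr
    _ = 2 * r * Q ^ (r + m) * ((r + 1) * 2 ^ m) ^ 3 := by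
      rw [← pow_add, show m + 1 + (r - 1) = r + m by omega]
    _ ≤ 2 * r * (6 * (n + m)) ^ (r + m) * ((r + 1) * 2 ^ m) ^ 3 := by gcongr
    _ = 2 * r * (6 ^ r * (r + 1) ^ 3 * 48 ^ m) * (n + m) ^ (r + m) := by
      rw [mul_pow, mul_pow, ← pow_mul, mul_comm m 3, pow_mul, pow_add,
        show (48 : ℕ) = 6 * 2 ^ 3 by norm_num, mul_pow]
      ring
    _ ≤ 2 * r * (6 ^ r * (r + 1) ^ 3 * (K * (m + 1).factorial)) * (n + m) ^ (r + m) := by gcongr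
    _ = 2 * r * (6 ^ r * (r + 1) ^ 3 * K) * (n + m) ^ (r + m) * (m + 1).factorial := by ring

/-! ### Enumeration of the selections -/

section Machine

variable {r n m : ℕ} {O : Oracles r n m}
variable {A : Matrix (Fin r) (Fin n) ℝ} {M : Matrix (Fin m) (Fin n) ℝ}

/-- The digit string in integer array `7` is increased by `1`; integer scalar `11` holds the
carry. -/
def odometerProg : Prog :=
  .seq (.setNat 11 (.const 0) (.const 1)) <|
  forLoop 23 (.get 0 (.const 0))
    (.branch (.natLt (.const 0) (nv 11))
      (.seq (.setNat 7 (nv 23) (.add (.get 7 (nv 23)) (.const 1)))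
        (.branch (.natLt (.get 7 (nv 23)) (nv 5)) (.setNat 11 (.const 0) (.const 0))
          (.setNat 7 (nv 23) (.const 0))))
      skip)

theorem runs_odometer {s : State} (hs : Env A M s) {W : ℕ} (hW : 1 ≤ W) (hrW : r ≤ W) {t : ℕ}
    (ht : ∀ k < r, s.nat 7 k = t / (2 * (r + (m + 1) + n)) ^ k % (2 * (r + (m + 1) + n))) :
    Runs O odometerProg s (W * 100) (fun s' => Same [7, 11, 23, 28] [] s s' ∧
      ∀ k < r, s'.nat 7 k = (t + 1) / (2 * (r + (m + 1) + n)) ^ k % (2 * (r + (m + 1) + n))) := by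
  have hQ5 := hs.hQ
  set Q := 2 * (r + (m + 1) + n) with hQ
  have hQ0 : 0 < Q := by omega
  refine Runs.seq (T := 3) (T' := W * (40 + 40)) (by omega) (Runs.setNat (by decide) (P := fun s' =>
    Same [11] [] s s' ∧ s'.nat 11 0 = 1) ⟨Same.setNat _ _ _ (by simp), by simp [NExp.eval]⟩) ?_
  rintro s₁ ⟨hs₁, hc₁⟩
  have h7 : s₁.nat 7 = s.nat 7 := hs₁.nat 7 (by decide)
  refine Runs.mono (Runs.forLoop W [7, 11, 28] [] (N := r) (fun k s' =>
    (∀ j < r, s'.nat 7 j = if j < k then (t + 1) / Q ^ j % Q else t / Q ^ j % Q) ∧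
    (s'.nat 11 0 ≠ 0 ↔ Q ^ k ∣ t + 1)) hrW hW (by decide) (by decide) ?_ ?_ ?_ ?_) le_rfl ?_
  · intro s' hs'
    simp only [NExp.eval]
    rw [hs'.nat 0 (by decide), hs₁.nat 0 (by decide), hs.hr]
  · intro k s' x h
    simpa [setNat_nat] using h
  · simpa [hc₁, h7] using ht
  · rintro k hk s' hs' hk23 ⟨hdig, hcar⟩
    obtain ⟨hyes, hno⟩ := succ_div_pow_mod (Q := Q) (t := t) (k := k) hQ0
    have h5 : s'.nat 5 0 = Q := by rw [hs'.nat 5 (by decide), hs₁.nat 5 (by decide), hQ5]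
    have hdk : s'.nat 7 k = t / Q ^ k % Q := by rw [hdig k hk, if_neg (lt_irrefl k)]
    refine Runs.branch 30 (by decide) (fun hc => ?_) (fun hc => ?_)
    · simp only [Test.holds, NExp.eval] at hc
      obtain ⟨h1, h2⟩ := hyes (hcar.1 (by omega))
      refine Runs.seq (T := 10) (T' := 20) (by norm_num) (P := fun s'' => s'' = s'.setNat 7 k
        (t / Q ^ k % Q + 1)) (Runs.setNat (by decide) (by simp only [NExp.eval, hk23, hdk])) ?_
      rintro s'' rfl
      refine Runs.branch 10 (by decide) (fun hc' => ?_) (fun hc' => ?_)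
      · simp only [Test.holds, NExp.eval] at hc'
        simp only [setNat_nat] at hc'
        simp [hk23, h5] at hc'
        obtain ⟨h3, h4⟩ := h1 hc'
        refine Runs.setNat (by decide) ⟨(Same.setNat (ns := [7, 11, 28]) (rs := []) _ _ _
          (by simp)).trans (Same.setNat (ns := [7, 11, 28]) (rs := []) _ _ _ (by simp)) (by simp)
          (by simp) (by simp) (by simp), fun j hj => ?_, by simpa [NExp.eval] using h4⟩
        simp only [NExp.eval, setNat_nat]
        rcases lt_trichotomy j k with h | rfl | h
        · simp [h.ne, hdig j hj, h, show j < k + 1 by omega]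
        · simp [h3]
        · simp [h.ne', hdig j hj, show ¬ j < k by omega, show ¬ j < k + 1 by omega]
      · simp only [Test.holds, NExp.eval] at hc'
        simp only [setNat_nat] at hc'
        simp [hk23, h5] at hc'
        obtain ⟨h3, h4⟩ := h2 (by omega)
        refine Runs.setNat (by decide) ⟨(Same.setNat (ns := [7, 11, 28]) (rs := []) _ _ _
          (by simp)).trans (Same.setNat (ns := [7, 11, 28]) (rs := []) _ _ _ (by simp)) (by simp)
          (by simp) (by simp) (by simp), fun j hj => ?_, ?_⟩
        · simp only [NExp.eval, setNat_nat]
          rcases lt_trichotomy j k with h | rfl | h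
          · simp [h.ne, hk23, hdig j hj, h, show j < k + 1 by omega]
          · simp [h3, hk23]
          · simp [h.ne', hk23, hdig j hj, show ¬ j < k by omega, show ¬ j < k + 1 by omega]
        · simp only [NExp.eval, setNat_nat]
          simpa [h4] using (by omega : s'.nat 11 0 ≠ 0)
    · simp only [Test.holds, NExp.eval] at hc
      obtain ⟨h1, h2⟩ := hno fun h => hc (by have := hcar.2 h; omega)
      refine Runs.mono Runs.skip (by norm_num) fun s'' hs'' => ?_
      have e7 : s''.nat 7 = s'.nat 7 := hs''.nat 7 (by decide)
      have e11 : s''.nat 11 = s'.nat 11 := hs''.nat 11 (by decide)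
      refine ⟨hs''.mono (by simp) (by simp), fun j hj => ?_, ?_⟩
      · rw [e7, hdig j hj]
        rcases lt_trichotomy j k with h | rfl | h
        · simp [h, show j < k + 1 by omega]
        · simp [h1]
        · simp [show ¬ j < k by omega, show ¬ j < k + 1 by omega]
      · rw [e11]
        exact ⟨fun h => absurd h (by omega), fun h => absurd h h2⟩
  · rintro s' ⟨h1, h2, -⟩
    exact ⟨hs₁.trans h1 (by simp) (by simp) (by simp) (by simp), fun k hk => by
      rw [h2 k hk, if_pos hk]⟩

/-- All digit strings of length `r` with small leading digit are processed with the current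
increasing sequence in integer array `6`. -/
def stringsProg : Prog :=
  .seq (forLoop 23 (.get 0 (.const 0)) (.setNat 7 (nv 23) (.const 0)))
    (.loop (.natLt (.get 7 (.sub (.get 0 (.const 0)) (.const 1)))
        (.add (.get 0 (.const 0)) (.get 0 (.const 0))))
      (.seq candidateProg odometerProg))

theorem runs_strings (hr : 0 < r) {b : Fin m → ℝ} {f : (Fin r → ℝ) → ℝ} {X : Set (Fin n → ℝ)}
    (hX : IsBinary X) (hO : O.SolvesFixedSupport A f X) (hLP : O.SolvesLP A M b X)
    {W : ℕ} (hW : O.T₁ + O.LP = W) (hnW : n ≤ W) (hrW : r ≤ W) {s : State} (hs : Env A M s)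
    (h6 : ∀ k < m + 1, s.nat 6 k < 2 * (r + (m + 1) + n)) (hv : Valid A f X s) :
    Runs O stringsProg s (W * 60 + (2 * r * (2 * (r + (m + 1) + n)) ^ (r - 1) * (20 +
        ((r + (m + 1)) * ((r + (m + 1)) * ((r + (m + 1)) * (W * 4000))) + W * 100)) + 20))
      (fun s' => Env A M s' ∧ s'.nat 6 = s.nat 6 ∧ Valid A f X s' ∧
        (∀ t, Beats t s → Beats t s') ∧
        ∀ g : ℕ → ℕ, (∀ k < r, g k < 2 * (r + (m + 1) + n)) → g (r - 1) < 2 * r →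
          Decisive A M b f X (s.nat 6) g → ∀ z ∈ X, Beats (f (A *ᵥ z)) s') := by
  have hW1 : 1 ≤ W := by omega
  have hQr : 2 * r < 2 * (r + (m + 1) + n) := by omega
  set Q := 2 * (r + (m + 1) + n) with hQ
  have hQ0 : 0 < Q := by omega
  refine Runs.seq (T := W * (20 + 40)) le_rfl (Runs.forLoop W [7] [] (N := r) (fun k s' =>
    ∀ j < k, s'.nat 7 j = 0) hrW hW1 (by decide) (by decide) ?_ ?_ (by simp) ?_) ?_
  · intro s' hs'
    simp only [NExp.eval]
    rw [hs'.nat 0 (by decide), hs.hr]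
  · intro k s' x h j hj
    simpa [setNat_nat] using h j hj
  · intro k hk s' hs' hk23 hφ
    refine Runs.setNat (by decide) ⟨Same.setNat _ _ _ (by simp), fun j hj => ?_⟩
    simp only [NExp.eval, hk23, setNat_nat]
    by_cases hjk : j = k
    · simp [hjk]
    · simpa [hjk] using hφ j (by omega)
  rintro s₁ ⟨hs₁, h7⟩
  have e6 : s₁.nat 6 = s.nat 6 := hs₁.nat 6 (by decide)
  have e8 : s₁.nat 8 0 = s.nat 8 0 := by rw [hs₁.nat 8 (by decide)]
  have e6' : s₁.real 6 = s.real 6 := hs₁.real 6 (by decide)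
  refine Runs.mono (Runs.loop (N := 2 * r * Q ^ (r - 1))
      (T := (r + (m + 1)) * ((r + (m + 1)) * ((r + (m + 1)) * (W * 4000))) + W * 100)
      (fun t s' => Env A M s' ∧
      s'.nat 6 = s.nat 6 ∧ (∀ k < r, s'.nat 7 k = t / Q ^ k % Q) ∧ Valid A f X s' ∧
      (∀ t, Beats t s → Beats t s') ∧ ∀ u < t, ∀ g : ℕ → ℕ, (∀ k < r, u / Q ^ k % Q = g k) →
        Decisive A M b f X (s.nat 6) g → ∀ z ∈ X, Beats (f (A *ᵥ z)) s') ?_ ?_ ?_ ?_) ?_ ?_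
  · exact ⟨hs.same hs₁ (by decide) (by decide) (by decide) (by decide) (by decide), e6,
      fun k hk => by simp [h7 k hk], (valid_congr e8 e6').2 hv,
      fun t ht => (beats_congr e8 e6').2 ht, by simp⟩
  · rintro t ht s' ⟨hE, -, hdig, -⟩
    simp only [Test.holds, NExp.eval, hE.hr]
    rw [hdig _ (by omega)]
    have h1 : t / Q ^ (r - 1) < 2 * r := by rwa [Nat.div_lt_iff_lt_mul (by positivity)]
    -- The leading digit does not wrap around before the loop ends, as `2 r < Q`.
    rw [Nat.mod_eq_of_lt (by omega)]
    omega
  · rintro s' ⟨hE, -, hdig, -⟩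
    simp only [Test.holds, NExp.eval, hE.hr]
    rw [hdig _ (by omega), Nat.mul_div_cancel _ (by positivity), Nat.mod_eq_of_lt (by omega)]
    omega
  · rintro t ht s' ⟨hE, h6', hdig, hval, hmono, hbest⟩
    refine Runs.seq le_rfl (runs_candidate hX hO hLP hW hW1 hnW hE (by rwa [h6']) fun k hk => by
      rw [hdig k hk]
      exact Nat.mod_lt _ hQ0) ?_
    rintro s₂ ⟨hs₂, hval₂, hmono₂, hdec⟩
    have h7' : s₂.nat 7 = s'.nat 7 := hs₂.nat 7 (by decide)
    have hE₂ := hE.same hs₂ (by decide) (by decide) (by decide) (by decide) (by decide)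
    refine Runs.mono (runs_odometer hE₂ hW1 hrW (t := t) (by rwa [h7'])) le_rfl ?_
    rintro s₃ ⟨hs₃, hdig₃⟩
    have f8 : s₃.nat 8 0 = s₂.nat 8 0 := by rw [hs₃.nat 8 (by decide)]
    have f6 : s₃.real 6 = s₂.real 6 := hs₃.real 6 (by decide)
    refine ⟨hE₂.same hs₃ (by decide) (by decide) (by decide) (by decide) (by decide), ?_, hdig₃,
      (valid_congr f8 f6).2 (hval₂ hval), fun t ht => (beats_congr f8 f6).2 (hmono₂ t (hmono t ht)),
      fun u hu g hg hdecg z hz => (beats_congr f8 f6).2 ?_⟩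
    · rw [hs₃.nat 6 (by decide), hs₂.nat 6 (by decide), h6']
    · rcases Nat.lt_succ_iff_lt_or_eq.1 hu with hu | rfl
      · exact hmono₂ _ (hbest u hu g hg hdecg z hz)
      · exact hdec (h6' ▸ hdecg.congr (fun _ _ => rfl) fun k hk => by rw [hdig k hk, hg k hk]) z hz
  · exact Nat.add_le_add (Nat.mul_le_mul_left _ (Nat.add_le_add_right (by decide) _)) (by decide)
  · rintro s' ⟨h1, h2, -, h3, h4, h5⟩
    refine ⟨h1, h2, h3, h4, fun g hg hgr hdec => ?_⟩
    obtain ⟨t, ht, htg⟩ := exists_digits r g hg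
    refine h5 t ?_ g htg hdec
    have h6 : t / Q ^ (r - 1) < Q := by
      rw [Nat.div_lt_iff_lt_mul (by positivity), ← pow_succ', Nat.sub_add_cancel hr]
      exact ht
    rwa [← Nat.div_lt_iff_lt_mul (by positivity), ← Nat.mod_eq_of_lt h6, htg _ (by omega)]

/-- The increasing sequence in integer array `6` is replaced by its successor in colexicographic
order. -/
def nextProg : Prog :=
  .seq (.setNat 12 (.const 0) (.const 0)) <|
  .seq (.loop (.natLt (.get 6 (.add (nv 12) (.const 1))) (.add (.get 6 (nv 12)) (.const 2)))
    (.seq (.setNat 6 (nv 12) (nv 12)) (.setNat 12 (.const 0) (.add (nv 12) (.const 1)))))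
  (.setNat 6 (nv 12) (.add (.get 6 (nv 12)) (.const 1)))

/-- `a 0 < ⋯ < a m < Q + 1 = a (m + 1)`, where the last entry is a sentinel. -/
structure IsSequence (m Q : ℕ) (a : ℕ → ℕ) : Prop where
  lt : ∀ k < m + 1, a k < a (k + 1)
  last : a (m + 1) = Q + 1

theorem IsSequence.le_last {m Q : ℕ} {a : ℕ → ℕ} (h : IsSequence m Q a) {k : ℕ} (hk : k ≤ m) :
    a k ≤ a m := by
  have key : ∀ j, k ≤ j → j ≤ m → a k ≤ a j := fun j hj => by
    induction j, hj using Nat.le_induction with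
    | base => exact fun _ => le_rfl
    | succ j _ ih => exact fun hjm => (ih (by omega)).trans (h.lt j (by omega)).le
  exact key m hk le_rfl

theorem runs_next {s : State} {Q : ℕ} (ha : IsSequence m Q (s.nat 6)) (hlast : s.nat 6 m < Q) :
    Runs O nextProg s ((m + 1) * 60) (fun s' => Same [6, 12] [] s s' ∧
      IsSequence m Q (s'.nat 6) ∧
      colexRank (m + 1) (s'.nat 6) = colexRank (m + 1) (s.nat 6) + 1) := by
  classical
  set a := s.nat 6 with hadef
  -- The first element that can be increased; the sentinel ends the search in any case.
  have hex : ∃ p, a p + 1 < a (p + 1) := ⟨m, by rw [ha.last]; omega⟩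
  set p := Nat.find hex with hp
  have hp1 : a p + 1 < a (p + 1) := Nat.find_spec hex
  have hp2 : ∀ k < p, ¬ a k + 1 < a (k + 1) := fun k hk => Nat.find_min hex hk
  have hpm : p ≤ m := Nat.find_min' hex (by rw [ha.last]; omega)
  have hcons : ∀ k < p, a (k + 1) = a k + 1 := fun k hk => by
    have h1 := ha.lt k (by omega)
    have h2 := hp2 k hk
    omega
  refine Runs.seq (T := 3) (T' := (m + 1) * 60 - 3) (by omega) (Runs.setNat (by decide)
    (P := fun s' => s' = s.setNat 12 0 0) rfl) ?_
  rintro s₁ rfl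
  refine Runs.seq (T := p * (11 + 12) + 11) (T' := 10) (by omega) (Runs.loop (fun i s' =>
    Same [6, 12] [] s s' ∧ s'.nat 12 0 = i ∧ ∀ k, s'.nat 6 k = if k < i then k else a k)
    ⟨Same.setNat _ _ _ (by simp), by simp, by simp [setNat_nat, hadef]⟩ ?_ ?_ ?_) ?_
  · rintro i hi s' ⟨-, h12, h6⟩
    simp only [Test.holds, NExp.eval, h12, h6]
    rw [if_neg (by omega), if_neg (by omega), hcons i hi]
    omega
  · rintro s' ⟨-, h12, h6⟩
    simp only [Test.holds, NExp.eval, h12, h6]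
    rw [if_neg (by omega), if_neg (by omega)]
    omega
  · rintro i hi s' ⟨hs', h12, h6⟩
    refine Runs.seq (T := 6) (T' := 6) (by norm_num) (P := fun s'' => s'' = s'.setNat 6 i i)
      (Runs.setNat (by decide) (by simp only [NExp.eval, h12])) ?_
    rintro s'' rfl
    refine Runs.setNat (by decide) ⟨(hs'.trans (Same.setNat (ns := [6, 12]) (rs := []) _ _ _
      (by simp)) (by simp) (by simp) (by simp) (by simp) (ns'' := [6, 12]) (rs'' := [])).trans
      (Same.setNat (ns := [6, 12]) (rs := []) _ _ _ (by simp)) (by simp) (by simp) (by simp)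
      (by simp), ?_, fun k => ?_⟩
    · simp [NExp.eval, setNat_nat, h12]
    · simp only [NExp.eval, setNat_nat, h6]
      rcases lt_trichotomy k i with h | rfl | h
      · simp [h, h.ne, show k < i + 1 by omega]
      · simp
      · simp [h.ne', show ¬ k < i by omega, show ¬ k < i + 1 by omega]
  · rintro s' ⟨hs', h12, h6⟩
    have e : ∀ k, (s'.setNat 6 p (a p + 1)).nat 6 k =
        if k < p then k else if k = p then a p + 1 else a k := fun k => by
      rw [setNat_nat, h6]
      rcases lt_trichotomy k p with h | rfl | h
      · simp [h, h.ne]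
      · simp
      · simp [h.ne', show ¬ k < p by omega]
    have e0 : ∀ k < p, (s'.setNat 6 p (a p + 1)).nat 6 k = k := fun k hk => by rw [e, if_pos hk]
    have e1 : (s'.setNat 6 p (a p + 1)).nat 6 p = a p + 1 := by simp
    have e2 : ∀ k, p < k → (s'.setNat 6 p (a p + 1)).nat 6 k = a k := fun k hk => by
      rw [e, if_neg (by omega), if_neg (by omega)]
    have hge : ∀ k ≤ p, k ≤ a k := by
      intro k
      induction k with
      | zero => intro _; omega
      | succ k ih =>
        intro hk
        have h1 := ih (by omega)
        have h2 := hcons k (by omega)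
        omega
    refine Runs.setNat (by decide) ?_
    have h6p : s'.nat 6 p = a p := by rw [h6, if_neg (lt_irrefl p)]
    simp only [NExp.eval, h12, h6p]
    refine ⟨hs'.trans (Same.setNat (ns := [6, 12]) (rs := []) _ _ _ (by simp)) (by simp) (by simp)
      (by simp) (by simp), ⟨fun k hk => ?_, ?_⟩, ?_⟩
    · have hpp := hge p le_rfl
      rcases lt_trichotomy (k + 1) p with h | h | h
      · rw [e0 k (by omega), e0 (k + 1) h]; omega
      · rw [e0 k (by omega), h, e1]; omega
      · rcases Nat.lt_succ_iff_lt_or_eq.1 h with h | rfl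
        · rw [e2 k h, e2 (k + 1) (by omega)]
          exact ha.lt k hk
        · rw [e1, e2 (p + 1) (by omega)]
          exact hp1
    · rw [e2 _ (by omega), ha.last]
    · exact colexRank_next hcons e0 e1 (by omega) fun k hk _ => e2 k hk

/-- The first increasing sequence is stored in integer array `6`. -/
def firstProg : Prog :=
  .seq (forLoop 23 (nv 4) (.setNat 6 (nv 23) (nv 23)))
    (.setNat 6 (nv 4) (.add (nv 5) (.const 1)))

theorem runs_first {s : State} (hs : Env A M s) :
    Runs O firstProg s ((m + 1) * 80) (fun s' => Same [6, 23] [] s s' ∧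
      IsSequence m (2 * (r + (m + 1) + n)) (s'.nat 6) ∧ colexRank (m + 1) (s'.nat 6) = 0) := by
  refine Runs.seq (T := (m + 1) * (20 + 40)) (T' := 20) (by omega) (Runs.forLoop (m + 1) [6] []
    (N := m + 1) (fun k s' => ∀ j < k, s'.nat 6 j = j) le_rfl (by omega) (by decide) (by decide) ?_
    ?_ (by simp) ?_) ?_
  · intro s' hs'
    simp only [NExp.eval]
    rw [hs'.nat 4 (by decide), hs.hq]
  · intro k s' x h j hj
    simpa [setNat_nat] using h j hj
  · intro k hk s' hs' hk23 hφ
    refine Runs.setNat (by decide) ⟨Same.setNat _ _ _ (by simp), fun j hj => ?_⟩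
    simp only [NExp.eval, hk23, setNat_nat]
    by_cases hjk : j = k
    · simp [hjk]
    · simpa [hjk] using hφ j (by omega)
  · rintro s₁ ⟨hs₁, h6⟩
    refine Runs.setNat (by decide) ?_
    simp only [NExp.eval]
    rw [hs₁.nat 4 (by decide), hs₁.nat 5 (by decide), hs.hq, hs.hQ]
    have e : ∀ k < m + 1, (s₁.setNat 6 (m + 1) (2 * (r + (m + 1) + n) + 1)).nat 6 k = k :=
      fun k hk => by simp [setNat_nat, hk.ne, h6 k hk]
    refine ⟨hs₁.trans (Same.setNat (ns := [6, 23]) (rs := []) _ _ _ (by simp)) (by simp) (by simp)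
      (by simp) (by simp), ⟨fun k hk => ?_, by simp⟩, ?_⟩
    · rw [e k hk]
      rcases Nat.lt_succ_iff_lt_or_eq.1 hk with h | rfl
      · rw [e (k + 1) (by omega)]
        omega
      · rw [setNat_nat_self]
        omega
    · exact Finset.sum_eq_zero fun k hk => by
        rw [e k (Finset.mem_range.1 hk), Nat.choose_succ_self]

/-- The algorithm: all pairs of an increasing sequence and a digit string are processed. -/
def solveProg : Prog :=
  .seq setupProg <| .seq firstProg <|
  .loop (.natLt (.get 6 (.sub (nv 4) (.const 1))) (nv 5)) (.seq stringsProg nextProg)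

theorem runs_solve (hr : 0 < r) {b : Fin m → ℝ} {f : (Fin r → ℝ) → ℝ} {S X : Set (Fin n → ℝ)}
    (hf : ConvexOn ℝ Set.univ f) (hS : IsBinary S) (hcom : StandardComonotone S)
    (hX : X = S ∩ polyhedron M b)
    (hconv : convexHull ℝ (S ∩ polyhedron M b) = convexHull ℝ S ∩ polyhedron M b)
    (hne : X.Nonempty) (hO : O.SolvesFixedSupport A f X) (hLP : O.SolvesLP A M b X)
    {W : ℕ} (hW : O.T₁ + O.LP = W) (hnW : n ≤ W) (hrn : r ≤ n) :
    Runs O solveProg (input A M b)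
      ((2 * (r + (m + 1) + n)).choose (m + 1) * (2 * r * (2 * (r + (m + 1) + n)) ^ (r - 1)) *
        (r + (m + 1)) ^ 3 * (10000 * W))
      (fun s => Valid A f X s ∧ ∀ z ∈ X, Beats (f (A *ᵥ z)) s) := by
  have hW1 : 1 ≤ W := by omega
  have hXb : IsBinary X := fun x hx => hS x (by rw [hX] at hx; exact hx.1)
  obtain ⟨a, g, ha1, ha2, hg1, hg2, hdec⟩ := exists_selection hr hf hS hcom hX hconv hne
  set d := r + (m + 1) with hd
  set Q := 2 * (d + n) with hQ
  set N₂ := 2 * r * Q ^ (r - 1) with hN₂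
  have hN₂1 : 1 ≤ N₂ := Nat.succ_le_of_lt (by positivity)
  have hN₁1 : 1 ≤ Q.choose (m + 1) := Nat.succ_le_of_lt (Nat.choose_pos (by omega))
  have hd1 : 1 ≤ d := by omega
  have hmd : m + 1 ≤ d := by omega
  set T := W * 60 + (N₂ * (20 + (d * (d * (d * (W * 4000))) + W * 100)) + 20) with hT
  -- Every term is at most a multiple of `N₁ N₂ d ^ 3 W`.
  have hbound : d * (d * W) * 1000 + ((m + 1) * 80 + (Q.choose (m + 1) * (10 + (T + (m + 1) * 60))
      + 10)) ≤ Q.choose (m + 1) * N₂ * d ^ 3 * (10000 * W) := by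
    generalize Q.choose (m + 1) = N₁ at hN₁1 ⊢
    have b1 : 1 * 1 * (d * (d * 1)) * W ≤ N₁ * N₂ * (d * (d * d)) * W := by gcongr
    have b2 : 1 * 1 * ((m + 1) * (1 * 1)) * 1 ≤ N₁ * N₂ * (d * (d * d)) * W := by gcongr
    have b3 : N₁ * 1 * (1 * (1 * 1)) * 1 ≤ N₁ * N₂ * (d * (d * d)) * W := by gcongr
    have b4 : N₁ * 1 * (1 * (1 * 1)) * W ≤ N₁ * N₂ * (d * (d * d)) * W := by gcongr
    have b5 : N₁ * N₂ * (1 * (1 * 1)) * 1 ≤ N₁ * N₂ * (d * (d * d)) * W := by gcongr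
    have b6 : N₁ * N₂ * (1 * (1 * 1)) * W ≤ N₁ * N₂ * (d * (d * d)) * W := by gcongr
    have b7 : N₁ * 1 * ((m + 1) * (1 * 1)) * 1 ≤ N₁ * N₂ * (d * (d * d)) * W := by gcongr
    have b8 : 1 * 1 * (1 * (1 * 1)) * 1 ≤ N₁ * N₂ * (d * (d * d)) * W := by gcongr
    have e : d ^ 3 = d * (d * d) := by ring
    rw [hT, e]
    clear_value d N₂
    linarith
  refine Runs.seq (T := d * (d * W) * 1000) (T' := (m + 1) * 80 + (Q.choose (m + 1) *
    (10 + (T + (m + 1) * 60)) + 10)) hbound (runs_setup b W hW1 hnW) ?_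
  rintro s₁ ⟨hE₁, h8⟩
  refine Runs.seq le_rfl (runs_first hE₁) ?_
  rintro s₂ ⟨hs₂, hseq₂, hrank₂⟩
  -- Iteration `t` processes the sequence of rank `t`.
  refine Runs.mono (Runs.loop (N := Q.choose (m + 1)) (T := T + (m + 1) * 60) (fun t s =>
    Env A M s ∧ IsSequence m Q (s.nat 6) ∧ colexRank (m + 1) (s.nat 6) = t ∧ Valid A f X s ∧
    (colexRank (m + 1) a < t → ∀ z ∈ X, Beats (f (A *ᵥ z)) s)) ?_ ?_ ?_ ?_) ?_ ?_
  · refine ⟨hE₁.same hs₂ (by decide) (by decide) (by decide) (by decide) (by decide), hseq₂,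
      hrank₂, fun h => absurd ?_ h, by simp⟩
    rw [hs₂.nat 8 (by decide), h8]
  · rintro t ht s ⟨hE, hseq, hrank, -⟩
    simp only [Test.holds, NExp.eval, hE.hq, hE.hQ, Nat.add_sub_cancel]
    by_contra hcon
    have : Q.choose (m + 1) ≤ _ := choose_le_colexRank (not_lt.1 hcon)
    omega
  · rintro s ⟨hE, hseq, hrank, -⟩
    simp only [Test.holds, NExp.eval, hE.hq, hE.hQ, Nat.add_sub_cancel]
    intro hcon
    refine (colexRank_lt (a := s.nat 6) (q := m + 1) (N := Q) (fun k hk => hseq.lt k (by omega))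
      fun k hk => ?_).ne hrank
    rwa [Nat.succ_injective hk]
  · rintro t ht s ⟨hE, hseq, hrank, hval, hbest⟩
    have hlast : s.nat 6 m < Q := by
      by_contra hcon
      have : Q.choose (m + 1) ≤ _ := choose_le_colexRank (not_lt.1 hcon)
      omega
    refine Runs.seq le_rfl (runs_strings hr hXb hO hLP hW hnW (hrn.trans hnW) hE
      (fun k hk => (hseq.le_last (Nat.lt_succ_iff.1 hk)).trans_lt hlast) hval) ?_
    rintro s₃ ⟨hE₃, h6, hval₃, hmono, hall⟩
    refine Runs.mono (runs_next (Q := Q) (by rwa [h6]) (by rwa [h6])) le_rfl ?_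
    rintro s₄ ⟨hs₄, hseq₄, hrank₄⟩
    have f8 : s₄.nat 8 0 = s₃.nat 8 0 := by rw [hs₄.nat 8 (by decide)]
    have f6 : s₄.real 6 = s₃.real 6 := hs₄.real 6 (by decide)
    refine ⟨hE₃.same hs₄ (by decide) (by decide) (by decide) (by decide) (by decide), hseq₄,
      by rw [hrank₄, h6, hrank], (valid_congr f8 f6).2 hval₃,
      fun hlt z hz => (beats_congr f8 f6).2 ?_⟩
    rcases Nat.lt_succ_iff_lt_or_eq.1 hlt with hlt | heq
    · exact hmono _ (hbest hlt z hz)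
    · refine hall g hg1 hg2 (Decisive.congr (a := a) (g := g) hdec (fun i hi => ?_)
        fun _ _ => rfl) z hz
      exact colexRank_injective (q := m + 1) (fun k hk => hseq.lt k (by omega))
        (fun k hk => ha1 k (k + 1) (by omega) hk) (hrank.trans heq.symm) i hi
  · exact Nat.add_le_add (Nat.mul_le_mul_left _ (Nat.add_le_add_right (by decide) _)) (by decide)
  · rintro s ⟨-, -, -, h1, h2⟩
    refine ⟨h1, h2 (colexRank_lt (fun k hk => ha1 k (k + 1) (by omega) hk) fun k hk => ?_)⟩
    exact ha2 k (by omega)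

end Machine

end ConvexMax

theorem mainTheorem12 :
    ∃ p : Prog, ∀ r : ℕ, 0 < r → ∃ C : ℕ, ∀ (n m : ℕ)
      (A : Matrix (Fin r) (Fin n) ℝ) (M : Matrix (Fin m) (Fin n) ℝ) (b : Fin m → ℝ)
      (f : (Fin r → ℝ) → ℝ) (S X : Set (Fin n → ℝ)) (O : Oracles r n m),
      A.rank = r →
      ConvexOn ℝ Set.univ f →
      IsBinary S →
      StandardComonotone S →
      X = S ∩ polyhedron M b →
      convexHull ℝ (S ∩ polyhedron M b) = convexHull ℝ S ∩ polyhedron M b →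
      (∃ x, IsMaximizer (fun y => f (A *ᵥ y)) X x) →
      O.SolvesFixedSupport A f X →
      O.SolvesLP A M b X →
      n ≤ O.T₁ + O.LP →
      ∃ (s : State) (t : ℕ), Exec O p (input A M b) s t ∧
        t ≤ C * (n + m) ^ (r + m) * (O.T₁ + O.LP) ∧
        IsMaximizer (fun y => f (A *ᵥ y)) X (outputPoint n s) ∧
        outputValue s = f (A *ᵥ outputPoint n s) := by
  refine ⟨solveProg, fun r hr => ?_⟩
  obtain ⟨C, hC⟩ := exists_enumeration_bound r
  refine ⟨C * 10000, fun n m A M b f S X O hA hf hS hcom hX hconv hopt hO hLP hn => ?_⟩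
  have hrn : r ≤ n := by
    rw [← hA]
    exact A.rank_le_width
  obtain ⟨x, hx, -⟩ := hopt
  obtain ⟨s, t, hexec, ht, hvalid, hbest⟩ :=
    runs_solve hr hf hS hcom hX hconv ⟨x, hx⟩ hO hLP rfl hn hrn
  obtain ⟨hmem, hval⟩ := hvalid (hbest x hx).1
  refine ⟨s, t, hexec, ht.trans ?_, ⟨hmem, fun z hz => ?_⟩, hval⟩
  · calc _ ≤ C * (n + m) ^ (r + m) * (10000 * (O.T₁ + O.LP)) :=
          Nat.mul_le_mul_right _ (hC n m hr hrn)
      _ = C * 10000 * (n + m) ^ (r + m) * (O.T₁ + O.LP) := by ring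
  · exact (hbest z hz).2.trans hval.le
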